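/- An instance of \textsc{Perfect Over-the-Rainbow Matching} consists of a finite simple graph $G=(V,E)$, a set of colors $\mathcal{C}=\{1,\dots,|\mathcal{C}|\}$, a function $\lambda\colon E\to 2^{\mathcal{C}}\setminus\{\emptyset\}$ assigning to each edge a non-empty set of allowed colors, weights $\gamma(e,c)\in\mathbb{Q}_{\ge 0}$ for all $e\in E$ and $c\in\lambda(e)$, and an integer $\ell\ge 0$. A perfect over-the-rainbow matching is a pair $(M,\xi)$ of a perfect matching $M\subseteq E$ of $G$ and a surjective function $\xi\colon M\to\mathcal{C}$ with $\xi(e)\in\lambda(e)$ for all $e\in M$; its weight is $\sum_{e\in M}\gamma(e,\xi(e))$. The task is to find a perfect over-the-rainbow matching of weight at most $\ell$, or to answer ``no''. Let $n=|V|$, let $D$ be the least common denominator of all the weights, and let $L=D\cdot\ell$ be the bound after the weights have been scaled to integers (so $L=\ell$ if the weights are integers). \textbf{Theorem.} For every constant $c\in\mathbb{N}$ there is a randomized algorithm (a program of a random access machine with unit-cost addition, subtraction, indirect addressing, tests and fair coin flips, working on natural numbers) and there are constants $A,b\in\mathbb{N}$ such that the following holds on every instance. For every outcome of the coin flips, the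 algorithm halts after at most $A\cdot 2^{|\mathcal{C}|}\cdot (n+1)^{b}\cdot (L+1)^{b}$ steps, that is, in time $2^{|\mathcal{C}|}\cdot n^{O(1)}\cdot L^{O(1)}$, and either outputs a perfect over-the-rainbow matching $(M,\xi)$ of weight at most $\ell$ or answers ``no''. If the instance has a perfect over-the-rainbow matching of weight at most $\ell$, then the algorithm answers ``no'' with probability at most $1/(n+L)^{c}$ (no condition if $n+L=0$ and $c\geq 1$). In particular, for integer weights the running time is $2^{|\mathcal{C}|}\cdot n^{O(1)}\cdot \ell^{O(1)}$ and the false-negative rate is at most $1/(n+\ell)^{c}$. -/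

import Mathlib

open scoped ENNReal NNRat

namespace RainbowMatching

noncomputable section

/-! ## The problem Perfect Over-the-Rainbow Matching -/

/-- An instance: a finite simple graph `G` on the vertices `0, …, n - 1`, the colors
`0, …, k - 1`, a nonempty set of allowed colors for each edge, a weight in `ℚ≥0` for each pair of
an edge and one of its allowed colors, and a bound `bound` on the weight. -/
structure Instance where
  n : ℕ
  k : ℕ
  G : SimpleGraph (Fin n)
  colors : G.edgeSet → Finset (Fin k)
  colors_nonempty : ∀ e, (colors e).Nonempty
  weight : (e : G.edgeSet) → colors e → ℚ≥0
  bound : ℕ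

/-- A perfect over-the-rainbow matching of `I`: a perfect matching `M` of the graph and a choice
of an allowed color for each edge of `M` such that every color is chosen at least once. -/
structure PerfectMatching (I : Instance) where
  M : I.G.Subgraph
  isPerfect : M.IsPerfectMatching
  color : (e : M.edgeSet) → I.colors ⟨e, M.edgeSet_subset e.2⟩
  surjective : ∀ c : Fin I.k, ∃ e : M.edgeSet, (color e : Fin I.k) = c

open Classical in
/-- The weight of a perfect over-the-rainbow matching. -/
def PerfectMatching.totalWeight {I : Instance} (R : PerfectMatching I) : ℚ≥0 :=
  ∑ e : R.M.edgeSet, I.weight ⟨e, R.M.edgeSet_subset e.2⟩ (R.color e)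

/-- The solutions of `I`: the perfect over-the-rainbow matchings of weight at most the bound. -/
def PerfectMatching.IsSolution {I : Instance} (R : PerfectMatching I) : Prop :=
  R.totalWeight ≤ (I.bound : ℚ≥0)

open Classical in
/-- The least common denominator of all weights of `I`; it is `1` if the weights are integers. -/
def Instance.denom (I : Instance) : ℕ :=
  (Finset.univ : Finset (Σ e : I.G.edgeSet, I.colors e)).lcm fun p => (I.weight p.1 p.2).den

/-- The bound on the weight after the weights and the bound have been multiplied by the least
common denominator of the weights, which makes all of them integers. -/
def Instance.scaledBound (I : Instance) : ℕ := I.denom * I.bound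

/-! ## Randomized random access machines -/

/-- Programs of a random access machine with natural numbers as its values. They use variables
`0, 1, 2, …` and arrays `0, 1, 2, …` of unbounded length (a program, being finite, mentions only
finitely many of both). There is no instruction for multiplication, so that `t` steps can
lengthen the numbers by at most `t` bits. -/
inductive Prog where
  /-- the variable `x` gets the constant value `c` -/
  | const (x c : ℕ)
  /-- `x := y + z` -/
  | add (x y z : ℕ)
  /-- `x := y - z`, and `x := 0` if `y < z` -/
  | sub (x y z : ℕ)
  /-- `x := a[y]` -/
  | load (x a y : ℕ)
  /-- `a[x] := y` -/
  | store (a x y : ℕ)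
  /-- `x` becomes a fair random bit -/
  | flip (x : ℕ)
  /-- first `p`, then `q` -/
  | seq (p q : Prog)
  /-- if the variable `x` is nonzero then `p`, else `q` -/
  | cond (x : ℕ) (p q : Prog)
  /-- while the variable `x` is nonzero, repeat `p` -/
  | loop (x : ℕ) (p : Prog)

/-- A state of the machine: the values of the variables and of the array entries, and the infinite
sequence of the random bits that have not been used yet. -/
@[ext] structure State where
  var : ℕ → ℕ
  arr : ℕ → ℕ → ℕ
  coins : ℕ → Bool

/-- Assign the value `v` to the variable `x`. -/
def State.setVar (s : State) (x v : ℕ) : State :=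
  { s with var := Function.update s.var x v }

/-- Assign the value `v` to the entry `i` of the array `a`. -/
def State.setArr (s : State) (a i v : ℕ) : State :=
  { s with arr := Function.update s.arr a (Function.update (s.arr a) i v) }

/-- Remove the first unused random bit. -/
def State.dropCoin (s : State) : State :=
  { s with coins := fun i => s.coins (i + 1) }

/-- `Exec p s s' t`: the program `p`, started in state `s`, halts in state `s'` after `t` steps.
Each elementary instruction and each test of a variable is one step. -/
inductive Exec : Prog → State → State → ℕ → Prop where
  | const (x c : ℕ) (s : State) : Exec (.const x c) s (s.setVar x c) 1
  | add (x y z : ℕ) (s : State) : Exec (.add x y z) s (s.setVar x (s.var y + s.var z)) 1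
  | sub (x y z : ℕ) (s : State) : Exec (.sub x y z) s (s.setVar x (s.var y - s.var z)) 1
  | load (x a y : ℕ) (s : State) : Exec (.load x a y) s (s.setVar x (s.arr a (s.var y))) 1
  | store (a x y : ℕ) (s : State) : Exec (.store a x y) s (s.setArr a (s.var x) (s.var y)) 1
  | flip (x : ℕ) (s : State) :
      Exec (.flip x) s (s.dropCoin.setVar x (if s.coins 0 then 1 else 0)) 1
  | seq {p q : Prog} {s s' s'' : State} {t t' : ℕ} (hp : Exec p s s' t) (hq : Exec q s' s'' t') :
      Exec (.seq p q) s s'' (t + t')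
  | condTrue {x : ℕ} {p q : Prog} {s s' : State} {t : ℕ} (hx : s.var x ≠ 0)
      (hp : Exec p s s' t) : Exec (.cond x p q) s s' (t + 1)
  | condFalse {x : ℕ} {p q : Prog} {s s' : State} {t : ℕ} (hx : s.var x = 0)
      (hq : Exec q s s' t) : Exec (.cond x p q) s s' (t + 1)
  | loopDone {x : ℕ} {p : Prog} {s : State} (hx : s.var x = 0) : Exec (.loop x p) s s 1
  | loopStep {x : ℕ} {p : Prog} {s s' s'' : State} {t t' : ℕ} (hx : s.var x ≠ 0)
      (hp : Exec p s s' t) (hl : Exec (.loop x p) s' s'' t') :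
      Exec (.loop x p) s s'' (t + t' + 1)

/-- The distribution of an infinite sequence of independent fair random bits. -/
def fairCoins : MeasureTheory.Measure (ℕ → Bool) :=
  MeasureTheory.Measure.infinitePi fun _ : ℕ => (PMF.uniformOfFintype Bool).toMeasure

/-! ## Input and output -/

open Classical in
/-- The weight of the edge between `u` and `v` in the color `c`, and `none` if `u` and `v` are not
adjacent vertices or `c` is not an allowed color of that edge. -/
def Instance.entry (I : Instance) (u v c : ℕ) : Option ℚ≥0 :=
  if h : u < I.n ∧ v < I.n ∧ c < I.k then
    if ha : s((⟨u, h.1⟩ : Fin I.n), (⟨v, h.2.1⟩ : Fin I.n)) ∈ I.G.edgeSet then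
      if hc : (⟨c, h.2.2⟩ : Fin I.k) ∈ I.colors ⟨_, ha⟩ then some (I.weight ⟨_, ha⟩ ⟨_, hc⟩)
      else none
    else none
  else none

/-- The state in which a program is started on the instance `I`. The variables `0`, `1`, `2` hold
the number of vertices, the number of colors, and the bound. The entry `(u * n + v) * k + c` of
the arrays `0` and `1` holds numerator and denominator of the weight of the edge between `u` and
`v` in the color `c`, where the denominator `0` says that there is no such edge or that `c` is not
an allowed color of it. All other variables and array entries are zero. -/
def Instance.start (I : Instance) (ω : ℕ → Bool) : State where
  var x := if x = 0 then I.n else if x = 1 then I.k else if x = 2 then I.bound else 0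
  arr a i :=
    let w := I.entry (i / I.k / I.n) (i / I.k % I.n) (i % I.k)
    if a = 0 then w.elim 0 NNRat.num else if a = 1 then w.elim 0 NNRat.den else 0
  coins := ω

/-- The answer "no": the variable `0` is zero. -/
def AnswersNo (s : State) : Prop := s.var 0 = 0

/-- The state `s` presents the perfect over-the-rainbow matching `R`: the variable `0` is one, and
for each vertex `v` the entry `v` of array `0` is the vertex to which `v` is matched, and the entry
`v` of array `1` is the color chosen for the edge between them. -/
def Presents {I : Instance} (s : State) (R : PerfectMatching I) : Prop :=
  s.var 0 = 1 ∧ ∀ (v w : Fin I.n) (h : R.M.Adj v w),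
    s.arr 0 v = w ∧ s.arr 1 v = (R.color ⟨s(v, w), h⟩ : Fin I.k)

end

end RainbowMatching

/-!
The algorithm is algebraic: it reads a solution off determinants over `𝔽₂⟦X⟧`.

*Determinants count matchings.* Give each arc `e` (an edge with one of its two directions and one of
its allowed colors) an exponent `wt e`, the same for both directions. For a set `s` of colors let
`A_s` be the symmetric matrix whose entry at `(u, v)` is the sum of `X ^ wt e` over the arcs `e`
from `u` to `v` with a color in `s`. In the expansion of `det (1 - A_s)` a permutation with colored
arcs cancels with its inverse, as the characteristic is two, unless it is an involution whose two
arcs between each pair of partners have the same color (`det_sum_eq_sum_involution`). So the terms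
that remain are colored matchings, in which the fixed points are the unmatched vertices. In the sum
over all `2 ^ k` sets `s` a matching is counted once for each `s` that contains all of its colors,
hence an even number of times unless it uses every color (`sum_indicator_eq`). All exponents lie
between `n * H` and `n * H + H`; then a matching that misses a vertex has total exponent below `n *
(n * H)`, and the coefficients from there on count the perfect over-the-rainbow matchings modulo two
by their total exponent (`coeff_sum_borderDet`).

*Isolation.* The exponent of an arc consists of the offset `n * H`, a large multiple of its weight,
and a random number below `2 ^ m`, made symmetric by adding the one for the opposite arc. By the
isolation lemma (`isolation`) the matching of least total exponent is unique except with probability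
`E / 2 ^ m`, where `E = n * n * k` is the number of arcs; with `2 ^ m ≥ (n + L + 1) ^ (c + 3)` this
is at most `1 / (n + L) ^ c` (`fairCoins_badBlocks_le`). The factor of the weights exceeds the
random parts of all matchings, so that matching also has the least weight. The least degree `W ≥ n *
(n * H)` with a nonzero coefficient is its total exponent, and if an arc is left out, then the
coefficient at `W` vanishes if and only if the matching uses that arc (`Admissible.recover`). The
arcs selected by this test are checked for being a solution before they are output, so wrong random
choices can only lead to the answer "no" (`finish_sound`).

*Computing the determinants.* No division is needed: from `det (1 - A)` of the leading `h × h` block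
the next one follows by a linear recurrence that can be evaluated coefficient by coefficient
(`exists_borderDet_succ`), because all exponents are positive. Degrees matter only up to a bound
that is polynomial in `n` and `L`, and numbers modulo two are bits.

*Scaling.* The common denominator `D` is found by trying `1, 2, 3, …`. If the bound is positive,
then `D ≤ L`. If the bound is zero, then `L = 0` says nothing about `D`, but only arcs of weight
zero are of use, and the denominators may be replaced by one. More colors than vertices exclude a
solution; this case is answered at once, so that elsewhere `k ≤ n`.

*The machine.* The algorithm is written in a small language of bounded loops over named variables
and arrays. Its programs have a semantics as functions on stores, with a loop rule for invariants
(`Stmt.loop_rule`), a syntactic bound for the running time (`Stmt.time_le`), and a compilation to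
the random access machine that respects both (`Stmt.code_exec`). Only one loop, the one over the
sets of colors, has exponentially many rounds, and it is not nested in itself; this gives the factor
`2 ^ k`.
-/

namespace RainbowMatching

/-! ### A language of bounded programs -/

/-- The named variables of the algorithm. The first three hold the input, and `n` finally holds the
answer. -/
inductive Var
  | n | k | bound
  | E | D | go | e | j | r | w | u | v | c | L | L1 | B | p | m0 | m | Q | N | K | H | T | nT | X
  | nX | S | o | coin | f | s | h | pos | t | val | W | found | ok | sum
  deriving DecidableEq

/-- The named arrays of the algorithm. The first two hold the input (numerators and denominators)
and finally the output (partner and color of each vertex). -/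
inductive Arr
  | fst | snd
  | src | dst | col | mir | al | wa | R | wt | pw | off | chi | on | P | G | acc | sel | deg | mark
  deriving DecidableEq

/-- A state of the machine as seen by the named variables and arrays. -/
structure Store where
  var : Var → ℕ
  arr : Arr → ℕ → ℕ
  coins : ℕ → Bool

namespace Store

/-- Assign a value to a named variable. -/
def setVar (σ : Store) (x : Var) (v : ℕ) : Store :=
  { σ with var := Function.update σ.var x v }

/-- Assign a value to an entry of a named array. -/
def setArr (σ : Store) (a : Arr) (i v : ℕ) : Store :=
  { σ with arr := Function.update σ.arr a (Function.update (σ.arr a) i v) }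

/-- Remove the first unused random bit. -/
def dropCoin (σ : Store) : Store :=
  { σ with coins := fun i => σ.coins (i + 1) }

@[simp] theorem setVar_var (σ : Store) (x : Var) (v : ℕ) (y : Var) :
    (σ.setVar x v).var y = if y = x then v else σ.var y := by
  simp [setVar, Function.update_apply]
@[simp] theorem setVar_arr (σ : Store) (x : Var) (v : ℕ) : (σ.setVar x v).arr = σ.arr := rfl
@[simp] theorem setVar_coins (σ : Store) (x : Var) (v : ℕ) : (σ.setVar x v).coins = σ.coins := rfl
@[simp] theorem setArr_var (σ : Store) (a : Arr) (i v : ℕ) : (σ.setArr a i v).var = σ.var := rfl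
@[simp] theorem setArr_arr (σ : Store) (a : Arr) (i v : ℕ) (b : Arr) (j : ℕ) :
    (σ.setArr a i v).arr b j = if b = a ∧ j = i then v else σ.arr b j := by
  by_cases h : b = a
  · subst h
    simp [setArr, Function.update_apply]
  · simp [setArr, h]
@[simp] theorem setArr_coins (σ : Store) (a : Arr) (i v : ℕ) :
    (σ.setArr a i v).coins = σ.coins := rfl
@[simp] theorem dropCoin_var (σ : Store) : σ.dropCoin.var = σ.var := rfl
@[simp] theorem dropCoin_arr (σ : Store) : σ.dropCoin.arr = σ.arr := rfl
@[simp] theorem dropCoin_coins (σ : Store) :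
    σ.dropCoin.coins = fun i => σ.coins (i + 1) := rfl

end Store

/-- Arithmetic expressions with truncated subtraction. -/
inductive Exp
  | lit (c : ℕ)
  | get (x : Var)
  | plus (a b : Exp)
  | minus (a b : Exp)
  | elem (a : Arr) (i : Exp)

namespace Exp

instance : Add Exp := ⟨Exp.plus⟩
instance : Sub Exp := ⟨Exp.minus⟩

/-- The value of an expression. -/
def eval (σ : Store) : Exp → ℕ
  | lit c => c
  | get x => σ.var x
  | plus a b => a.eval σ + b.eval σ
  | minus a b => a.eval σ - b.eval σ
  | elem a i => σ.arr a (i.eval σ)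

@[simp] theorem eval_lit (σ : Store) (c : ℕ) : (lit c).eval σ = c := rfl
@[simp] theorem eval_get (σ : Store) (x : Var) : (get x).eval σ = σ.var x := rfl
@[simp] theorem eval_add (σ : Store) (a b : Exp) : (a + b).eval σ = a.eval σ + b.eval σ := rfl
@[simp] theorem eval_sub (σ : Store) (a b : Exp) : (a - b).eval σ = a.eval σ - b.eval σ := rfl
@[simp] theorem eval_elem (σ : Store) (a : Arr) (i : Exp) :
    (elem a i).eval σ = σ.arr a (i.eval σ) := rfl

/-- Negation; every number but `0` counts as true. -/
def not (a : Exp) : Exp := lit 1 - a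
/-- Conjunction. -/
def and (a b : Exp) : Exp := lit 1 - (not a + not b)
/-- The test `a ≤ b`. -/
def le (a b : Exp) : Exp := not (a - b)
/-- The test `a = b`. -/
def eq (a b : Exp) : Exp := not ((a - b) + (b - a))
/-- The sum modulo `2` of two bits. -/
def xor (a b : Exp) : Exp := (a - b) + (b - a)

@[simp] theorem eval_not (σ : Store) (a : Exp) :
    (not a).eval σ = if a.eval σ = 0 then 1 else 0 := by
  simp only [not, eval_sub, eval_lit]; split_ifs <;> omega
@[simp] theorem eval_and (σ : Store) (a b : Exp) :
    (and a b).eval σ = if a.eval σ ≠ 0 ∧ b.eval σ ≠ 0 then 1 else 0 := by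
  simp only [and, eval_sub, eval_lit, eval_add, eval_not]; split_ifs <;> omega
@[simp] theorem eval_le (σ : Store) (a b : Exp) :
    (le a b).eval σ = if a.eval σ ≤ b.eval σ then 1 else 0 := by
  simp only [le, eval_sub, eval_not, Nat.sub_eq_zero_iff_le]
@[simp] theorem eval_eq (σ : Store) (a b : Exp) :
    (eq a b).eval σ = if a.eval σ = b.eval σ then 1 else 0 := by
  simp only [eq, eval_sub, eval_add, eval_not]
  congr 1
  rw [eq_iff_iff]
  omega
@[simp] theorem eval_xor (σ : Store) (a b : Exp) :
    (xor a b).eval σ = (a.eval σ - b.eval σ) + (b.eval σ - a.eval σ) := rfl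

/-- The number of instructions that evaluate an expression. -/
def size : Exp → ℕ
  | lit _ => 1
  | get _ => 2
  | plus a b => a.size + b.size + 1
  | minus a b => a.size + b.size + 1
  | elem _ i => i.size + 1

end Exp

/-- Programs in which the number of rounds of each loop is known when the loop is entered. -/
inductive Stmt
  | skip
  /-- `x := e` -/
  | set (x : Var) (e : Exp)
  /-- `a[i] := e` -/
  | put (a : Arr) (i e : Exp)
  /-- `x` becomes a fair random bit -/
  | flip (x : Var)
  /-- `x := e * y` -/
  | mul (x : Var) (e : Exp) (y : Var)
  | seq (p q : Stmt)
  /-- if `e` is nonzero then `p`, else `q` -/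
  | ite (e : Exp) (p q : Stmt)
  /-- execute `p` for `i = 0, …, y - 1` -/
  | loop (i y : Var) (p : Stmt)

namespace Stmt

/-- Execute the statements of a list one after the other. -/
def block : List Stmt → Stmt
  | [] => skip
  | p :: l => seq p (block l)

/-- If `e` is nonzero then `p`. -/
def when (e : Exp) (p : Stmt) : Stmt := ite e p skip

/-- Apply `f 0, …, f (n - 1)` one after the other. -/
def iter (f : ℕ → Store → Store) (σ : Store) : ℕ → Store
  | 0 => σ
  | n + 1 => f n (iter f σ n)

/-- The effect of a program on the store. -/
def run : Stmt → Store → Store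
  | skip, σ => σ
  | set x e, σ => σ.setVar x (e.eval σ)
  | put a i e, σ => σ.setArr a (i.eval σ) (e.eval σ)
  | flip x, σ => σ.dropCoin.setVar x (if σ.coins 0 then 1 else 0)
  | mul x e y, σ => σ.setVar x (e.eval σ * σ.var y)
  | seq p q, σ => q.run (p.run σ)
  | ite e p q, σ => if e.eval σ ≠ 0 then p.run σ else q.run σ
  | loop i y p, σ => (iter (fun j τ => p.run (τ.setVar i j)) σ (σ.var y)).setVar i (σ.var y)

@[simp] theorem run_skip (σ : Store) : skip.run σ = σ := rfl
@[simp] theorem run_set (x : Var) (e : Exp) (σ : Store) :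
    (set x e).run σ = σ.setVar x (e.eval σ) := rfl
@[simp] theorem run_put (a : Arr) (i e : Exp) (σ : Store) :
    (put a i e).run σ = σ.setArr a (i.eval σ) (e.eval σ) := rfl
@[simp] theorem run_flip (x : Var) (σ : Store) :
    (flip x).run σ = σ.dropCoin.setVar x (if σ.coins 0 then 1 else 0) := rfl
@[simp] theorem run_mul (x : Var) (e : Exp) (y : Var) (σ : Store) :
    (mul x e y).run σ = σ.setVar x (e.eval σ * σ.var y) := rfl
@[simp] theorem run_seq (p q : Stmt) (σ : Store) : (seq p q).run σ = q.run (p.run σ) := rfl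
@[simp] theorem run_ite (e : Exp) (p q : Stmt) (σ : Store) :
    (ite e p q).run σ = if e.eval σ ≠ 0 then p.run σ else q.run σ := rfl
@[simp] theorem run_when (e : Exp) (p : Stmt) (σ : Store) :
    (when e p).run σ = if e.eval σ ≠ 0 then p.run σ else σ := rfl
@[simp] theorem run_block_nil (σ : Store) : (block []).run σ = σ := rfl
@[simp] theorem run_block_cons (p : Stmt) (l : List Stmt) (σ : Store) :
    (block (p :: l)).run σ = (block l).run (p.run σ) := rfl

/-- Whether the program assigns to the variable. -/
def writesVar : Stmt → Var → Bool
  | skip, _ => false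
  | set x _, z => x == z
  | put _ _ _, _ => false
  | flip x, z => x == z
  | mul x _ _, z => x == z
  | seq p q, z => p.writesVar z || q.writesVar z
  | ite _ p q, z => p.writesVar z || q.writesVar z
  | loop i _ p, z => i == z || p.writesVar z

/-- Whether the program assigns to entries of the array. -/
def writesArr : Stmt → Arr → Bool
  | skip, _ => false
  | set _ _, _ => false
  | put a _ _, b => a == b
  | flip _, _ => false
  | mul _ _ _, _ => false
  | seq p q, b => p.writesArr b || q.writesArr b
  | ite _ p q, b => p.writesArr b || q.writesArr b
  | loop _ _ p, b => p.writesArr b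

/-- Whether the program uses random bits. -/
def flips : Stmt → Bool
  | flip _ => true
  | seq p q => p.flips || q.flips
  | ite _ p q => p.flips || q.flips
  | loop _ _ p => p.flips
  | _ => false

/-- The variables that bound the number of rounds of the loops and of the multiplications. -/
def bounds : Stmt → List Var
  | mul _ _ y => [y]
  | seq p q => p.bounds ++ q.bounds
  | ite _ p q => p.bounds ++ q.bounds
  | loop _ y p => y :: p.bounds
  | _ => []

/-- The bounds of all loops are known from the start: no bound changes before the loop is over. -/
def wf : Stmt → Bool
  | seq p q => p.wf && q.wf && q.bounds.all fun z => !p.writesVar z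
  | ite _ p q => p.wf && q.wf
  | loop i y p => p.wf && i != y && !p.writesVar i && !p.writesVar y &&
      p.bounds.all fun z => !p.writesVar z && z != i
  | _ => true

/-- A bound for the number of steps in terms of the initial values of the variables. -/
def time (v : Var → ℕ) : Stmt → ℕ
  | skip => 1
  | set _ e => e.size + 2
  | put _ i e => i.size + e.size + 1
  | flip _ => 1
  | mul _ e y => e.size + 7 + v y * 4
  | seq p q => p.time v + q.time v
  | ite e p q => e.size + 1 + (p.time v + q.time v)
  | loop _ y p => 3 + v y * (p.time v + 4)

/-- `τ` agrees with `σ` on everything that `p` does not write. -/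
structure Frame (p : Stmt) (σ τ : Store) : Prop where
  var : ∀ x, p.writesVar x = false → τ.var x = σ.var x
  arr : ∀ a, p.writesArr a = false → τ.arr a = σ.arr a
  coins : p.flips = false → τ.coins = σ.coins

theorem Frame.refl (p : Stmt) (σ : Store) : p.Frame σ σ :=
  ⟨fun _ _ => rfl, fun _ _ => rfl, fun _ => rfl⟩

theorem Frame.trans {p : Stmt} {σ τ υ : Store} (h : p.Frame σ τ) (h' : p.Frame τ υ) :
    p.Frame σ υ :=
  ⟨fun x hx => (h'.var x hx).trans (h.var x hx), fun a ha => (h'.arr a ha).trans (h.arr a ha),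
    fun hc => (h'.coins hc).trans (h.coins hc)⟩

theorem iter_induction {f : ℕ → Store → Store} {σ : Store} (Inv : ℕ → Store → Prop) (n : ℕ)
    (h0 : Inv 0 σ) (hs : ∀ j < n, ∀ τ, Inv j τ → Inv (j + 1) (f j τ)) : Inv n (iter f σ n) := by
  induction n with
  | zero => exact h0
  | succ n ih => exact hs n (Nat.lt_succ_self n) _ (ih fun j hj => hs j (Nat.lt_succ_of_lt hj))

theorem frame (p : Stmt) (σ : Store) : p.Frame σ (p.run σ) := by
  induction p generalizing σ with
  | skip => exact Frame.refl _ _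
  | set x e =>
    refine ⟨fun z hz => ?_, fun _ _ => rfl, fun _ => rfl⟩
    have : z ≠ x := by rintro rfl; simp [writesVar] at hz
    simp [this]
  | put a i e =>
    refine ⟨fun z hz => rfl, fun b hb => ?_, fun _ => rfl⟩
    have : b ≠ a := by rintro rfl; simp [writesArr] at hb
    funext j
    simp [this]
  | flip x =>
    refine ⟨fun z hz => ?_, fun _ _ => rfl, fun h => by simp [flips] at h⟩
    have : z ≠ x := by rintro rfl; simp [writesVar] at hz
    simp [this]
  | mul x e y =>
    refine ⟨fun z hz => ?_, fun _ _ => rfl, fun _ => rfl⟩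
    have : z ≠ x := by rintro rfl; simp [writesVar] at hz
    simp [this]
  | seq p q hp hq =>
    refine ⟨fun z hz => ?_, fun a ha => ?_, fun hc => ?_⟩
    · simp only [writesVar, Bool.or_eq_false_iff] at hz
      exact ((hq _).var z hz.2).trans ((hp σ).var z hz.1)
    · simp only [writesArr, Bool.or_eq_false_iff] at ha
      exact ((hq _).arr a ha.2).trans ((hp σ).arr a ha.1)
    · simp only [flips, Bool.or_eq_false_iff] at hc
      exact ((hq _).coins hc.2).trans ((hp σ).coins hc.1)
  | ite e p q hp hq =>
    refine ⟨fun z hz => ?_, fun a ha => ?_, fun hc => ?_⟩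
    · simp only [writesVar, Bool.or_eq_false_iff] at hz
      rw [run_ite]; split_ifs
      exacts [(hp _).var z hz.1, (hq σ).var z hz.2]
    · simp only [writesArr, Bool.or_eq_false_iff] at ha
      rw [run_ite]; split_ifs
      exacts [(hp _).arr a ha.1, (hq σ).arr a ha.2]
    · simp only [flips, Bool.or_eq_false_iff] at hc
      rw [run_ite]; split_ifs
      exacts [(hp _).coins hc.1, (hq σ).coins hc.2]
  | loop i y p hp =>
    refine ⟨fun z hz => ?_, fun a ha => ?_, fun hc => ?_⟩
    · simp only [writesVar, Bool.or_eq_false_iff, beq_eq_false_iff_ne] at hz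
      simp only [run, Store.setVar_var, hz.1.symm, if_false]
      refine iter_induction (fun _ τ => τ.var z = σ.var z) _ rfl fun j _ τ h => ?_
      rw [(hp _).var z hz.2, Store.setVar_var, if_neg hz.1.symm, h]
    · simp only [run, Store.setVar_arr]
      refine iter_induction (fun _ τ => τ.arr a = σ.arr a) _ rfl fun j _ τ h => ?_
      rw [(hp _).arr a ha, Store.setVar_arr, h]
    · simp only [run, Store.setVar_coins]
      refine iter_induction (fun _ τ => τ.coins = σ.coins) _ rfl fun j _ τ h => ?_
      rw [(hp _).coins hc, Store.setVar_coins, h]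

theorem run_var {p : Stmt} {x : Var} (h : p.writesVar x = false) (σ : Store) :
    (p.run σ).var x = σ.var x := (p.frame σ).var x h

theorem run_arr {p : Stmt} {a : Arr} (h : p.writesArr a = false) (σ : Store) :
    (p.run σ).arr a = σ.arr a := (p.frame σ).arr a h

theorem run_coins {p : Stmt} (h : p.flips = false) (σ : Store) :
    (p.run σ).coins = σ.coins := (p.frame σ).coins h

/-- The rule for loops: the invariant `Inv j` holds after `j` rounds. In each round, everything that
the loop does not write has its initial value. -/
theorem loop_rule {i y : Var} {p : Stmt} {σ : Store} (Inv : ℕ → Store → Prop) (h0 : Inv 0 σ)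
    (hs : ∀ j < σ.var y, ∀ τ, (loop i y p).Frame σ τ → Inv j τ →
      Inv (j + 1) (p.run (τ.setVar i j))) :
    ∃ τ, (loop i y p).Frame σ τ ∧ Inv (σ.var y) τ ∧
      (loop i y p).run σ = τ.setVar i (σ.var y) := by
  have key := iter_induction (f := fun j τ => p.run (τ.setVar i j)) (σ := σ)
    (fun j τ => (loop i y p).Frame σ τ ∧ Inv j τ) (σ.var y) ⟨Frame.refl _ _, h0⟩ ?_
  · exact ⟨_, key.1, key.2, rfl⟩
  · rintro j hj τ ⟨hF, hI⟩
    refine ⟨hF.trans ⟨fun z hz => ?_, fun a ha => ?_, fun hc => ?_⟩, hs j hj τ hF hI⟩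
    · simp only [writesVar, Bool.or_eq_false_iff, beq_eq_false_iff_ne] at hz
      rw [(p.frame _).var z hz.2, Store.setVar_var, if_neg hz.1.symm]
    · rw [(p.frame _).arr a ha, Store.setVar_arr]
    · rw [(p.frame _).coins hc, Store.setVar_coins]

theorem time_congr (p : Stmt) {v v' : Var → ℕ} (h : ∀ x ∈ p.bounds, v x = v' x) :
    p.time v = p.time v' := by
  induction p with
  | mul x e y => simp [time, h y (by simp [bounds])]
  | seq p q hp hq =>
    simp only [bounds, List.mem_append] at h
    simp [time, hp fun x hx => h x (.inl hx), hq fun x hx => h x (.inr hx)]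
  | ite e p q hp hq =>
    simp only [bounds, List.mem_append] at h
    simp [time, hp fun x hx => h x (.inl hx), hq fun x hx => h x (.inr hx)]
  | loop i y p hp =>
    simp only [bounds, List.mem_cons] at h
    simp [time, h y (.inl rfl), hp fun x hx => h x (.inr hx)]
  | _ => rfl

/-- The constant factor of the bound for the running time in `time_le`. -/
def coef : Stmt → ℕ
  | skip => 1
  | set _ e => e.size + 2
  | put _ i e => i.size + e.size + 1
  | flip _ => 1
  | mul _ e _ => e.size + 11
  | seq p q => p.coef + q.coef
  | ite e p q => e.size + 1 + (p.coef + q.coef)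
  | loop _ _ p => 7 + p.coef

/-- The nesting depth of loops, apart from those over all sets of colors. -/
def deg : Stmt → ℕ
  | mul _ _ y => if y = .S then 0 else 1
  | seq p q => max p.deg q.deg
  | ite _ p q => max p.deg q.deg
  | loop _ y p => p.deg + if y = .S then 0 else 1
  | _ => 0

/-- The nesting depth of loops over all sets of colors. -/
def setDeg : Stmt → ℕ
  | mul _ _ y => if y = .S then 1 else 0
  | seq p q => max p.setDeg q.setDeg
  | ite _ p q => max p.setDeg q.setDeg
  | loop _ y p => p.setDeg + if y = .S then 1 else 0
  | _ => 0

/-- A bound for the running time that is polynomial in a bound `Z` for the number of rounds of the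
ordinary loops and in a bound `S` for the number of sets of colors. -/
theorem time_le (p : Stmt) {v : Var → ℕ} {Z S : ℕ} (hZ : 1 ≤ Z) (hS : 1 ≤ S)
    (h : ∀ x ∈ p.bounds, x ≠ .S → v x ≤ Z) (h' : v .S ≤ S ∨ .S ∉ p.bounds) :
    p.time v ≤ p.coef * (Z ^ p.deg * S ^ p.setDeg) := by
  have hpow : ∀ a b, 1 ≤ Z ^ a * S ^ b := fun a b =>
    Nat.one_le_iff_ne_zero.2 (by positivity)
  have hmono : ∀ {a b a' b'}, a ≤ a' → b ≤ b' → Z ^ a * S ^ b ≤ Z ^ a' * S ^ b' := by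
    intro a b a' b' h1 h2
    exact Nat.mul_le_mul (Nat.pow_le_pow_right hZ h1) (Nat.pow_le_pow_right hS h2)
  have hv : ∀ y ∈ p.bounds,
      v y ≤ Z ^ (if y = .S then 0 else 1) * S ^ (if y = .S then 1 else 0) := by
    intro y hy
    by_cases hyS : y = .S
    · subst hyS
      rcases h' with h' | h'
      · simpa using h'
      · exact absurd hy h'
    · simpa [hyS] using h y hy hyS
  induction p with
  | mul x e y =>
    have h1 := hv y (by simp [bounds])
    simp only [time, coef, deg, setDeg]
    have := hpow (if y = .S then 0 else 1) (if y = .S then 1 else 0)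
    nlinarith
  | seq p q hp hq =>
    simp only [bounds, List.mem_append, not_or] at h hv h'
    have h1 := hp (fun x hx => h x (.inl hx)) (h'.imp_right And.left) fun y hy => hv y (.inl hy)
    have h2 := hq (fun x hx => h x (.inr hx)) (h'.imp_right And.right) fun y hy => hv y (.inr hy)
    simp only [time, coef, deg, setDeg, Nat.add_mul]
    exact Nat.add_le_add
      (h1.trans (Nat.mul_le_mul_left _ (hmono (le_max_left _ _) (le_max_left _ _))))
      (h2.trans (Nat.mul_le_mul_left _ (hmono (le_max_right _ _) (le_max_right _ _))))
  | ite e p q hp hq =>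
    simp only [bounds, List.mem_append, not_or] at h hv h'
    have h1 := hp (fun x hx => h x (.inl hx)) (h'.imp_right And.left) fun y hy => hv y (.inl hy)
    have h2 := hq (fun x hx => h x (.inr hx)) (h'.imp_right And.right) fun y hy => hv y (.inr hy)
    simp only [time, coef, deg, setDeg, Nat.add_mul]
    refine Nat.add_le_add ?_ (Nat.add_le_add
      (h1.trans (Nat.mul_le_mul_left _ (hmono (le_max_left _ _) (le_max_left _ _))))
      (h2.trans (Nat.mul_le_mul_left _ (hmono (le_max_right _ _) (le_max_right _ _)))))
    have := hpow (max p.deg q.deg) (max p.setDeg q.setDeg)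
    nlinarith
  | loop i y p hp =>
    simp only [bounds, List.mem_cons, not_or] at h hv h'
    have h1 := hp (fun x hx => h x (.inr hx)) (h'.imp_right And.right) fun y hy => hv y (.inr hy)
    have h2 := hv y (.inl rfl)
    simp only [time, coef, deg, setDeg, pow_add]
    have h3 := hpow p.deg p.setDeg
    have h4 := hpow (if y = .S then 0 else 1) (if y = .S then 1 else 0)
    set a := Z ^ p.deg * S ^ p.setDeg
    set b := Z ^ (if y = .S then 0 else 1) * S ^ (if y = .S then 1 else 0)
    have h5 : p.time v + 4 ≤ (p.coef + 4) * a := by nlinarith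
    calc 3 + v y * (p.time v + 4) ≤ 3 * (a * b) + b * ((p.coef + 4) * a) :=
          Nat.add_le_add (by nlinarith [Nat.mul_le_mul h3 h4]) (Nat.mul_le_mul h2 h5)
      _ = (7 + p.coef) * (a * b) := by ring
      _ = _ := by simp only [a, b]; ring
  | skip => simpa [time, coef] using hpow _ _
  | set x e => exact Nat.le_mul_of_pos_right _ (hpow _ _)
  | put a i e => exact Nat.le_mul_of_pos_right _ (hpow _ _)
  | flip x => simpa [time, coef] using hpow _ _

end Stmt

/-! ### Compilation to the random access machine -/

theorem Exec.deterministic {p : Prog} {s s₁ s₂ : State} {t₁ t₂ : ℕ} (h₁ : Exec p s s₁ t₁)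
    (h₂ : Exec p s s₂ t₂) : s₁ = s₂ ∧ t₁ = t₂ := by
  induction h₁ generalizing s₂ t₂ with
  | const | add | sub | load | store | flip => cases h₂; exact ⟨rfl, rfl⟩
  | seq hp hq ihp ihq =>
    cases h₂ with
    | seq hp' hq' =>
      obtain ⟨rfl, rfl⟩ := ihp hp'
      obtain ⟨rfl, rfl⟩ := ihq hq'
      exact ⟨rfl, rfl⟩
  | condTrue hx hp ih =>
    cases h₂ with
    | condTrue _ hp' => obtain ⟨rfl, rfl⟩ := ih hp'; exact ⟨rfl, rfl⟩
    | condFalse hx' => exact absurd hx' hx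
  | condFalse hx hp ih =>
    cases h₂ with
    | condTrue hx' => exact absurd hx hx'
    | condFalse _ hp' => obtain ⟨rfl, rfl⟩ := ih hp'; exact ⟨rfl, rfl⟩
  | loopDone hx =>
    cases h₂ with
    | loopDone => exact ⟨rfl, rfl⟩
    | loopStep hx' => exact absurd hx hx'
  | loopStep hx hp hl ihp ihl =>
    cases h₂ with
    | loopDone hx' => exact absurd hx' hx
    | loopStep _ hp' hl' =>
      obtain ⟨rfl, rfl⟩ := ihp hp'
      obtain ⟨rfl, rfl⟩ := ihl hl'
      exact ⟨rfl, rfl⟩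

/-- The machine variable that holds a named variable. -/
def Var.idx (x : Var) : ℕ := x.ctorIdx

/-- The machine array that holds a named array. -/
def Arr.idx (a : Arr) : ℕ := a.ctorIdx

theorem Var.idx_injective : Function.Injective Var.idx := fun x y h => by
  have := congrArg Var.ofNat h
  rwa [Var.idx, Var.idx, Var.ofNat_ctorIdx, Var.ofNat_ctorIdx] at this

theorem Arr.idx_injective : Function.Injective Arr.idx := fun x y h => by
  have := congrArg Arr.ofNat h
  rwa [Arr.idx, Arr.idx, Arr.ofNat_ctorIdx, Arr.ofNat_ctorIdx] at this

theorem Var.idx_lt (x : Var) : x.idx < 100 := by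
  cases x <;> decide

/-- The machine variables `100, 101, …` hold intermediate results. -/
def temp (d : ℕ) : ℕ := 100 + d

theorem Var.idx_ne_temp (x : Var) (d : ℕ) : x.idx ≠ temp d := by
  have := x.idx_lt
  unfold temp
  omega

@[simp] theorem temp_inj {d d' : ℕ} : temp d = temp d' ↔ d = d' := by simp [temp]

/-- The store `σ` is the part of the machine state `s` that the named variables and arrays see. -/
structure Rep (σ : Store) (s : State) : Prop where
  var : ∀ x : Var, s.var x.idx = σ.var x
  arr : ∀ a : Arr, s.arr a.idx = σ.arr a
  coins : s.coins = σ.coins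

@[simp] theorem State.setVar_var (s : State) (x v y : ℕ) :
    (s.setVar x v).var y = if y = x then v else s.var y := by
  simp [State.setVar, Function.update_apply]
@[simp] theorem State.setVar_arr (s : State) (x v : ℕ) : (s.setVar x v).arr = s.arr := rfl

theorem Rep.setTemp {σ : Store} {s : State} (h : Rep σ s) (d v : ℕ) :
    Rep σ (s.setVar (temp d) v) :=
  ⟨fun x => by simp [x.idx_ne_temp, h.var], h.arr, h.coins⟩

theorem Rep.setVar {σ : Store} {s : State} (h : Rep σ s) (x : Var) (v : ℕ) :
    Rep (σ.setVar x v) (s.setVar x.idx v) :=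
  ⟨fun y => by simp [Var.idx_injective.eq_iff, h.var], h.arr, h.coins⟩

theorem Rep.setArr {σ : Store} {s : State} (h : Rep σ s) (a : Arr) (i v : ℕ) :
    Rep (σ.setArr a i v) (s.setArr a.idx i v) := by
  refine ⟨h.var, fun b => ?_, h.coins⟩
  simp only [State.setArr, Store.setArr, Function.update_apply, Arr.idx_injective.eq_iff, h.arr]

theorem Rep.dropCoin {σ : Store} {s : State} (h : Rep σ s) : Rep σ.dropCoin s.dropCoin :=
  ⟨h.var, h.arr, by simp [State.dropCoin, Store.dropCoin, h.coins]⟩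

/-- Instructions that evaluate an expression into the intermediate result `d`. -/
def Exp.code (d : ℕ) : Exp → Prog
  | .lit c => .const (temp d) c
  | .get x => .seq (.const (temp (d + 1)) 0) (.add (temp d) x.idx (temp (d + 1)))
  | .plus a b => .seq (.seq (a.code d) (b.code (d + 1))) (.add (temp d) (temp d) (temp (d + 1)))
  | .minus a b => .seq (.seq (a.code d) (b.code (d + 1))) (.sub (temp d) (temp d) (temp (d + 1)))
  | .elem a i => .seq (i.code d) (.load (temp d) a.idx (temp d))

/-- The code of an expression computes its value and leaves the intermediate results below `d`
alone. -/
theorem Exp.code_exec (e : Exp) (d : ℕ) {σ : Store} {s : State} (h : Rep σ s) :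
    ∃ s', Exec (e.code d) s s' e.size ∧ Rep σ s' ∧ s'.var (temp d) = e.eval σ ∧
      ∀ j < d, s'.var (temp j) = s.var (temp j) := by
  induction e generalizing d s with
  | lit c =>
    refine ⟨_, .const _ _ _, h.setTemp _ _, by simp, fun j hj => by simp [hj.ne]⟩
  | get x =>
    refine ⟨_, .seq (.const _ _ _) (.add _ _ _ _), (h.setTemp _ _).setTemp _ _,
      by simp [x.idx_ne_temp, h.var], fun j hj => ?_⟩
    have : j ≠ d + 1 := by omega
    simp [hj.ne, this]
  | plus a b iha ihb =>
    obtain ⟨s₁, h1, h2, h3, h4⟩ := iha d h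
    obtain ⟨s₂, g1, g2, g3, g4⟩ := ihb (d + 1) h2
    refine ⟨_, .seq (.seq h1 g1) (.add _ _ _ _), g2.setTemp _ _, ?_, fun j hj => ?_⟩
    · simp only [State.setVar_var, if_true, g3, g4 d (Nat.lt_succ_self d), h3]
      rfl
    · simp only [State.setVar_var, temp_inj, hj.ne, if_false, g4 j (by omega), h4 j hj]
  | minus a b iha ihb =>
    obtain ⟨s₁, h1, h2, h3, h4⟩ := iha d h
    obtain ⟨s₂, g1, g2, g3, g4⟩ := ihb (d + 1) h2
    refine ⟨_, .seq (.seq h1 g1) (.sub _ _ _ _), g2.setTemp _ _, ?_, fun j hj => ?_⟩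
    · simp only [State.setVar_var, if_true, g3, g4 d (Nat.lt_succ_self d), h3]
      rfl
    · simp only [State.setVar_var, temp_inj, hj.ne, if_false, g4 j (by omega), h4 j hj]
  | elem a i ih =>
    obtain ⟨s₁, h1, h2, h3, h4⟩ := ih d h
    refine ⟨_, .seq h1 (.load _ _ _ _), h2.setTemp _ _, ?_, fun j hj => ?_⟩
    · simp [h2.arr, h3]
    · simp [hj.ne, h4 j hj]

namespace Stmt

/-- The machine program of a statement. -/
def code : Stmt → Prog
  | skip => .const (temp 0) 0
  | set x e => .seq (e.code 0) (.seq (.const (temp 1) 0) (.add x.idx (temp 0) (temp 1)))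
  | put a i e => .seq (.seq (i.code 0) (e.code 1)) (.store a.idx (temp 0) (temp 1))
  | flip x => .flip x.idx
  | mul x e y => .seq (e.code 0) (.seq (.const (temp 1) 0) (.seq (.const (temp 2) 0)
      (.seq (.const (temp 3) 1) (.seq (.sub (temp 4) y.idx (temp 2))
      (.seq (.loop (temp 4) (.seq (.add (temp 1) (temp 1) (temp 0))
        (.seq (.add (temp 2) (temp 2) (temp 3)) (.sub (temp 4) y.idx (temp 2)))))
      (.add x.idx (temp 1) (temp 4)))))))
  | seq p q => .seq p.code q.code
  | ite e p q => .seq (e.code 0) (.cond (temp 0) p.code q.code)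
  | loop i y p => .seq (.const i.idx 0) (.seq (.sub (temp 0) y.idx i.idx)
      (.loop (temp 0) (.seq p.code (.seq (.const (temp 0) 1)
        (.seq (.add i.idx i.idx (temp 0)) (.sub (temp 0) y.idx i.idx))))))

/-- Multiplication by repeated addition: `r` rounds remain. -/
theorem mul_loop_exec (y : Var) {σ : Store} (a r : ℕ) {s : State} (h : Rep σ s)
    (h0 : s.var (temp 0) = a) (h2 : s.var (temp 2) + r = σ.var y)
    (h3 : s.var (temp 3) = 1) (h4 : s.var (temp 4) = r) :
    ∃ s', Exec (.loop (temp 4) (.seq (.add (temp 1) (temp 1) (temp 0))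
        (.seq (.add (temp 2) (temp 2) (temp 3)) (.sub (temp 4) y.idx (temp 2))))) s s' (r * 4 + 1) ∧
      Rep σ s' ∧ s'.var (temp 4) = 0 ∧ s'.var (temp 1) = s.var (temp 1) + a * r := by
  induction r generalizing s with
  | zero => exact ⟨s, .loopDone h4, h, h4, by simp⟩
  | succ r ih =>
    have hstep := Exec.seq (.add (temp 1) (temp 1) (temp 0) s)
      (.seq (.add (temp 2) (temp 2) (temp 3) _) (.sub (temp 4) y.idx (temp 2) _))
    obtain ⟨s', e1, e2, e3, e4⟩ := ih
      (s := ((s.setVar (temp 1) (s.var (temp 1) + a)).setVar (temp 2)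
        (s.var (temp 2) + 1)).setVar (temp 4) r) (((h.setTemp _ _).setTemp _ _).setTemp _ _)
      (by simpa using h0) (by simp; omega) (by simpa using h3) (by simp)
    refine ⟨s', ?_, e2, e3, ?_⟩
    · have hlast : σ.var y - (s.var (temp 2) + 1) = r := by omega
      simp only [State.setVar_var, temp_inj, y.idx_ne_temp, h0, h3, h.var, if_true, if_false,
        OfNat.ofNat_ne_one, hlast] at hstep
      have := Exec.loopStep (by omega) hstep e1
      convert this using 1
      ring
    · rw [e4]
      simp
      ring

/-- The compiled program has the effect `run` and takes at most `time` steps. -/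
theorem code_exec (p : Stmt) (hp : p.wf = true) {σ : Store} {s : State} (h : Rep σ s) :
    ∃ s' t, Exec p.code s s' t ∧ t ≤ p.time σ.var ∧ Rep (p.run σ) s' := by
  induction p generalizing σ s with
  | skip => exact ⟨_, _, .const _ _ _, le_rfl, h.setTemp _ _⟩
  | set x e =>
    obtain ⟨s₁, h1, h2, h3, -⟩ := e.code_exec 0 h
    refine ⟨_, _, .seq h1 (.seq (.const _ _ _) (.add _ _ _ _)), le_rfl, ?_⟩
    have := (h2.setTemp 1 0).setVar x (e.eval σ)
    simpa [h3] using this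
  | put a i e =>
    obtain ⟨s₁, h1, h2, h3, -⟩ := i.code_exec 0 h
    obtain ⟨s₂, g1, g2, g3, g4⟩ := e.code_exec 1 h2
    refine ⟨_, _, .seq (.seq h1 g1) (.store _ _ _ _), le_rfl, ?_⟩
    rw [g3, g4 0 one_pos, h3]
    exact g2.setArr _ _ _
  | flip x =>
    refine ⟨_, _, .flip _ _, le_rfl, ?_⟩
    rw [h.coins]
    exact h.dropCoin.setVar _ _
  | mul x e y =>
    obtain ⟨s₁, h1, h2, h3, -⟩ := e.code_exec 0 h
    obtain ⟨s₂, g1, g2, g3, g4⟩ := mul_loop_exec y (e.eval σ) (σ.var y)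
      ((((h2.setTemp 1 0).setTemp 2 0).setTemp 3 1).setTemp 4 (σ.var y))
      (by simpa using h3) (by simp) (by simp) (by simp)
    have hsub := Exec.sub (temp 4) y.idx (temp 2)
      (((s₁.setVar (temp 1) 0).setVar (temp 2) 0).setVar (temp 3) 1)
    rw [show (((s₁.setVar (temp 1) 0).setVar (temp 2) 0).setVar (temp 3) 1).var y.idx = σ.var y by
      simp [y.idx_ne_temp, h2.var], show (((s₁.setVar (temp 1) 0).setVar (temp 2) 0).setVar
        (temp 3) 1).var (temp 2) = 0 by simp, Nat.sub_zero] at hsub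
    refine ⟨_, _, .seq h1 (.seq (.const _ _ _) (.seq (.const _ _ _) (.seq (.const _ _ _)
      (.seq hsub (.seq g1 (.add _ _ _ _)))))), ?_, ?_⟩
    · simp only [time]; omega
    · rw [g3, g4]
      have := g2.setVar x (e.eval σ * σ.var y)
      simpa using this
  | seq p q ihp ihq =>
    simp only [wf, Bool.and_eq_true, List.all_eq_true, Bool.not_eq_true'] at hp
    obtain ⟨s₁, t₁, h1, h2, h3⟩ := ihp hp.1.1 h
    obtain ⟨s₂, t₂, g1, g2, g3⟩ := ihq hp.1.2 h3
    refine ⟨s₂, _, .seq h1 g1, Nat.add_le_add h2 (g2.trans_eq ?_), g3⟩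
    exact time_congr q fun x hx => (p.frame σ).var x (hp.2 x hx)
  | ite e p q ihp ihq =>
    simp only [wf, Bool.and_eq_true] at hp
    obtain ⟨s₁, h1, h2, h3, -⟩ := e.code_exec 0 h
    by_cases he : e.eval σ = 0
    · obtain ⟨s₂, t₂, g1, g2, g3⟩ := ihq hp.2 h2
      refine ⟨s₂, _, .seq h1 (.condFalse (h3.trans he) g1), ?_, by simpa [he] using g3⟩
      simp only [time]; omega
    · obtain ⟨s₂, t₂, g1, g2, g3⟩ := ihp hp.1 h2
      refine ⟨s₂, _, .seq h1 (.condTrue (by rwa [h3]) g1), ?_, by simpa [he] using g3⟩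
      simp only [time]; omega
  | loop i y p ih =>
    simp only [wf, Bool.and_eq_true, List.all_eq_true, Bool.not_eq_true', bne_iff_ne] at hp
    obtain ⟨⟨⟨⟨hwf, hiy⟩, hpi⟩, hpy⟩, hb⟩ := hp
    set f : ℕ → Store → Store := fun j τ => p.run (τ.setVar i j) with hf
    have hframe : ∀ j x, x ≠ i → p.writesVar x = false → (iter f σ j).var x = σ.var x := by
      intro j x hxi hx
      refine iter_induction (fun _ τ => τ.var x = σ.var x) j rfl fun l _ τ hτ => ?_
      rw [hf]
      simp only
      rw [(p.frame _).var x hx, Store.setVar_var, if_neg hxi, hτ]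
    -- The last `r` rounds, started after `j` rounds.
    have key : ∀ r j : ℕ, j + r = σ.var y → ∀ s₁, Rep ((iter f σ j).setVar i j) s₁ →
        s₁.var (temp 0) = r → ∃ s' t, Exec (.loop (temp 0) (.seq p.code (.seq (.const (temp 0) 1)
          (.seq (.add i.idx i.idx (temp 0)) (.sub (temp 0) y.idx i.idx))))) s₁ s' t ∧
          t ≤ 1 + r * (p.time σ.var + 4) ∧ Rep ((iter f σ (σ.var y)).setVar i (σ.var y)) s' := by
      intro r
      induction r with
      | zero =>
        intro j hj s₁ hs₁ h0
        obtain rfl : j = σ.var y := by omega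
        exact ⟨s₁, 1, .loopDone h0, by omega, hs₁⟩
      | succ r ihr =>
        intro j hj s₁ hs₁ h0
        obtain ⟨s₂, t₂, g1, g2, g3⟩ := ih hwf hs₁
        have e1 : p.run ((iter f σ j).setVar i j) = iter f σ (j + 1) := rfl
        rw [e1] at g3
        have e2 : (iter f σ (j + 1)).var i = j := by
          rw [← e1, (p.frame _).var i hpi]; simp
        have e3 : (iter f σ (j + 1)).var y = σ.var y := hframe _ _ hiy.symm hpy
        have e4 : p.time ((iter f σ j).setVar i j).var = p.time σ.var := by
          refine time_congr p fun x hx => ?_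
          rw [Store.setVar_var, if_neg (hb x hx).2, hframe _ _ (hb x hx).2 (hb x hx).1]
        have hne : i.idx ≠ y.idx := fun h => hiy (Var.idx_injective h)
        obtain ⟨s₃, t₃, k1, k2, k3⟩ := ihr (j + 1) (by omega)
          (((s₂.setVar (temp 0) 1).setVar i.idx (j + 1)).setVar (temp 0) r)
          (((g3.setTemp _ _).setVar i (j + 1)).setTemp 0 r) (by simp)
        have hstep := Exec.seq (.const (temp 0) 1 s₂)
          (.seq (.add i.idx i.idx (temp 0) _) (.sub (temp 0) y.idx i.idx _))
        have hr : σ.var y - (j + 1) = r := by omega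
        simp only [State.setVar_var, i.idx_ne_temp, y.idx_ne_temp, hne.symm, g3.var,
          e2, e3, if_true, if_false, hr] at hstep
        refine ⟨s₃, _, .loopStep (by omega) (.seq g1 hstep) k1, ?_, k3⟩
        · rw [e4] at g2
          have : (r + 1) * (p.time σ.var + 4) = r * (p.time σ.var + 4) + (p.time σ.var + 4) := by
            ring
          omega
    obtain ⟨s', t, k1, k2, k3⟩ := key (σ.var y) 0 (by omega)
      ((s.setVar i.idx 0).setVar (temp 0) (σ.var y)) ((h.setVar i 0).setTemp _ _) (by simp)
    have hne : y.idx ≠ i.idx := fun h => hiy (Var.idx_injective h).symm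
    have hstep := Exec.sub (temp 0) y.idx i.idx (s.setVar i.idx 0)
    simp only [State.setVar_var, hne, if_true, if_false, h.var, Nat.sub_zero] at hstep
    refine ⟨s', _, .seq (.const _ _ _) (.seq hstep k1), ?_, k3⟩
    simp only [time]; omega

end Stmt

/-! ### Determinants by bordering -/

open PowerSeries in
/-- The determinant `det (1 - A)` of the leading `h × h` block of an infinite matrix `A`. -/
noncomputable def borderDet {R : Type*} [CommRing R] (a : ℕ → ℕ → R⟦X⟧) (h : ℕ) : R⟦X⟧ :=
  (1 - Matrix.of fun i j : Fin h => a i j).det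

open PowerSeries in
/-- The recurrence behind the algorithm: `G u` is `det (1 - A)` of the leading `h × h` block times
the generating function of the walks in `0, …, h` from `h` to `u` that visit `h` only at the start.
The recurrence expresses the Schur complement of that block in the next one. -/
theorem exists_borderDet_succ {R : Type*} [CommRing R] (a : ℕ → ℕ → R⟦X⟧)
    (h : ℕ)
    (ha : ∀ u < h, ∀ v < h, constantCoeff (a u v) = 0) :
    ∃ G : ℕ → R⟦X⟧, G h = borderDet a h ∧ (∀ v, h < v → G v = 0) ∧
      (∀ v < h, G v = ∑ u ∈ Finset.range (h + 1), G u * a u v) ∧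
      borderDet a (h + 1) = borderDet a h - ∑ u ∈ Finset.range (h + 1), G u * a u h := by
  set M : Matrix (Fin h) (Fin h) R⟦X⟧ := 1 - Matrix.of fun i j : Fin h => a i j with hM
  have hunit : IsUnit M.det := by
    rw [isUnit_iff_constantCoeff, RingHom.map_det]
    have : M.map (constantCoeff (R := R)) = 1 := by
      ext i j
      simp [hM, Matrix.one_apply, ha i i.2 j j.2, apply_ite (constantCoeff (R := R))]
    rw [RingHom.mapMatrix_apply, this, Matrix.det_one]
    exact isUnit_one
  set r : Fin h → R⟦X⟧ := fun j => a h j with hr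
  set g : Fin h → R⟦X⟧ := M.det • Matrix.vecMul r M⁻¹ with hg
  have hgM : Matrix.vecMul g M = M.det • r := by
    rw [hg, Matrix.smul_vecMul, Matrix.vecMul_vecMul, Matrix.nonsing_inv_mul _ hunit,
      Matrix.vecMul_one]
  have hgv : ∀ v : Fin h, g v = ∑ u : Fin h, g u * a u v + M.det * a h v := by
    intro v
    have h1 := congrFun hgM v
    rw [hM, Matrix.vecMul_sub, Matrix.vecMul_one, ← hM] at h1
    simp only [Pi.sub_apply, Pi.smul_apply, smul_eq_mul, hr] at h1
    rw [← h1]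
    simp [Matrix.vecMul, dotProduct]
  refine ⟨fun u => if hu : u < h then g ⟨u, hu⟩ else if u = h then M.det else 0, ?_, ?_, ?_, ?_⟩
  · simp [borderDet, hM]
  · intro v hv
    simp [hv.not_gt, hv.ne']
  · intro v hv
    rw [Finset.sum_range_succ, Finset.sum_range]
    simp only [hv, dif_pos, Fin.is_lt, lt_irrefl, dif_neg, not_false_eq_true, if_true]
    exact hgv ⟨v, hv⟩
  · rw [Finset.sum_range_succ, Finset.sum_range]
    simp only [Fin.is_lt, dif_pos, lt_irrefl, dif_neg, not_false_eq_true, if_true]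
    let _ := M.invertibleOfIsUnitDet hunit
    have hblock : (1 - Matrix.of fun i j : Fin (h + 1) => a i j).submatrix finSumFinEquiv
        finSumFinEquiv = Matrix.fromBlocks M (Matrix.of fun (i : Fin h) (_ : Fin 1) => -a i h)
          (Matrix.of fun (_ : Fin 1) (j : Fin h) => -a h j)
          (Matrix.of fun (_ : Fin 1) (_ : Fin 1) => 1 - a h h) := by
      ext i j
      rcases i with i | i <;> rcases j with j | j
      · simp [hM, Matrix.one_apply, Fin.ext_iff]
      · simp [Fin.ext_iff, i.2.ne]
      · simp [Fin.ext_iff, j.2.ne']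
      · simp [Matrix.one_apply, Fin.ext_iff]
    have hdet : borderDet a (h + 1) = _ :=
      (Matrix.det_submatrix_equiv_self finSumFinEquiv _).symm
    rw [hdet, hblock, Matrix.det_fromBlocks₁₁, Matrix.det_fin_one, Matrix.invOf_eq_nonsing_inv]
    have hD : borderDet a h = M.det := rfl
    rw [hD]
    have : ∀ u : Fin h, g u = M.det * ∑ j : Fin h, a h j * M⁻¹ j u := by
      intro u
      simp [hg, hr, Matrix.vecMul, dotProduct]
    simp only [Matrix.sub_apply, Matrix.mul_apply, Matrix.of_apply, this, neg_mul, mul_neg,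
      Finset.sum_neg_distrib, neg_neg, Finset.mul_sum, Finset.sum_mul, mul_sub]
    simp only [mul_one, mul_assoc]
    ring

/-! ### Involutions in characteristic two -/

open Equiv in
/-- Expand a symmetric determinant of sums in characteristic two: a permutation `σ` with labels `ξ`
on its arcs cancels with its inverse unless both are equal. -/
theorem det_sum_eq_sum_involution {V C S : Type*} [Fintype V] [DecidableEq V] [Fintype C]
    [DecidableEq C] [CommRing S] [CharP S 2] (b : V → V → C → S) (hb : ∀ u v c, b u v c = b v u c) :
    (Matrix.of fun u v => ∑ c, b u v c).det =
      ∑ p : Perm V × (V → C) with (∀ u, p.1 (p.1 u) = u) ∧ ∀ u, p.2 (p.1 u) = p.2 u,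
        ∏ u, b u (p.1 u) (p.2 u) := by
  have hexp : (Matrix.of fun u v => ∑ c, b u v c).det =
      ∑ p : Perm V × (V → C), ∏ u, b u (p.1 u) (p.2 u) := by
    rw [Matrix.det_apply, Fintype.sum_prod_type]
    refine Finset.sum_congr rfl fun σ _ => ?_
    have hs : ∀ x : S, Perm.sign σ • x = x := by
      intro x
      rcases Int.units_eq_one_or (Perm.sign σ) with h | h <;> simp [h, CharTwo.neg_eq]
    rw [hs]
    simp only [Matrix.of_apply]
    rw [Finset.prod_univ_sum, Fintype.piFinset_univ]
    exact Finset.sum_congr rfl fun ξ _ => Finset.prod_congr rfl fun u _ => hb _ _ _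
  rw [hexp, ← Finset.sum_filter_add_sum_filter_not Finset.univ
    (fun p : Perm V × (V → C) => (∀ u, p.1 (p.1 u) = u) ∧ ∀ u, p.2 (p.1 u) = p.2 u)]
  rw [add_eq_left]
  refine Finset.sum_involution (fun p _ => (p.1.symm, p.2 ∘ p.1.symm)) ?_ ?_ ?_ ?_
  · rintro ⟨σ, ξ⟩ -
    have : ∏ u, b u (σ.symm u) (ξ (σ.symm u)) = ∏ u, b u (σ u) (ξ u) := by
      rw [← Equiv.prod_comp σ]
      exact Finset.prod_congr rfl fun u _ => by simp [hb]
    simp only [Function.comp]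
    rw [this]
    exact CharTwo.add_self_eq_zero _
  · rintro ⟨σ, ξ⟩ hp - heq
    simp only [Finset.mem_filter, Finset.mem_univ, true_and] at hp
    simp only [Prod.mk.injEq] at heq
    refine hp ⟨fun u => ?_, fun u => ?_⟩
    · nth_rw 1 [← heq.1]
      simp
    · have := congrFun heq.2 (σ u)
      simpa using this.symm
  · rintro ⟨σ, ξ⟩ hp
    simp only [Finset.mem_filter, Finset.mem_univ, true_and] at hp ⊢
    intro ⟨h1, h2⟩
    have h1' : ∀ u, σ (σ u) = u := by
      intro u
      have := congrArg (fun v => σ (σ v)) (h1 u)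
      simpa using this.symm
    refine hp ⟨h1', fun u => ?_⟩
    have h3 := h2 (σ u)
    simp only [Function.comp, Equiv.symm_apply_apply] at h3
    rw [← h3]
    congr 1
    rw [Equiv.eq_symm_apply, h1']
  · rintro ⟨σ, ξ⟩ -
    simp [Function.comp_def]

/-- Inclusion-exclusion in characteristic two: the sets of colors that contain a given proper
subset are even in number. -/
theorem sum_indicator_eq {K S : Type*} [Fintype K] [DecidableEq K] [CommRing S] [CharP S 2]
    (A : K → Prop) [DecidablePred A] :
    ∑ χ : K → Fin 2, (if ∀ c, A c → χ c = 1 then (1 : S) else 0) = if ∀ c, A c then 1 else 0 := by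
  split_ifs with h
  · rw [Finset.sum_eq_single (fun _ => 1)]
    · simp
    · intro χ _ hχ
      rw [if_neg]
      intro h'
      exact hχ (funext fun c => h' c (h c))
    · simp
  · push Not at h
    obtain ⟨c, hc⟩ := h
    refine Finset.sum_involution (fun χ _ => Function.update χ c (1 - χ c)) ?_ ?_ (by simp) ?_
    · intro χ _
      have : (∀ d, A d → Function.update χ c (1 - χ c) d = 1) ↔ ∀ d, A d → χ d = 1 := by
        refine forall_congr' fun d => imp_congr_right fun hd => ?_
        rw [Function.update_of_ne (by rintro rfl; exact hc hd)]
      simp only [this]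
      exact CharTwo.add_self_eq_zero _
    · intro χ _ _ heq
      have := congrFun heq c
      simp only [Function.update_self] at this
      revert this
      generalize χ c = z
      revert z
      decide
    · intro χ _
      simp

/-! ### The determinants count solutions -/

/-- The index of the arc from `u` to `v` in the color `c`. -/
def arc (n k u v c : ℕ) : ℕ := (u * n + v) * k + c

open Equiv in
open Classical in
/-- Perfect over-the-rainbow matchings that only use arcs in `al`, encoded by the involution `σ`
that maps each vertex to its partner and by the color `ξ u` of the edge at each vertex `u`. -/
noncomputable def rainbow (n k : ℕ) (al : ℕ → Prop) : Finset (Perm (Fin n) × (Fin n → Fin k)) :=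
  {p | (∀ u, p.1 (p.1 u) = u) ∧ (∀ u, p.2 (p.1 u) = p.2 u) ∧ Function.Surjective p.2 ∧
    ∀ u : Fin n, al (arc n k u (p.1 u) (p.2 u))}

theorem mem_rainbow {n k : ℕ} {al : ℕ → Prop} {p : Equiv.Perm (Fin n) × (Fin n → Fin k)} :
    p ∈ rainbow n k al ↔ (∀ u, p.1 (p.1 u) = u) ∧ (∀ u, p.2 (p.1 u) = p.2 u) ∧
      Function.Surjective p.2 ∧ ∀ u : Fin n, al (arc n k u (p.1 u) (p.2 u)) := by
  simp [rainbow]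

/-- The sum of `wt` over the arcs of a solution, two for each edge. -/
def arcSum {n k : ℕ} (wt : ℕ → ℕ) (p : Equiv.Perm (Fin n) × (Fin n → Fin k)) : ℕ :=
  ∑ u : Fin n, wt (arc n k u (p.1 u) (p.2 u))

open PowerSeries in
open Classical in
/-- The entries of the matrix whose determinants are computed: the sum of `X ^ wt e` over the arcs
`e` from `u` to `v` that are in `al` and whose color is in the set with characteristic function
`χ`. -/
noncomputable def arcSeries (n k : ℕ) (al : ℕ → Prop) (wt : ℕ → ℕ) (χ : ℕ → Prop) (u v : ℕ) :
    (ZMod 2)⟦X⟧ :=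
  ∑ c ∈ Finset.range k, if al (arc n k u v c) ∧ χ c then X ^ wt (arc n k u v c) else 0

instance charP_powerSeries : CharP (PowerSeries (ZMod 2)) 2 :=
  charP_of_injective_ringHom (f := PowerSeries.C (R := ZMod 2)) PowerSeries.C_injective 2

/-- The summands of the entry at `(u, v)` of `1 - A`, where the signs do not matter: one for each
color, and the label `none` for the diagonal entry `1`, which stands for an unmatched vertex. -/
noncomputable def labelSeries (n k : ℕ) (al : ℕ → Prop) (wt : ℕ → ℕ) (u v : Fin n) :
    Option (Fin k) → PowerSeries (ZMod 2)
  | none => if u = v then 1 else 0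
  | some c => open Classical in
      if al (arc n k u v c) then PowerSeries.X ^ wt (arc n k u v c) else 0

open PowerSeries Equiv in
open Classical in
/-- The determinants for all sets of colors, expanded and added up: the remaining terms are
matchings that use every color. -/
theorem sum_borderDet_eq (n k : ℕ) (al : ℕ → Prop) (wt : ℕ → ℕ)
    (hal : ∀ u v : Fin n, ∀ c : Fin k, al (arc n k u v c) → al (arc n k v u c))
    (hwt : ∀ u v : Fin n, ∀ c : Fin k, wt (arc n k u v c) = wt (arc n k v u c)) :
    ∑ s ∈ Finset.range (2 ^ k), borderDet (arcSeries n k al wt fun c => s / 2 ^ c % 2 = 1) n =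
      ∑ p : Perm (Fin n) × (Fin n → Option (Fin k))
        with (∀ u, p.1 (p.1 u) = u) ∧ ∀ u, p.2 (p.1 u) = p.2 u,
        (if ∀ c, ∃ u, p.2 u = some c then 1 else 0) *
          ∏ u, labelSeries n k al wt u (p.1 u) (p.2 u) := by
  have hal' : ∀ u v : Fin n, ∀ c : Fin k, al (arc n k u v c) ↔ al (arc n k v u c) :=
    fun u v c => ⟨hal u v c, hal v u c⟩
  rw [Finset.sum_range]
  rw [← (finFunctionFinEquiv (m := 2) (n := k)).sum_comp]
  have hdet : ∀ χ : Fin k → Fin 2,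
      borderDet (arcSeries n k al wt fun c =>
        ((finFunctionFinEquiv χ : Fin (2 ^ k)) : ℕ) / 2 ^ c % 2 = 1) n =
      ∑ p : Perm (Fin n) × (Fin n → Option (Fin k))
        with (∀ u, p.1 (p.1 u) = u) ∧ ∀ u, p.2 (p.1 u) = p.2 u,
        (if ∀ c, (∃ u, p.2 u = some c) → χ c = 1 then 1 else 0) *
          ∏ u, labelSeries n k al wt u (p.1 u) (p.2 u) := by
    intro χ
    have hχ : ∀ c : Fin k, ((finFunctionFinEquiv χ : Fin (2 ^ k)) : ℕ) / 2 ^ (c : ℕ) % 2 = 1 ↔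
        χ c = 1 := by
      intro c
      rw [← finFunctionFinEquiv_symm_apply_val, Equiv.symm_apply_apply]
      exact ⟨fun h => Fin.ext h, fun h => by rw [h]; rfl⟩
    have hmat : (1 - Matrix.of fun i j : Fin n => arcSeries n k al wt (fun c =>
        ((finFunctionFinEquiv χ : Fin (2 ^ k)) : ℕ) / 2 ^ c % 2 = 1) i j) =
        Matrix.of fun u v : Fin n => ∑ c : Option (Fin k),
          (if ∀ d, c = some d → χ d = 1 then 1 else 0) * labelSeries n k al wt u v c := by
      ext1 u v
      rw [Matrix.sub_apply, CharTwo.sub_eq_add, Matrix.of_apply, Matrix.of_apply,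
        Fintype.sum_option, arcSeries, Finset.sum_range, Matrix.one_apply]
      congr 1
      · simp [labelSeries]
      · refine Finset.sum_congr rfl fun c _ => ?_
        simp only [labelSeries, hχ, Option.some.injEq, forall_eq', ite_and]
        split_ifs <;> simp
    rw [borderDet, hmat, det_sum_eq_sum_involution]
    · refine Finset.sum_congr (by ext; simp) fun p _ => ?_
      rw [Finset.prod_mul_distrib, Finset.prod_ite_zero]
      congr 1
      simp only [Finset.mem_univ, true_imp_iff, Finset.prod_const_one]
      refine if_congr ⟨?_, ?_⟩ rfl rfl
      · rintro h c ⟨u, hu⟩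
        exact h u c hu
      · exact fun h u c hu => h c ⟨u, hu⟩
    · intro u v c
      congr 1
      cases c with
      | none => simp [labelSeries, eq_comm]
      | some c => simp [labelSeries, hal' u v, hwt u v]
  simp only [hdet]
  rw [Finset.sum_comm]
  refine Finset.sum_congr rfl fun p _ => ?_
  rw [← Finset.sum_mul]
  congr 1
  convert sum_indicator_eq (S := (ZMod 2)⟦X⟧) fun c => ∃ u, p.2 u = some c

open PowerSeries in
open Classical in
/-- From the degree `n * (n * H)` on, which imperfect matchings do not reach, the sum of the
determinants over all sets of colors counts the solutions modulo two by their weight. -/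
theorem coeff_sum_borderDet (n k : ℕ) (al : ℕ → Prop) (wt : ℕ → ℕ) (H x : ℕ) (hH : 0 < H)
    (hal : ∀ u v : Fin n, ∀ c : Fin k, al (arc n k u v c) → al (arc n k v u c))
    (hwt : ∀ u v : Fin n, ∀ c : Fin k, wt (arc n k u v c) = wt (arc n k v u c))
    (hH' : ∀ u v : Fin n, ∀ c : Fin k, al (arc n k u v c) → wt (arc n k u v c) ≤ n * H + H)
    (hx : n * (n * H) ≤ x) :
    coeff x (∑ s ∈ Finset.range (2 ^ k),
      borderDet (arcSeries n k al wt fun c => s / 2 ^ c % 2 = 1) n) =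
      (((rainbow n k al).filter fun p => arcSum wt p = x).card : ZMod 2) := by
  rw [sum_borderDet_eq n k al wt hal hwt, map_sum, Finset.card_eq_sum_ones, Nat.cast_sum]
  symm
  refine Finset.sum_of_injOn (fun p => (p.1, fun u => some (p.2 u))) ?_ ?_ ?_ ?_
  · rintro ⟨σ, ξ⟩ - ⟨σ', ξ'⟩ - h
    simp only [Prod.mk.injEq] at h ⊢
    exact ⟨h.1, funext fun u => Option.some_injective _ (congrFun h.2 u)⟩
  · rintro ⟨σ, ξ⟩ h
    simp only [Finset.coe_filter, mem_rainbow, Set.mem_ofPred_eq] at h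
    simp only [Finset.coe_filter, Finset.mem_univ, true_and, Set.mem_ofPred_eq]
    exact ⟨h.1.1, fun u => by rw [h.1.2.1 u]⟩
  · rintro ⟨σ, ξ⟩ h hne
    simp only [Finset.mem_filter, Finset.mem_univ, true_and] at h
    by_cases hnone : ∃ u, ξ u = none
    · -- An unmatched vertex: the degree is at most `(n - 1) * (n * H + H) < n * (n * H)`.
      obtain ⟨u₀, hu₀⟩ := hnone
      have key : ∀ t : Finset (Fin n), ∃ d ≤ (t.filter fun u => ξ u ≠ none).card * (n * H + H),
          ∏ u ∈ t, labelSeries n k al wt u (σ u) (ξ u) = X ^ d ∨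
          ∏ u ∈ t, labelSeries n k al wt u (σ u) (ξ u) = 0 := by
        intro t
        induction t using Finset.induction_on with
        | empty => exact ⟨0, by simp, .inl (by simp)⟩
        | insert u t hu ih =>
          obtain ⟨d, hd, h1⟩ := ih
          rw [Finset.prod_insert hu, Finset.filter_insert]
          rcases h1 with h1 | h1
          · rw [h1]
            rcases hξ : ξ u with _ | c
            · simp only [labelSeries]
              simp only [ne_eq, not_true_eq_false, if_false]
              split_ifs
              · exact ⟨d, hd, .inl (by simp)⟩
              · exact ⟨d, hd, .inr (by simp)⟩
            · simp only [labelSeries, ne_eq, reduceCtorEq, not_false_eq_true, if_true]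
              rw [Finset.card_insert_of_notMem (by simp [hu])]
              split_ifs with h2
              · refine ⟨wt (arc n k u (σ u) c) + d, ?_, .inl (by rw [pow_add])⟩
                have := hH' u (σ u) c h2
                rw [Nat.add_mul, Nat.one_mul, Nat.add_comm]
                exact Nat.add_le_add hd this
              · exact ⟨0, by simp, .inr (by simp)⟩
          · rw [h1]
            exact ⟨0, by simp, .inr (by simp)⟩
      obtain ⟨d, hd, h1⟩ := key Finset.univ
      rcases h1 with h1 | h1
      · have hcard : (Finset.univ.filter fun u => ξ u ≠ none).card < n := by
          have := Finset.card_lt_card (s := Finset.univ.filter fun u => ξ u ≠ none)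
            (t := Finset.univ) (Finset.filter_ssubset.2 ⟨u₀, Finset.mem_univ _, by simp [hu₀]⟩)
          simpa using this
        have hdx : d < x := by
          obtain ⟨m, rfl⟩ : ∃ m, n = m + 1 := ⟨n - 1, by omega⟩
          have : d ≤ m * ((m + 1) * H + H) :=
            hd.trans (Nat.mul_le_mul_right _ (Nat.lt_succ_iff.1 hcard))
          nlinarith
        simp only [h1]
        split_ifs
        · rw [one_mul, coeff_X_pow, if_neg hdx.ne']
        · simp
      · simp [h1]
    · push Not at hnone
      choose ξ' hξ' using fun u => Option.ne_none_iff_exists'.1 (hnone u)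
      obtain rfl : ξ = fun u => some (ξ' u) := funext hξ'
      simp only [labelSeries, Option.some.injEq]
      rw [Finset.prod_ite_zero, Finset.prod_pow_eq_pow_sum]
      simp only [Finset.mem_univ, true_imp_iff]
      by_contra hcon
      refine hne ⟨(σ, ξ'), ?_, rfl⟩
      simp only [Finset.coe_filter, mem_rainbow, Set.mem_ofPred_eq]
      split_ifs at hcon with h1 h2
      · rw [one_mul, coeff_X_pow] at hcon
        refine ⟨⟨h.1, fun u => Option.some_injective _ (h.2 u), fun c => h1 c, h2⟩, ?_⟩
        by_contra hx'
        rw [if_neg fun hx'' => hx' hx''.symm] at hcon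
        exact hcon rfl
      all_goals simp at hcon
  · rintro ⟨σ, ξ⟩ h
    simp only [Finset.mem_filter, mem_rainbow] at h
    have hx' : x = ∑ u : Fin n, wt (arc n k u (σ u) (ξ u)) := h.2.symm
    simp only [labelSeries, Option.some.injEq]
    rw [Finset.prod_ite_zero, Finset.prod_pow_eq_pow_sum, if_pos fun c => h.1.2.2.1 c,
      if_pos fun u _ => h.1.2.2.2 u, one_mul, coeff_X_pow, if_pos hx', Nat.cast_one]

/-! ### The isolation lemma -/

open Classical in
/-- The isolation lemma: for random values `val (R i)`, a family of sets with additional costs `c`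
has two members of minimal value with probability at most `|ι| / |B|`. For two such members, some
`i` belongs to only one of them, and then `R i` is determined by the other values. -/
theorem isolation {ι B β : Type*} [Fintype ι] [Fintype B] [Nonempty B] (val : B → ℕ)
    (hval : Function.Injective val) (F : Set β) (Q : β → Finset ι) (hQ : Set.InjOn Q F)
    (c : β → ℕ) (a : ℕ) (ha : 0 < a) :
    (Finset.univ.filter fun R : ι → B => ∃ p ∈ F, ∃ p' ∈ F, p ≠ p' ∧
      (∀ r ∈ F, c p + a * ∑ i ∈ Q p, val (R i) ≤ c r + a * ∑ i ∈ Q r, val (R i)) ∧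
      (∀ r ∈ F, c p' + a * ∑ i ∈ Q p', val (R i) ≤ c r + a * ∑ i ∈ Q r, val (R i))).card *
      Fintype.card B ≤ Fintype.card ι * Fintype.card B ^ Fintype.card ι := by
  set f : (ι → B) → β → ℕ := fun R p => c p + a * ∑ i ∈ Q p, val (R i) with hf
  set bad : ι → Finset (ι → B) := fun i => Finset.univ.filter fun R =>
    ∃ p ∈ F, ∃ p' ∈ F, i ∈ Q p ∧ i ∉ Q p' ∧ (∀ r ∈ F, f R p ≤ f R r) ∧ ∀ r ∈ F, f R p' ≤ f R r
    with hbad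
  have hsub : (Finset.univ.filter fun R : ι → B => ∃ p ∈ F, ∃ p' ∈ F, p ≠ p' ∧
      (∀ r ∈ F, f R p ≤ f R r) ∧ ∀ r ∈ F, f R p' ≤ f R r) ⊆ Finset.univ.biUnion bad := by
    intro R hR
    simp only [Finset.mem_filter, Finset.mem_univ, true_and] at hR
    obtain ⟨p, hp, p', hp', hne, h1, h2⟩ := hR
    have : Q p ≠ Q p' := fun h => hne (hQ hp hp' h)
    rw [Finset.mem_biUnion]
    by_cases hs : Q p ⊆ Q p'
    · obtain ⟨i, hi, hi'⟩ := Finset.exists_of_ssubset (hs.ssubset_of_ne this)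
      exact ⟨i, Finset.mem_univ _, by
        simp only [hbad, Finset.mem_filter, Finset.mem_univ, true_and]
        exact ⟨p', hp', p, hp, hi, hi', h2, h1⟩⟩
    · obtain ⟨i, hi, hi'⟩ := Finset.not_subset.1 hs
      exact ⟨i, Finset.mem_univ _, by
        simp only [hbad, Finset.mem_filter, Finset.mem_univ, true_and]
        exact ⟨p, hp, p', hp', hi, hi', h1, h2⟩⟩
  have hlt : ∀ i, ∀ R R' : ι → B, (∀ j, j ≠ i → R j = R' j) → ∀ p, i ∈ Q p →
      val (R i) < val (R' i) → f R p < f R' p := by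
    intro i R R' hRR p hip hv
    simp only [hf]
    refine Nat.add_lt_add_left (Nat.mul_lt_mul_of_pos_left ?_ ha) _
    refine Finset.sum_lt_sum (fun j _ => ?_) ⟨i, hip, hv⟩
    by_cases hj : j = i
    · subst hj; exact hv.le
    · rw [hRR j hj]
  have heq : ∀ i, ∀ R R' : ι → B, (∀ j, j ≠ i → R j = R' j) → ∀ p, i ∉ Q p → f R p = f R' p := by
    intro i R R' hRR p hip
    simp only [hf]
    congr 2
    refine Finset.sum_congr rfl fun j hj => ?_
    rw [hRR j (by rintro rfl; exact hip hj)]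
  have hcard : ∀ i, (bad i).card * Fintype.card B ≤ Fintype.card B ^ Fintype.card ι := by
    intro i
    have h1 : (bad i).card ≤ Fintype.card ({j // j ≠ i} → B) := by
      rw [← Finset.card_univ]
      refine Finset.card_le_card_of_injOn (fun R j => R j) (fun _ _ => Finset.mem_univ _) ?_
      intro R hR R' hR' hRR
      simp only [hbad, Finset.coe_filter, Finset.mem_univ, true_and, Set.mem_ofPred_eq] at hR hR'
      obtain ⟨p, hp, p', hp', hip, hip', h1, h2⟩ := hR
      obtain ⟨q, hq, q', hq', hiq, hiq', g1, g2⟩ := hR'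
      have hRR' : ∀ j, j ≠ i → R j = R' j := fun j hj => congrFun hRR ⟨j, hj⟩
      have e1 := heq i R R' hRR' p' hip'
      have e2 := heq i R R' hRR' q' hiq'
      have a1 := h2 q' hq'
      have a2 := g2 p' hp'
      have b1 := h1 p' hp'
      have b2 := h2 p hp
      have b3 := g1 q' hq'
      have b4 := g2 q hq
      have c1 := h2 q hq
      have c2 := g2 p hp
      funext j
      by_cases hj : j = i
      · subst hj
        refine hval (le_antisymm ?_ ?_)
        · by_contra hlt'
          have := hlt j R' R (fun l hl => (hRR' l hl).symm) p hip (not_le.1 hlt')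
          omega
        · by_contra hlt'
          have := hlt j R R' hRR' q hiq (not_le.1 hlt')
          omega
      · exact hRR' j hj
    have h2 : Fintype.card ({j // j ≠ i} → B) * Fintype.card B =
        Fintype.card B ^ Fintype.card ι := by
      rw [Fintype.card_fun, ← pow_succ, Fintype.card_subtype_compl, Fintype.card_subtype_eq,
        Nat.sub_add_cancel (Fintype.card_pos_iff.2 ⟨i⟩)]
    calc _ ≤ _ := Nat.mul_le_mul_right _ h1
      _ = _ := h2
  calc _ ≤ (Finset.univ.biUnion bad).card * Fintype.card B :=
        Nat.mul_le_mul_right _ (Finset.card_le_card hsub)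
    _ ≤ (∑ i, (bad i).card) * Fintype.card B := Nat.mul_le_mul_right _ Finset.card_biUnion_le
    _ = ∑ i, (bad i).card * Fintype.card B := Finset.sum_mul _ _ _
    _ ≤ ∑ _i : ι, Fintype.card B ^ Fintype.card ι := Finset.sum_le_sum fun i _ => hcard i
    _ = _ := by simp

/-! ### The algorithm -/

namespace Algorithm

open Exp Stmt

/-- The number `E = n * n * k` of arcs. -/
def countArcs : Stmt := block [mul .t (get .n) .n, mul .E (get .t) .k]

/-- Write arc `e`, from `u` to `v` in the color `c`, into the tables: its ends `src` and `dst`, its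
color `col`, and the opposite arc `mir`. -/
def tabulateArc : Stmt := block [
  put .src (get .e) (get .u), put .dst (get .e) (get .v), put .col (get .e) (get .c),
  mul .t (get .v) .n, mul .t (get .t + get .u) .k, put .mir (get .e) (get .t + get .c)]

/-- Pass on to the next triple `(u, v, c)`. -/
def nextArc : Stmt := block [
  set .c (get .c + lit 1),
  when (eq (get .c) (get .k)) (block [set .c (lit 0), set .v (get .v + lit 1),
    when (eq (get .v) (get .n)) (block [set .v (lit 0), set .u (get .u + lit 1)])])]

/-- If the bound is zero, only edges of weight zero are of use; then replace all denominators by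
one, which preserves the zeros, so that the search for the common denominator stops at once. The
running time may not depend on the denominators in this case, since `L = 0`. -/
def trimDenoms : Stmt := when (not (get .bound))
  (loop .e .E (put .snd (get .e) (not (not (elem .snd (get .e))))))

/-- Tabulate the arcs, and prepare the search for the common denominator. -/
def tabulate : Stmt := block [
  set .u (lit 0), set .v (lit 0), set .c (lit 0),
  loop .e .E (seq tabulateArc nextArc),
  trimDenoms, set .D (lit 0), set .go (lit 1)]

/-- Divide `D` by the denominator of arc `e`: `r` is the remainder, and `w` is the numerator times
the quotient. -/
def divide : Stmt := block [
  set .w (lit 0), set .r (lit 0),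
  loop .j .D (block [set .r (get .r + lit 1),
    when (eq (get .r) (elem .snd (get .e))) (block [set .r (lit 0),
      set .w (get .w + elem .fst (get .e))])])]

/-- The next candidate for the common denominator. -/
def nextDenom : Stmt := set .D (get .D + lit 1)

/-- Set `go` unless `D` is a multiple of all denominators. -/
def testDenom : Stmt := block [
  set .go (lit 0),
  loop .e .E (block [divide, when (and (elem .snd (get .e)) (get .r)) (set .go (lit 1))])]

/-- The scaled bound `L`, the scaled weights `wa`, and the table `al` of the allowed arcs of weight
at most `L`. -/
def scale : Stmt := block [
  mul .L (get .bound) .D,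
  loop .e .E (block [divide, put .wa (get .e) (get .w),
    put .al (get .e) (and (elem .snd (get .e)) (le (get .w) (get .L)))]),
  set .B (get .n + get .L + lit 1), set .p (lit 1), set .m0 (lit 0)]

/-- Find `m0` with `n + L + 1 ≤ 2 ^ m0`. -/
def findLog (c : ℕ) : Stmt := block [
  loop .j .B (when (not (le (get .B) (get .p)))
    (block [set .p (get .p + get .p), set .m0 (get .m0 + lit 1)])),
  set .Q (lit (c + 3)), set .m (lit 0), set .N (lit 1)]

/-- The number `m = Q * m0` of random bits for each arc, and `N = 2 ^ m`. -/
def randomRange : Stmt := block [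
  loop .j .Q (loop .t .m0 (block [set .N (get .N + get .N), set .m (get .m + lit 1)])),
  set .L1 (get .L + lit 1), mul .K (get .N + get .N) .n, set .K (get .K + lit 1)]

/-- The parameters of the matrix, the powers of two, and the offsets of the rows of `G`, which has
`n` rows of `X` coefficients. -/
def parameters : Stmt := block [
  mul .H (get .K) .L1, mul .T (get .H) .n, mul .nT (get .T) .n,
  set .X (get .nT + get .H + get .H), mul .nX (get .X) .n,
  set .S (lit 1),
  loop .j .k (block [put .pw (get .j) (get .S), set .S (get .S + get .S)]),
  set .o (lit 0),
  loop .v .n (block [put .off (get .v) (get .o), set .o (get .o + get .X)])]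

/-- A random number below `2 ^ m` for each arc. -/
def randomize : Stmt :=
  loop .e .E (block [set .r (lit 0),
    loop .j .m (block [flip .coin, set .r (get .r + get .r + get .coin)]),
    put .R (get .e) (get .r)])

/-- The exponents of the entries of the matrix. -/
def exponents : Stmt :=
  loop .e .E (block [mul .t (elem .wa (get .e)) .K,
    put .wt (get .e) (get .T + get .t + elem .R (get .e) + elem .R (elem .mir (get .e)))])

/-- The binary digits `chi` of `s`, which encode a set of colors. -/
def digits : Stmt := block [
  set .t (get .s),
  loop .j .k (block [set .c (get .k - (get .j + lit 1)),
    ite (le (elem .pw (get .c)) (get .t))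
      (block [put .chi (get .c) (lit 1), set .t (get .t - elem .pw (get .c))])
      (put .chi (get .c) (lit 0))])]

/-- The arcs that are allowed, have a color in the set `chi`, and are neither `f` nor opposite to
`f`. -/
def activate : Stmt :=
  loop .e .E (put .on (get .e) (and (and (elem .al (get .e)) (elem .chi (elem .col (get .e))))
    (and (not (eq (get .e) (get .f))) (not (eq (elem .mir (get .e)) (get .f))))))

/-- One arc `e` in the recurrence of `exists_borderDet_succ` for the coefficient at `pos`. -/
def extend : Stmt :=
  when (and (elem .on (get .e)) (le (elem .wt (get .e)) (get .pos))) (block [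
    set .val (elem .G (elem .off (elem .src (get .e)) + (get .pos - elem .wt (get .e)))),
    ite (eq (elem .dst (get .e)) (get .h))
      (put .P (get .pos) (xor (elem .P (get .pos)) (get .val)))
      (when (le (elem .dst (get .e)) (get .h))
        (put .G (elem .off (elem .dst (get .e)) + get .pos)
          (xor (elem .G (elem .off (elem .dst (get .e)) + get .pos)) (get .val))))])

/-- From the leading `h × h` block to the next one. The coefficients are computed in the order of
the degree, as each one depends on those of lower degree. -/
def border : Stmt := block [
  loop .j .nX (put .G (get .j) (lit 0)),
  loop .pos .X (put .G (elem .off (get .h) + get .pos) (elem .P (get .pos))),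
  loop .pos .X (loop .e .E extend)]

/-- The determinant `P` for the set `s` of colors. -/
def determinant : Stmt := block [
  digits, activate,
  loop .pos .X (put .P (get .pos) (not (get .pos))),
  loop .h .n border]

/-- The sum `acc` of the determinants over all sets of colors, without the arc `f`. For `f = E` no
arc is left out. -/
def sumDets : Stmt := block [
  loop .pos .X (put .acc (get .pos) (lit 0)),
  loop .s .S (block [determinant,
    loop .pos .X (put .acc (get .pos) (xor (elem .acc (get .pos)) (elem .P (get .pos))))])]

/-- The least exponent `W ≥ n * T` in the sum. -/
def findMin : Stmt := block [
  set .W (lit 0), set .found (lit 0),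
  loop .pos .X (when (and (not (get .found)) (and (le (get .nT) (get .pos))
    (elem .acc (get .pos)))) (block [set .W (get .pos), set .found (lit 1)]))]

/-- Select the arcs without which the term of exponent `W` vanishes. -/
def select : Stmt := block [
  set .f (get .E), sumDets, findMin,
  loop .f .E (block [sumDets, put .sel (get .f) (not (elem .acc (get .W)))])]

/-- One arc in the test of the selection. -/
def verifyArc : Stmt :=
  when (elem .sel (get .e)) (block [
    put .deg (elem .src (get .e)) (elem .deg (elem .src (get .e)) + lit 1),
    put .mark (elem .col (get .e)) (lit 1),
    put .fst (elem .src (get .e)) (elem .dst (get .e)),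
    put .snd (elem .src (get .e)) (elem .col (get .e)),
    set .sum (get .sum + elem .wa (get .e)),
    when (not (and (elem .al (get .e)) (elem .sel (elem .mir (get .e))))) (set .ok (lit 0))])

/-- Test whether the selected arcs form a solution, and output it. -/
def verify : Stmt := block [
  set .ok (lit 1), set .sum (lit 0),
  loop .e .E verifyArc,
  loop .u .n (when (not (eq (elem .deg (get .u)) (lit 1))) (set .ok (lit 0))),
  loop .c .k (when (not (elem .mark (get .c))) (set .ok (lit 0))),
  when (not (le (get .sum) (get .L + get .L))) (set .ok (lit 0)),
  set .n (get .ok)]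

/-- The phases between the search for the common denominator and the selection. -/
def phases (c : ℕ) : List Stmt :=
  [scale, findLog c, randomRange, parameters, randomize, exponents]

end Algorithm

/-- Execute statements one after the other. -/
def chain : List Stmt → Prog
  | [] => Stmt.skip.code
  | p :: l => .seq p.code (chain l)

open Algorithm in
/-- The algorithm, with error probability at most `1 / (n + L) ^ c`. There is no solution if there
are more colors than vertices. -/
def algorithm (c : ℕ) : Prog :=
  .seq ((Exp.le (.get .k) (.get .n)).code 0) (.cond (temp 0)
    (.seq countArcs.code (.seq tabulate.code
      (.seq (.loop Var.go.idx (.seq nextDenom.code testDenom.code))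
        (.seq (chain (phases c)) (.seq select.code verify.code)))))
    (Stmt.set .n (.lit 0)).code)

/-! ### The tables of arcs and the common denominator -/

open Stmt Exp in
/-- A loop that fills an array. -/
theorem loop_put {i y : Var} {a : Arr} {e : Exp} {σ : Store} (f : ℕ → ℕ)
    (h : ∀ j < σ.var y, ∀ τ : Store, (∀ x, x ≠ i → τ.var x = σ.var x) →
      (∀ b, b ≠ a → τ.arr b = σ.arr b) → (∀ l, j ≤ l → τ.arr a l = σ.arr a l) →
      e.eval (τ.setVar i j) = f j) (l : ℕ) :
    ((loop i y (put a (get i) e)).run σ).arr a l = if l < σ.var y then f l else σ.arr a l := by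
  obtain ⟨τ, -, hI, hrun⟩ := loop_rule (i := i) (y := y) (p := put a (get i) e) (σ := σ)
    (fun j τ => ∀ l, τ.arr a l = if l < j then f l else σ.arr a l) (by simp) (by
      intro j hj τ hF hI l
      have hv : ∀ x, x ≠ i → τ.var x = σ.var x := fun x hx => hF.var x (by
        simpa [writesVar] using hx.symm)
      have hb : ∀ b, b ≠ a → τ.arr b = σ.arr b := fun b hb => hF.arr b (by
        simpa [writesArr] using hb.symm)
      have hl : ∀ l, j ≤ l → τ.arr a l = σ.arr a l := fun l hl => by
        rw [hI, if_neg (by omega)]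
      simp only [run_put, Store.setArr_arr, eval_get, Store.setVar_var, if_true, true_and,
        h j hj τ hv hb hl, Store.setVar_arr, hI]
      split_ifs <;> first | rfl | omega | (congr 1; omega))
  rw [hrun, Store.setVar_arr, hI]

theorem div_mod_succ (e k : ℕ) :
    (e % k + 1 = k → (e + 1) / k = e / k + 1 ∧ (e + 1) % k = 0) ∧
      (e % k + 1 ≠ k → (e + 1) / k = e / k ∧ (e + 1) % k = e % k + 1) := by
  rcases Nat.eq_zero_or_pos k with rfl | hk
  · simp
  have h1 := Nat.div_add_mod e k
  have h2 := Nat.mod_lt e hk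
  refine ⟨fun h => (Nat.div_mod_unique hk).2 ⟨?_, hk⟩,
    fun h => (Nat.div_mod_unique hk).2 ⟨?_, by omega⟩⟩
  · rw [Nat.mul_add]; omega
  · omega

namespace Algorithm

open Stmt Exp

/-- The arrays `src`, `dst`, `col`, `mir` hold the ends and the color of each arc, and the
opposite arc. -/
structure Tables (n k : ℕ) (σ : Store) : Prop where
  src : ∀ e < n * n * k, σ.arr .src e = e / k / n
  dst : ∀ e < n * n * k, σ.arr .dst e = e / k % n
  col : ∀ e < n * n * k, σ.arr .col e = e % k
  mir : ∀ e < n * n * k, σ.arr .mir e = arc n k (e / k % n) (e / k / n) (e % k)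

theorem countArcs_spec (σ : Store) :
    (countArcs.run σ).var .E = σ.var .n * σ.var .n * σ.var .k := by
  simp [countArcs]

theorem trimDenoms_spec (σ : Store) (e : ℕ) (he : e < σ.var .E) :
    (trimDenoms.run σ).arr .snd e =
      if σ.var .bound = 0 then min 1 (σ.arr .snd e) else σ.arr .snd e := by
  rw [trimDenoms, run_when]
  by_cases hb : σ.var .bound = 0
  · simp only [eval_not, eval_get, hb, if_true, ne_eq, one_ne_zero, not_false_eq_true]
    rw [loop_put fun e => min 1 (σ.arr .snd e), if_pos he]
    intro j _ τ _ _ hl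
    simp only [eval_not, eval_elem, eval_get, Store.setVar_var, if_true, Store.setVar_arr,
      hl j le_rfl]
    by_cases h : σ.arr .snd j = 0
    · simp [h]
    · simp [h]
      omega
  · simp [hb]

theorem tabulate_spec {σ : Store} (hE : σ.var .E = σ.var .n * σ.var .n * σ.var .k) :
    Tables (σ.var .n) (σ.var .k) (tabulate.run σ) ∧ (tabulate.run σ).var .D = 0 ∧
      (tabulate.run σ).var .go = 1 ∧ ∀ e < σ.var .E, (tabulate.run σ).arr .snd e =
        if σ.var .bound = 0 then min 1 (σ.arr .snd e) else σ.arr .snd e := by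
  simp only [tabulate, run_block_cons, run_set, run_block_nil, eval_lit]
  set σ₁ := ((σ.setVar .u 0).setVar .v 0).setVar .c 0 with hσ₁
  obtain ⟨τ, hF, ⟨-, -, -, htab⟩, hrun⟩ := loop_rule (i := .e) (y := .E)
    (p := seq tabulateArc nextArc) (σ := σ₁) (fun e τ => τ.var .u = e / σ.var .k / σ.var .n ∧
      τ.var .v = e / σ.var .k % σ.var .n ∧ τ.var .c = e % σ.var .k ∧ ∀ e' < e,
        τ.arr .src e' = e' / σ.var .k / σ.var .n ∧ τ.arr .dst e' = e' / σ.var .k % σ.var .n ∧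
        τ.arr .col e' = e' % σ.var .k ∧ τ.arr .mir e' = arc (σ.var .n) (σ.var .k)
          (e' / σ.var .k % σ.var .n) (e' / σ.var .k / σ.var .n) (e' % σ.var .k))
    (by simp [hσ₁]) (by
      rintro e he τ hF ⟨hu, hv, hc, htab⟩
      have hn : τ.var .n = σ.var .n := (hF.var .n rfl).trans (by simp [hσ₁])
      have hk : τ.var .k = σ.var .k := (hF.var .k rfl).trans (by simp [hσ₁])
      replace he : e < σ.var .n * σ.var .n * σ.var .k := by simpa [hσ₁, hE] using he
      have h1 := div_mod_succ e (σ.var .k)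
      have h2 := div_mod_succ (e / σ.var .k) (σ.var .n)
      rw [run_seq]
      refine ⟨?_, ?_, ?_, ?_⟩
      · by_cases hc' : e % σ.var .k + 1 = σ.var .k
        · by_cases hv' : e / σ.var .k % σ.var .n + 1 = σ.var .n
          · simp [tabulateArc, nextArc, hn, hk, hu, hv, hc, hc', hv', (h1.1 hc').1, (h2.1 hv').1]
          · simp [tabulateArc, nextArc, hn, hk, hu, hv, hc, hc', hv', (h1.1 hc').1, (h2.2 hv').1]
        · simp [tabulateArc, nextArc, hk, hu, hc, hc', (h1.2 hc').1]
      · by_cases hc' : e % σ.var .k + 1 = σ.var .k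
        · by_cases hv' : e / σ.var .k % σ.var .n + 1 = σ.var .n
          · simp [tabulateArc, nextArc, hn, hk, hv, hc, hc', hv', (h1.1 hc').1, (h2.1 hv').2]
          · simp [tabulateArc, nextArc, hn, hk, hv, hc, hc', hv', (h1.1 hc').1, (h2.2 hv').2]
        · simp [tabulateArc, nextArc, hk, hv, hc, hc', (h1.2 hc').1]
      · by_cases hc' : e % σ.var .k + 1 = σ.var .k
        · by_cases hv' : e / σ.var .k % σ.var .n + 1 = σ.var .n
          · simp [tabulateArc, nextArc, hn, hk, hv, hc, hc', hv', (h1.1 hc').2]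
          · simp [tabulateArc, nextArc, hn, hk, hv, hc, hc', hv', (h1.1 hc').2]
        · simp [tabulateArc, nextArc, hk, hc, hc', (h1.2 hc').2]
      · intro e' he'
        rw [run_arr (p := nextArc) rfl, run_arr (p := nextArc) rfl, run_arr (p := nextArc) rfl,
          run_arr (p := nextArc) rfl]
        by_cases hlt : e' = e
        · subst hlt
          simp [tabulateArc, hn, hk, hu, hv, hc, arc]
        · simpa [tabulateArc, hlt] using htab e' (by omega))
  have hE₁ : σ₁.var .E = σ.var .n * σ.var .n * σ.var .k := by simp [hσ₁, hE]
  rw [hE₁] at htab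
  rw [hrun]
  refine ⟨⟨fun e he => ?_, fun e he => ?_, fun e he => ?_, fun e he => ?_⟩, ?_, ?_, ?_⟩
  · rw [Store.setVar_arr, Store.setVar_arr, run_arr rfl, Store.setVar_arr]
    exact (htab e he).1
  · rw [Store.setVar_arr, Store.setVar_arr, run_arr rfl, Store.setVar_arr]
    exact (htab e he).2.1
  · rw [Store.setVar_arr, Store.setVar_arr, run_arr rfl, Store.setVar_arr]
    exact (htab e he).2.2.1
  · rw [Store.setVar_arr, Store.setVar_arr, run_arr rfl, Store.setVar_arr]
    exact (htab e he).2.2.2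
  · simp
  · simp
  · intro e he
    have h1 : τ.var .E = σ.var .E := (hF.var .E rfl).trans (by simp [hσ₁])
    have h2 : τ.var .bound = σ.var .bound := (hF.var .bound rfl).trans (by simp [hσ₁])
    have h3 : τ.arr .snd = σ.arr .snd := (hF.arr .snd rfl).trans (by simp [hσ₁])
    rw [Store.setVar_arr, Store.setVar_arr, trimDenoms_spec _ _ (by simpa [h1] using he)]
    simp [h2, h3]

theorem divide_spec (σ : Store) :
    (divide.run σ).var .r = σ.var .D % σ.arr .snd (σ.var .e) ∧
      (divide.run σ).var .w =
        σ.arr .fst (σ.var .e) * (σ.var .D / σ.arr .snd (σ.var .e)) := by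
  simp only [divide, run_block_cons, run_set, run_block_nil, eval_lit]
  set σ₁ := (σ.setVar .w 0).setVar .r 0 with hσ₁
  set d := σ.arr .snd (σ.var .e) with hd'
  set a := σ.arr .fst (σ.var .e) with ha
  obtain ⟨τ, hF, ⟨h1, h2⟩, hrun⟩ := loop_rule (i := .j) (y := .D)
    (p := block [set .r (get .r + lit 1),
      when (eq (get .r) (elem .snd (get .e))) (block [set .r (lit 0),
      set .w (get .w + elem .fst (get .e))])]) (σ := σ₁)
    (fun j τ => τ.var .r = j % d ∧ τ.var .w = a * (j / d))
    (by simp [hσ₁]) (by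
      rintro j - τ hF ⟨hr, hw⟩
      have he : τ.var .e = σ.var .e := (hF.var .e rfl).trans (by simp [hσ₁])
      have h2 : τ.arr .snd = σ.arr .snd := (hF.arr .snd rfl).trans (by simp [hσ₁])
      have h3 : τ.arr .fst = σ.arr .fst := (hF.arr .fst rfl).trans (by simp [hσ₁])
      have h1 := div_mod_succ j d
      by_cases hj : j % d + 1 = d
      · have : τ.var .r + 1 = σ.arr .snd (σ.var .e) := by rw [hr, ← hd']; exact hj
        simp [he, h2, h3, this, hw, (h1.1 hj).1, (h1.1 hj).2, ← ha, Nat.mul_add]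
      · have : j % d + 1 ≠ σ.arr .snd (σ.var .e) := hj
        simp [he, h2, this, hr, hw, (h1.2 hj).1, (h1.2 hj).2])
  rw [hrun]
  have : σ₁.var .D = σ.var .D := by simp [hσ₁]
  rw [this] at h1 h2
  simp [h1, h2]

theorem testDenom_spec (σ : Store) :
    (testDenom.run σ).var .go =
      if ∀ e < σ.var .E, σ.arr .snd e ≠ 0 → σ.arr .snd e ∣ σ.var .D then 0 else 1 := by
  simp only [testDenom, run_block_cons, run_set, run_block_nil, eval_lit]
  set σ₁ := σ.setVar .go 0 with hσ₁
  obtain ⟨τ, hF, hI, hrun⟩ := loop_rule (i := .e) (y := .E)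
    (p := block [divide, when (and (elem .snd (get .e)) (get .r)) (set .go (lit 1))]) (σ := σ₁)
    (fun e τ => τ.var .go = if ∀ e' < e, σ.arr .snd e' ≠ 0 → σ.arr .snd e' ∣ σ.var .D
      then 0 else 1)
    (by simp [hσ₁]) (by
      intro e he τ hF hI
      have hD : τ.var .D = σ.var .D := (hF.var .D rfl).trans (by simp [hσ₁])
      have h2 : τ.arr .snd = σ.arr .snd := (hF.arr .snd rfl).trans (by simp [hσ₁])
      simp only [run_block_cons, run_block_nil, run_when]
      set υ := divide.run (τ.setVar .e e) with hυ
      have hgo : υ.var .go = τ.var .go := by rw [hυ, run_var rfl]; simp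
      have hs : υ.arr .snd = σ.arr .snd := by rw [hυ, run_arr rfl]; simp [h2]
      have hue : υ.var .e = e := by rw [hυ, run_var rfl]; simp
      have hiff : (∀ e' < e + 1, σ.arr .snd e' ≠ 0 → σ.arr .snd e' ∣ σ.var .D) ↔
          (∀ e' < e, σ.arr .snd e' ≠ 0 → σ.arr .snd e' ∣ σ.var .D) ∧
            (σ.arr .snd e ≠ 0 → σ.arr .snd e ∣ σ.var .D) := by
        constructor
        · exact fun h => ⟨fun e' he' => h e' (by omega), h e (by omega)⟩
        · rintro ⟨h, h'⟩ e' he'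
          rcases Nat.lt_succ_iff_lt_or_eq.1 he' with h3 | rfl
          exacts [h e' h3, h']
      simp only [hiff]
      by_cases hd : σ.arr .snd e = 0
      · simp [hue, hs, hd, hgo, hI]
      · have hr := (divide_spec (τ.setVar .e e)).1
        simp only [← hυ, Store.setVar_var, if_true, Store.setVar_arr, h2, hD, reduceCtorEq,
          if_false] at hr
        by_cases hdvd : σ.arr .snd e ∣ σ.var .D
        · simp [hue, hs, hr, Nat.mod_eq_zero_of_dvd hdvd, hgo, hI, hdvd]
        · have : σ.var .D % σ.arr .snd e ≠ 0 := fun h => hdvd (Nat.dvd_of_mod_eq_zero h)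
          simp [hue, hs, hr, this, hdvd, hd])
  rw [hrun]
  simpa [hσ₁] using hI

theorem scale_spec (σ : Store) :
    (scale.run σ).var .L = σ.var .bound * σ.var .D ∧
    (scale.run σ).var .B = σ.var .n + σ.var .bound * σ.var .D + 1 ∧
    (scale.run σ).var .p = 1 ∧ (scale.run σ).var .m0 = 0 ∧
    ∀ e < σ.var .E, (scale.run σ).arr .wa e = σ.arr .fst e * (σ.var .D / σ.arr .snd e) ∧
      ((scale.run σ).arr .al e ≠ 0 ↔ σ.arr .snd e ≠ 0 ∧
        σ.arr .fst e * (σ.var .D / σ.arr .snd e) ≤ σ.var .bound * σ.var .D) := by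
  simp only [scale, run_block_cons, run_set, run_mul, run_block_nil, eval_lit, eval_get]
  set σ₁ := σ.setVar .L (σ.var .bound * σ.var .D) with hσ₁
  obtain ⟨τ, hF, hI, hrun⟩ := loop_rule (i := .e) (y := .E)
    (p := block [divide, put .wa (get .e) (get .w),
      put .al (get .e) (and (elem .snd (get .e)) (le (get .w) (get .L)))]) (σ := σ₁)
    (fun e τ => ∀ e' < e, τ.arr .wa e' = σ.arr .fst e' * (σ.var .D / σ.arr .snd e') ∧
      (τ.arr .al e' ≠ 0 ↔ σ.arr .snd e' ≠ 0 ∧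
        σ.arr .fst e' * (σ.var .D / σ.arr .snd e') ≤ σ.var .bound * σ.var .D))
    (by simp) (by
      intro e he τ hF hI e' he'
      have hD : τ.var .D = σ.var .D := (hF.var .D rfl).trans (by simp [hσ₁])
      have hL : τ.var .L = σ.var .bound * σ.var .D := (hF.var .L rfl).trans (by simp [hσ₁])
      have h1 : τ.arr .fst = σ.arr .fst := (hF.arr .fst rfl).trans (by simp [hσ₁])
      have h2 : τ.arr .snd = σ.arr .snd := (hF.arr .snd rfl).trans (by simp [hσ₁])
      simp only [run_block_cons, run_block_nil]
      set υ := divide.run (τ.setVar .e e) with hυ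
      have hs : υ.arr .snd = σ.arr .snd := by rw [hυ, run_arr rfl]; simp [h2]
      have hal : υ.arr .al = τ.arr .al := by rw [hυ, run_arr rfl]; simp
      have hwa : υ.arr .wa = τ.arr .wa := by rw [hυ, run_arr rfl]; simp
      have hue : υ.var .e = e := by rw [hυ, run_var rfl]; simp
      have huL : υ.var .L = σ.var .bound * σ.var .D := by rw [hυ, run_var rfl]; simp [hL]
      by_cases hlt : e' = e
      · subst hlt
        have hw := (divide_spec (τ.setVar .e e')).2
        simp only [← hυ, Store.setVar_var, if_true, Store.setVar_arr, h1, h2, hD, reduceCtorEq,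
          if_false] at hw
        simp [hue, hs, hw, huL]
      · simpa [hue, hlt, hal, hwa] using hI e' (by omega))
  have hn : τ.var .n = σ.var .n := (hF.var .n rfl).trans (by simp [hσ₁])
  have hL : τ.var .L = σ.var .bound * σ.var .D := (hF.var .L rfl).trans (by simp [hσ₁])
  rw [hrun]
  refine ⟨by simp [hL], by simp [hn, hL], by simp, by simp, fun e he => ?_⟩
  simpa using hI e (by simpa [hσ₁] using he)

/-! ### Parameters and random weights -/

theorem clog_two_le (B : ℕ) : Nat.clog 2 B ≤ B := Nat.clog_le_of_le_pow Nat.lt_two_pow_self.le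

theorem findLog_spec (c : ℕ) {σ : Store} (hp : σ.var .p = 1) (hm : σ.var .m0 = 0) :
    let τ := (findLog c).run σ
    τ.var .m0 = Nat.clog 2 (σ.var .B) ∧ τ.var .Q = c + 3 ∧ τ.var .m = 0 ∧ τ.var .N = 1 := by
  simp only [findLog, run_block_cons, run_set, run_block_nil, eval_lit]
  obtain ⟨τ, hF, ⟨h1, h2⟩, hrun⟩ := loop_rule (i := .j) (y := .B)
    (p := when (not (le (get .B) (get .p)))
      (block [set .p (get .p + get .p), set .m0 (get .m0 + lit 1)])) (σ := σ)
    (fun j τ => τ.var .p = 2 ^ τ.var .m0 ∧ τ.var .m0 = min j (Nat.clog 2 (σ.var .B)))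
    (by simp [hp, hm]) (by
      rintro j hj τ hF ⟨h1, h2⟩
      have hB' : τ.var .B = σ.var .B := hF.var .B rfl
      have hiff := Nat.clog_le_iff_le_pow (b := 2) one_lt_two (x := σ.var .B) (y := τ.var .m0)
      by_cases hle : σ.var .B ≤ τ.var .p
      · simp only [run_when, eval_not, eval_le, eval_get, Store.setVar_var, reduceCtorEq, if_false,
          hB', hle, if_true, one_ne_zero, ne_eq, not_true_eq_false]
        refine ⟨h1, ?_⟩
        rw [← h1] at hiff
        have := hiff.2 hle
        omega
      · have h5 : ¬ Nat.clog 2 (σ.var .B) ≤ τ.var .m0 := by rwa [hiff, ← h1]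
        have h6 : τ.var .p < σ.var .B := by omega
        simp only [run_when, eval_not, eval_le, eval_get, Store.setVar_var, reduceCtorEq, if_false,
          hB', hle, if_true, one_ne_zero, ne_eq, not_false_eq_true, run_block_cons, run_set,
          run_block_nil, eval_add, eval_lit]
        exact ⟨by rw [h1, pow_succ, Nat.mul_two], by omega⟩)
  rw [hrun]
  have := clog_two_le (σ.var .B)
  simp [h2, this]

theorem randomRange_spec {σ : Store} (hm : σ.var .m = 0) (hN : σ.var .N = 1) :
    let τ := randomRange.run σ
    τ.var .m = σ.var .Q * σ.var .m0 ∧ τ.var .N = 2 ^ (σ.var .Q * σ.var .m0) ∧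
      τ.var .L1 = σ.var .L + 1 ∧
      τ.var .K = (2 ^ (σ.var .Q * σ.var .m0) + 2 ^ (σ.var .Q * σ.var .m0)) * σ.var .n + 1 := by
  simp only [randomRange, run_block_cons, run_set, run_mul, run_block_nil]
  obtain ⟨τ, hF, ⟨h1, h2⟩, hrun⟩ := loop_rule (i := .j) (y := .Q)
    (p := loop .t .m0 (block [set .N (get .N + get .N), set .m (get .m + lit 1)])) (σ := σ)
    (fun j τ => τ.var .m = j * σ.var .m0 ∧ τ.var .N = 2 ^ (j * σ.var .m0))
    (by simp [hm, hN]) (by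
      rintro j hj τ hF ⟨h1, h2⟩
      have hm0 : τ.var .m0 = σ.var .m0 := hF.var .m0 rfl
      obtain ⟨υ, -, ⟨g1, g2⟩, hrun⟩ := loop_rule (i := .t) (y := .m0)
        (p := block [set .N (get .N + get .N), set .m (get .m + lit 1)]) (σ := τ.setVar .j j)
        (fun l υ => υ.var .m = j * σ.var .m0 + l ∧ υ.var .N = 2 ^ (j * σ.var .m0 + l))
        (by simp [h1, h2]) (by
          rintro l hl υ hF ⟨h1, h2⟩
          simp [h1, h2, ← Nat.add_assoc, pow_succ]
          omega)
      rw [hrun]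
      simp only [Store.setVar_var, reduceCtorEq, if_false, hm0] at g1 g2
      simp [g1, g2, Nat.add_mul])
  have hL : τ.var .L = σ.var .L := hF.var .L rfl
  have hn : τ.var .n = σ.var .n := hF.var .n rfl
  rw [hrun]
  simp [h1, h2, hL, hn]

theorem parameters_spec (σ : Store) :
    let τ := parameters.run σ
    let H := σ.var .K * σ.var .L1
    let X := H * σ.var .n * σ.var .n + H + H
    τ.var .H = H ∧ τ.var .T = H * σ.var .n ∧ τ.var .nT = H * σ.var .n * σ.var .n ∧
      τ.var .X = X ∧ τ.var .nX = X * σ.var .n ∧ τ.var .S = 2 ^ σ.var .k ∧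
      (∀ j < σ.var .k, τ.arr .pw j = 2 ^ j) ∧ ∀ v < σ.var .n, τ.arr .off v = v * X := by
  intro τ H X
  have hτ : τ = parameters.run σ := rfl
  simp only [parameters, run_block_cons, run_set, run_mul, run_block_nil, eval_lit] at hτ
  set σ₁ := Store.setVar _ .S 1 with hσ₁
  obtain ⟨υ, hF, ⟨h1, h2⟩, hrun⟩ := loop_rule (i := .j) (y := .k)
    (p := block [put .pw (get .j) (get .S), set .S (get .S + get .S)]) (σ := σ₁)
    (fun j υ => υ.var .S = 2 ^ j ∧ ∀ j' < j, υ.arr .pw j' = 2 ^ j') (by simp [hσ₁]) (by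
      rintro j hj υ hF ⟨h1, h2⟩
      refine ⟨by simp [h1, pow_succ]; omega, fun j' hj' => ?_⟩
      by_cases hlt : j' = j
      · simp [hlt, h1]
      · simpa [hlt] using h2 j' (by omega))
  rw [hrun] at hτ
  set σ₂ := (υ.setVar .j (σ₁.var .k)).setVar .o 0 with hσ₂
  have hX : σ₂.var .X = X := by
    simp only [hσ₂, Store.setVar_var, reduceCtorEq, if_false]
    rw [hF.var .X rfl]
    simp [hσ₁, X, H]
  have hn : σ₂.var .n = σ.var .n := by
    simp only [hσ₂, Store.setVar_var, reduceCtorEq, if_false]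
    rw [hF.var .n rfl]
    simp [hσ₁]
  obtain ⟨φ, hG, ⟨g1, g2⟩, hrun'⟩ := loop_rule (i := .v) (y := .n)
    (p := block [put .off (get .v) (get .o), set .o (get .o + get .X)]) (σ := σ₂)
    (fun v φ => φ.var .o = v * X ∧ ∀ v' < v, φ.arr .off v' = v' * X) (by simp [hσ₂]) (by
      rintro j hj φ hG ⟨g1, g2⟩
      have : φ.var .X = X := (hG.var .X rfl).trans hX
      refine ⟨by simp [g1, this, Nat.add_mul], fun j' hj' => ?_⟩
      by_cases hlt : j' = j
      · simp [hlt, g1]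
      · simpa [hlt] using g2 j' (by omega))
  rw [hrun'] at hτ
  have hv : ∀ x, x ≠ .v → x ≠ .o → x ≠ .j → x ≠ .S → τ.var x = σ₁.var x := by
    intro x h1 h2 h3 h4
    rw [hτ, Store.setVar_var, if_neg h1, hG.var x (by
      simp [writesVar, block, h1.symm, h2.symm]), hσ₂]
    simp only [Store.setVar_var, h2, h3, if_false]
    exact hF.var x (by simp [writesVar, block, h3.symm, h4.symm])
  refine ⟨?_, ?_, ?_, ?_, ?_, ?_, fun j hj => ?_, fun v hv => ?_⟩
  · rw [hv _ (by simp) (by simp) (by simp) (by simp)]; simp [hσ₁, H]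
  · rw [hv _ (by simp) (by simp) (by simp) (by simp)]; simp [hσ₁, H]
  · rw [hv _ (by simp) (by simp) (by simp) (by simp)]; simp [hσ₁, H]
  · rw [hv _ (by simp) (by simp) (by simp) (by simp)]; simp [hσ₁, X, H]
  · rw [hv _ (by simp) (by simp) (by simp) (by simp)]; simp [hσ₁, X, H]
  · rw [hτ, Store.setVar_var, if_neg (by simp), hG.var .S rfl, hσ₂]
    simp [h1, hσ₁]
  · rw [hτ, Store.setVar_arr, hG.arr .pw rfl, hσ₂]
    simp only [Store.setVar_arr]
    exact h2 j (by simpa [hσ₁] using hj)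
  · rw [hτ, Store.setVar_arr]
    exact g2 v (by rwa [hn])

end Algorithm

/-! ### Random bits and exponents -/

/-- The number with the first `m` bits of `ω` as its binary digits, the most significant first. -/
def bitsVal (ω : ℕ → Bool) : ℕ → ℕ
  | 0 => 0
  | j + 1 => bitsVal ω j + bitsVal ω j + if ω j then 1 else 0

theorem bitsVal_lt (ω : ℕ → Bool) (m : ℕ) : bitsVal ω m < 2 ^ m := by
  induction m with
  | zero => simp [bitsVal]
  | succ m ih => rw [bitsVal, pow_succ]; split_ifs <;> omega

theorem bitsVal_inj {ω ω' : ℕ → Bool} {m : ℕ} (h : bitsVal ω m = bitsVal ω' m) :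
    ∀ j < m, ω j = ω' j := by
  induction m with
  | zero => simp
  | succ m ih =>
    simp only [bitsVal] at h
    have h1 : bitsVal ω m = bitsVal ω' m := by split_ifs at h <;> omega
    intro j hj
    rcases Nat.lt_succ_iff_lt_or_eq.1 hj with hj | rfl
    · exact ih h1 j hj
    · rw [h1] at h
      cases h2 : ω j <;> cases h3 : ω' j <;> simp_all

theorem bitsVal_congr {ω ω' : ℕ → Bool} {m : ℕ} (h : ∀ j < m, ω j = ω' j) :
    bitsVal ω m = bitsVal ω' m := by
  induction m with
  | zero => rfl
  | succ m ih => rw [bitsVal, bitsVal, ih fun j hj => h j (by omega), h m (by omega)]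

namespace Algorithm

open Stmt Exp

theorem randomize_spec (σ : Store) : ∀ e < σ.var .E,
    (randomize.run σ).arr .R e =
      bitsVal (fun j => σ.coins (j + e * σ.var .m)) (σ.var .m) := by
  obtain ⟨τ, hF, ⟨-, hI⟩, hrun⟩ := loop_rule (i := .e) (y := .E)
    (p := block [set .r (lit 0),
      loop .j .m (block [flip .coin, set .r (get .r + get .r + get .coin)]),
      put .R (get .e) (get .r)]) (σ := σ)
    (fun e τ => (τ.coins = fun i => σ.coins (i + e * σ.var .m)) ∧ ∀ e' < e, τ.arr .R e' =
      bitsVal (fun j => σ.coins (j + e' * σ.var .m)) (σ.var .m)) (by simp) (by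
      rintro e he τ hF ⟨hc, hI⟩
      have hm : τ.var .m = σ.var .m := hF.var .m rfl
      simp only [run_block_cons, run_block_nil, run_set, eval_lit]
      obtain ⟨υ, hG, ⟨h1, h2⟩, hrun⟩ := loop_rule (i := .j) (y := .m)
        (p := block [flip .coin, set .r (get .r + get .r + get .coin)])
        (σ := (τ.setVar .e e).setVar .r 0)
        (fun l υ => (υ.coins = fun i => τ.coins (i + l)) ∧ υ.var .r = bitsVal τ.coins l)
        (by simp [bitsVal]) (by
          rintro l hl υ hG ⟨h1, h2⟩
          simp [h1, h2, bitsVal, Nat.add_right_comm _ 1 l, Nat.add_assoc])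
      rw [hrun]
      simp only [Store.setVar_var, reduceCtorEq, if_false, hm] at h1 h2
      have hue : υ.var .e = e := by rw [hG.var .e rfl]; simp
      have huR : υ.arr .R = τ.arr .R := by rw [hG.arr .R rfl]; simp
      refine ⟨?_, fun e' he' => ?_⟩
      · funext i
        simp [h1, hc, Nat.add_mul]
        congr 1
        ring
      · by_cases hlt : e' = e
        · simp [hlt, hue, h2, hc]
        · simpa [hlt, hue, huR] using hI e' (by omega))
  intro e he
  rw [randomize, hrun]
  exact hI e he

theorem exponents_spec (σ : Store) : ∀ e < σ.var .E,
    (exponents.run σ).arr .wt e =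
      σ.var .T + σ.arr .wa e * σ.var .K + σ.arr .R e + σ.arr .R (σ.arr .mir e) := by
  obtain ⟨τ, hF, hI, hrun⟩ := loop_rule (i := .e) (y := .E)
    (p := block [mul .t (elem .wa (get .e)) .K,
      put .wt (get .e) (get .T + get .t + elem .R (get .e) + elem .R (elem .mir (get .e)))])
    (σ := σ) (fun e τ => ∀ e' < e, τ.arr .wt e' =
      σ.var .T + σ.arr .wa e' * σ.var .K + σ.arr .R e' + σ.arr .R (σ.arr .mir e')) (by simp) (by
      rintro e he τ hF hI e' he'
      by_cases hlt : e' = e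
      · simp [hlt, hF.var .T rfl, hF.var .K rfl, hF.arr .wa rfl, hF.arr .R rfl, hF.arr .mir rfl]
      · simpa [hlt] using hI e' (by omega))
  intro e he
  rw [exponents, hrun]
  exact hI e he

/-! ### The determinants -/

theorem digits_spec {σ : Store} (hpw : ∀ j < σ.var .k, σ.arr .pw j = 2 ^ j)
    (hs : σ.var .s < 2 ^ σ.var .k) :
    ∀ c < σ.var .k, (digits.run σ).arr .chi c = σ.var .s / 2 ^ c % 2 := by
  simp only [digits, run_block_cons, run_set, run_block_nil, eval_get]
  obtain ⟨τ, hF, ⟨-, hI⟩, hrun⟩ := loop_rule (i := .j) (y := .k)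
    (p := block [set .c (get .k - (get .j + lit 1)),
      ite (le (elem .pw (get .c)) (get .t))
        (block [put .chi (get .c) (lit 1), set .t (get .t - elem .pw (get .c))])
        (put .chi (get .c) (lit 0))]) (σ := σ.setVar .t (σ.var .s))
    (fun j τ => τ.var .t = σ.var .s % 2 ^ (σ.var .k - j) ∧
      ∀ c < σ.var .k, σ.var .k ≤ c + j → τ.arr .chi c = σ.var .s / 2 ^ c % 2)
    (by
      refine ⟨by simp [Nat.mod_eq_of_lt hs], fun c h1 h2 => by omega⟩) (by
      rintro j hj τ hF ⟨ht, hI⟩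
      replace hj : j < σ.var .k := by simpa using hj
      have hk : τ.var .k = σ.var .k := hF.var .k rfl
      have hp : τ.arr .pw = σ.arr .pw := hF.arr .pw rfl
      set d := σ.var .k - (j + 1) with hd
      have hd' : σ.var .k - j = d + 1 := by omega
      rw [hd'] at ht
      have hpd : σ.arr .pw d = 2 ^ d := hpw d (by omega)
      -- the digit in place `d` of the remainder modulo `2 ^ (d + 1)`
      have hmod : σ.var .s % 2 ^ (d + 1) = σ.var .s % 2 ^ d + 2 ^ d * (σ.var .s / 2 ^ d % 2) := by
        rw [pow_succ, Nat.mod_mul]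
      have hlt : σ.var .s % 2 ^ d < 2 ^ d := Nat.mod_lt _ (by positivity)
      simp only [run_block_cons, run_block_nil, run_set, run_ite, run_put, eval_le, eval_sub,
        eval_get, eval_elem, eval_add, eval_lit, Store.setVar_var, Store.setVar_arr, reduceCtorEq,
        if_true, if_false, hk, hp, ← hd, hpd, ht]
      rcases Nat.mod_two_eq_zero_or_one (σ.var .s / 2 ^ d) with h0 | h0
      · have hle : ¬ 2 ^ d ≤ σ.var .s % 2 ^ (d + 1) := by rw [hmod, h0]; omega
        simp only [hle, if_false, ne_eq, not_true_eq_false]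
        refine ⟨by simp [ht, hmod, h0], fun c hc hcj => ?_⟩
        by_cases hcd : c = d
        · simp [hcd, h0]
        · simpa [hcd] using hI c hc (by omega)
      · have hle : 2 ^ d ≤ σ.var .s % 2 ^ (d + 1) := by rw [hmod, h0]; omega
        simp only [hle, if_true, ne_eq, one_ne_zero, not_false_eq_true]
        refine ⟨by simp [hmod, h0, hp, hpd, ht], fun c hc hcj => ?_⟩
        by_cases hcd : c = d
        · simp [hcd, h0]
        · simpa [hcd] using hI c hc (by omega))
  intro c hc
  rw [hrun]
  exact hI c hc (by simp)

theorem activate_spec (σ : Store) : ∀ e < σ.var .E,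
    (activate.run σ).arr .on e ≠ 0 ↔ (σ.arr .al e ≠ 0 ∧ σ.arr .chi (σ.arr .col e) ≠ 0) ∧
      e ≠ σ.var .f ∧ σ.arr .mir e ≠ σ.var .f := by
  intro e he
  rw [activate, loop_put fun e => if (σ.arr .al e ≠ 0 ∧ σ.arr .chi (σ.arr .col e) ≠ 0) ∧
      e ≠ σ.var .f ∧ σ.arr .mir e ≠ σ.var .f then 1 else 0, if_pos he]
  · simp [and_assoc]
  · intro j _ τ hv hb _
    simp [hv .f (by simp), hb .al (by simp), hb .chi (by simp), hb .col (by simp),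
      hb .mir (by simp)]

/-- Bits are numbers modulo two. -/
theorem val_add (a b : ZMod 2) : (a + b).val = (a.val - b.val) + (b.val - a.val) := by
  revert a b; decide
end Algorithm

theorem sum_range_mul_eq {M : Type*} [AddCommMonoid M] (F : ℕ → M) (a b : ℕ) :
    ∑ e ∈ Finset.range (a * b), F e =
      ∑ i ∈ Finset.range a, ∑ j ∈ Finset.range b, F (i * b + j) := by
  induction a with
  | zero => simp
  | succ a ih => rw [Nat.succ_mul, Finset.sum_range_add, ih, Finset.sum_range_succ]

theorem arc_col {n k u v c : ℕ} (hc : c < k) : arc n k u v c % k = c := by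
  rw [arc, Nat.mul_add_mod', Nat.mod_eq_of_lt hc]

theorem arc_div {n k u v c : ℕ} (hc : c < k) : arc n k u v c / k = u * n + v := by
  rw [arc, Nat.mul_comm, Nat.mul_add_div (by omega), Nat.div_eq_of_lt hc, Nat.add_zero]

theorem arc_src {n k u v c : ℕ} (hv : v < n) (hc : c < k) : arc n k u v c / k / n = u := by
  rw [arc_div hc, Nat.mul_comm, Nat.mul_add_div (by omega), Nat.div_eq_of_lt hv, Nat.add_zero]

theorem arc_dst {n k u v c : ℕ} (hv : v < n) (hc : c < k) : arc n k u v c / k % n = v := by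
  rw [arc_div hc, Nat.mul_add_mod', Nat.mod_eq_of_lt hv]

theorem arc_lt {n k u v c : ℕ} (hu : u < n) (hv : v < n) (hc : c < k) :
    arc n k u v c < n * n * k := by
  have h1 : u * n + v < n * n := by nlinarith
  unfold arc
  nlinarith

/-- Sums over all arcs. -/
theorem sum_arcs_eq {M : Type*} [AddCommMonoid M] (F : ℕ → M) (n k : ℕ) :
    ∑ e ∈ Finset.range (n * n * k), F e = ∑ u ∈ Finset.range n, ∑ v ∈ Finset.range n,
      ∑ c ∈ Finset.range k, F (arc n k u v c) := by
  rw [sum_range_mul_eq, sum_range_mul_eq]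
  rfl

open PowerSeries in
open Classical in
/-- A coefficient of the product of a row vector with a column of the matrix, as a sum over all
arcs. -/
theorem coeff_sum_mul_arcSeries (n k : ℕ) (al : ℕ → Prop) (wt : ℕ → ℕ) (χ : ℕ → Prop)
    (γ : ℕ → (ZMod 2)⟦X⟧) (x v : ℕ) (hv : v < n) :
    coeff x (∑ u ∈ Finset.range n, γ u * arcSeries n k al wt χ u v) =
      ∑ e ∈ Finset.range (n * n * k), if e / k % n = v ∧ (al e ∧ χ (e % k)) ∧ wt e ≤ x
        then coeff (x - wt e) (γ (e / k / n)) else 0 := by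
  rw [sum_arcs_eq, map_sum]
  refine Finset.sum_congr rfl fun u hu => ?_
  rw [Finset.sum_eq_single v]
  · rw [arcSeries, Finset.mul_sum, map_sum]
    refine Finset.sum_congr rfl fun c hc => ?_
    have hc := Finset.mem_range.1 hc
    rw [arc_src hv hc, arc_dst hv hc, arc_col hc, mul_ite, mul_zero,
      apply_ite (coeff (R := ZMod 2) x), coeff_mul_X_pow']
    simp only [true_and, map_zero]
    rw [← ite_and]
  · intro v' hv' hne
    refine Finset.sum_eq_zero fun c hc => ?_
    rw [arc_dst (Finset.mem_range.1 hv') (Finset.mem_range.1 hc), if_neg fun h => hne h.1]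
  · intro h
    exact absurd (Finset.mem_range.2 hv) h

theorem row_inj {X v v' x x' : ℕ} (hx : x < X) (hx' : x' < X) :
    v * X + x = v' * X + x' ↔ v = v' ∧ x = x' := by
  constructor
  · intro h
    have h1 : (v * X + x) / X = v := by
      rw [Nat.mul_comm, Nat.mul_add_div (by omega), Nat.div_eq_of_lt hx, Nat.add_zero]
    have h2 : (v' * X + x') / X = v' := by
      rw [Nat.mul_comm, Nat.mul_add_div (by omega), Nat.div_eq_of_lt hx', Nat.add_zero]
    have h3 : v = v' := by rw [← h1, ← h2, h]
    subst h3
    exact ⟨rfl, by omega⟩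
  · rintro ⟨rfl, rfl⟩; rfl

namespace Algorithm

open Stmt Exp

/-- The variables and arrays that the computation of determinants reads. -/
structure DetData (n k X : ℕ) (on : ℕ → Prop) (wt : ℕ → ℕ) (τ : Store) : Prop where
  E_eq : τ.var .E = n * n * k
  n_eq : τ.var .n = n
  X_eq : τ.var .X = X
  nX_eq : τ.var .nX = X * n
  src : ∀ e < n * n * k, τ.arr .src e = e / k / n
  dst : ∀ e < n * n * k, τ.arr .dst e = e / k % n
  off : ∀ v < n, τ.arr .off v = v * X
  on_iff : ∀ e < n * n * k, τ.arr .on e ≠ 0 ↔ on e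
  wt_eq : ∀ e < n * n * k, τ.arr .wt e = wt e

/-- The data are preserved by changes of other variables and arrays. -/
theorem DetData.congr {n k X : ℕ} {on : ℕ → Prop} {wt : ℕ → ℕ} {τ υ : Store}
    (h : DetData n k X on wt τ) (hv : ∀ x ∈ [Var.E, .n, .X, .nX], υ.var x = τ.var x)
    (ha : ∀ a ∈ [Arr.src, .dst, .off, .on, .wt], υ.arr a = τ.arr a) :
    DetData n k X on wt υ := by
  simp only [List.forall_mem_cons] at hv ha
  obtain ⟨h1, h2, h3, h4, -⟩ := hv
  obtain ⟨a1, a2, a3, a4, a5, -⟩ := ha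
  constructor
  · rw [h1]; exact h.E_eq
  · rw [h2]; exact h.n_eq
  · rw [h3]; exact h.X_eq
  · rw [h4]; exact h.nX_eq
  · rw [a1]; exact h.src
  · rw [a2]; exact h.dst
  · rw [a3]; exact h.off
  · rw [a4]; exact h.on_iff
  · rw [a5]; exact h.wt_eq

/-- The arrays `G` and `P` hold the bits `g` and `p`. -/
def Holds (n X : ℕ) (g : ℕ → ℕ → ZMod 2) (p : ℕ → ZMod 2) (τ : Store) : Prop :=
  (∀ v < n, ∀ x < X, τ.arr .G (v * X + x) = (g v x).val) ∧ ∀ x < X, τ.arr .P x = (p x).val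

open Classical in
/-- The arc `e` contributes one term to a coefficient of `G`, or of `P` if it leads to `h`. -/
theorem extend_spec {n k X : ℕ} {on : ℕ → Prop} {wt : ℕ → ℕ} {τ : Store} {g : ℕ → ℕ → ZMod 2}
    {p : ℕ → ZMod 2} {e x h : ℕ} (hd : DetData n k X on wt τ) (hH : Holds n X g p τ)
    (he : τ.var .e = e) (hx : τ.var .pos = x) (hh : τ.var .h = h) (heE : e < n * n * k)
    (hxX : x < X) (hhn : h < n) :
    Holds n X
      (fun v x' => g v x' + if x' = x ∧ v < h ∧ e / k % n = v ∧ on e ∧ wt e ≤ x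
        then g (e / k / n) (x - wt e) else 0)
      (fun x' => p x' + if x' = x ∧ e / k % n = h ∧ on e ∧ wt e ≤ x
        then g (e / k / n) (x - wt e) else 0) (extend.run τ) := by
  have hn0 : 0 < n := by omega
  have hsrc : e / k / n < n := by
    rw [Nat.div_div_eq_div_mul]
    refine Nat.div_lt_of_lt_mul ?_
    exact heE.trans_le (by ring_nf; rfl)
  have hdst : e / k % n < n := Nat.mod_lt _ hn0
  rw [extend, run_when]
  by_cases hc : on e ∧ wt e ≤ x
  · have hval : τ.arr .G (e / k / n * X + (x - wt e)) = (g (e / k / n) (x - wt e)).val :=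
      hH.1 _ hsrc _ (by omega)
    have hon : τ.arr .on e ≠ 0 := (hd.on_iff e heE).2 hc.1
    simp only [eval_and, eval_le, eval_elem, eval_get, he, hx, hd.wt_eq e heE, hc.2, hon, if_true,
      ne_eq, one_ne_zero, not_false_eq_true, and_self, run_block_cons, run_set, run_block_nil,
      eval_add, eval_sub, hd.src e heE, hd.off _ hsrc, hval, run_ite, eval_eq, Store.setVar_var,
      Store.setVar_arr, reduceCtorEq, if_false, hd.dst e heE, hh, run_when, run_put, eval_xor,
      hd.off _ hdst, hc.1, and_true]
    by_cases h1 : e / k % n = h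
    · simp only [h1, if_true, one_ne_zero, not_false_eq_true]
      refine ⟨fun v hv x' hx' => ?_, fun x' hx' => ?_⟩
      · have : ¬(x' = x ∧ v < h ∧ h = v) := fun h => by omega
        simpa [this] using hH.1 v hv x' hx'
      · by_cases hxx : x' = x
        · subst hxx
          simp [val_add, hH.2 x' hx']
        · simpa [hxx] using hH.2 x' hx'
    · simp only [h1, if_false, not_true_eq_false]
      by_cases h2 : e / k % n ≤ h
      · simp only [h2, if_true, one_ne_zero, not_false_eq_true]
        refine ⟨fun v hv x' hx' => ?_, fun x' hx' => ?_⟩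
        · simp only [Store.setArr_arr, row_inj hx' hxX, true_and]
          by_cases hvx : v = e / k % n ∧ x' = x
          · obtain ⟨rfl, rfl⟩ := hvx
            have : e / k % n < h := by omega
            simp [this, val_add, hH.1 _ hv x' hx']
          · have : ¬(x' = x ∧ v < h ∧ e / k % n = v) := fun h => hvx ⟨h.2.2.symm, h.1⟩
            simpa [hvx, this] using hH.1 v hv x' hx'
        · simpa using hH.2 x' hx'
      · simp only [h2, if_false, not_true_eq_false]
        refine ⟨fun v hv x' hx' => ?_, fun x' hx' => ?_⟩
        · have : ¬(x' = x ∧ v < h ∧ e / k % n = v) := fun h => by omega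
          simpa [this] using hH.1 v hv x' hx'
        · simpa using hH.2 x' hx'
  · have hcond : ¬(τ.arr .on e ≠ 0 ∧ τ.arr .wt e ≤ x) := by
      rwa [hd.on_iff e heE, hd.wt_eq e heE]
    have hcond' : (and (elem .on (get .e)) (le (elem .wt (get .e)) (get .pos))).eval τ = 0 := by
      simp only [eval_and, eval_le, eval_elem, eval_get, he, hx, ite_eq_right_iff, one_ne_zero,
        imp_false, ne_eq, not_and, not_not] at hcond ⊢
      exact fun h1 h2 => hcond h1 h2
    have e1 : ∀ a b c : Prop, ¬ (a ∧ b ∧ c ∧ on e ∧ wt e ≤ x) := fun _ _ _ h => hc h.2.2.2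
    have e2 : ∀ a c : Prop, ¬ (a ∧ c ∧ on e ∧ wt e ≤ x) := fun _ _ h => hc h.2.2
    simpa [hcond', e1, e2] using hH

open PowerSeries in
/-- The recurrence of `exists_borderDet_succ`, one coefficient after the other. -/
theorem border_spec {n k X : ℕ} {al χ : ℕ → Prop} {wt : ℕ → ℕ} {τ : Store} {h : ℕ}
    (hd : DetData n k X (fun e => al e ∧ χ (e % k)) wt τ) (hh : τ.var .h = h) (hhn : h < n)
    (hwt : ∀ e < n * n * k, 0 < wt e)
    (hP : ∀ x < X, τ.arr .P x = (coeff x (borderDet (arcSeries n k al wt χ) h)).val) :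
    ∀ x < X, (border.run τ).arr .P x =
      (coeff x (borderDet (arcSeries n k al wt χ) (h + 1))).val := by
  classical
  have ha : ∀ u < h, ∀ v < h, constantCoeff (arcSeries n k al wt χ u v) = 0 := by
    intro u hu v hv
    rw [arcSeries, map_sum]
    refine Finset.sum_eq_zero fun c hc => ?_
    have := hwt _ (arc_lt (hu.trans hhn) (hv.trans hhn) (Finset.mem_range.1 hc))
    split_ifs
    · simp [this.ne']
    · simp
  obtain ⟨Γ, hΓh, hΓ0, hΓ, hsucc⟩ := exists_borderDet_succ (arcSeries n k al wt χ) h ha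
  set γ : ℕ → ℕ → ZMod 2 := fun v x => coeff x (Γ v) with hγ
  set δ : ℕ → ZMod 2 := fun x => coeff x (borderDet (arcSeries n k al wt χ) h) with hδ
  set δ' : ℕ → ZMod 2 := fun x => coeff x (borderDet (arcSeries n k al wt χ) (h + 1)) with hδ'
  -- the contribution of the arc `e` to the coefficient at `x`
  set term : ℕ → ℕ → ℕ → ZMod 2 := fun v x e =>
    if e / k % n = v ∧ (al e ∧ χ (e % k)) ∧ wt e ≤ x then γ (e / k / n) (x - wt e) else 0
    with hterm
  have hsum : ∀ v < n, ∀ x, coeff x (∑ u ∈ Finset.range (h + 1), Γ u * arcSeries n k al wt χ u v) =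
      ∑ e ∈ Finset.range (n * n * k), term v x e := by
    intro v hv x
    have : ∑ u ∈ Finset.range (h + 1), Γ u * arcSeries n k al wt χ u v =
        ∑ u ∈ Finset.range n, Γ u * arcSeries n k al wt χ u v := by
      refine Finset.sum_subset (Finset.range_mono (by omega)) fun u _ hu => ?_
      rw [hΓ0 u (by simpa [Nat.lt_succ_iff] using hu), zero_mul]
    rw [this, coeff_sum_mul_arcSeries _ _ _ _ _ _ _ _ hv]
  have hγ_rec : ∀ v < h, ∀ x, γ v x = ∑ e ∈ Finset.range (n * n * k), term v x e := by
    intro v hv x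
    rw [← hsum v (by omega), ← hΓ v hv]
  have hδ_rec : ∀ x, δ' x = δ x + ∑ e ∈ Finset.range (n * n * k), term h x e := by
    intro x
    simp only [hδ', hδ]
    rw [hsucc, CharTwo.sub_eq_add, map_add, hsum h hhn]
  have hγh : ∀ x, γ h x = δ x := fun x => by simp only [hγ, hδ, hΓh]
  have hγ0 : ∀ v, h < v → ∀ x, γ v x = 0 := fun v hv x => by simp only [hγ, hΓ0 v hv, map_zero]
  simp only [border, run_block_cons, run_block_nil]
  -- clear the rows of `G`, and fill row `h`
  set τ₁ := (loop .j .nX (put .G (get .j) (lit 0))).run τ with hτ₁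
  have hd₁ : DetData n k X (fun e => al e ∧ χ (e % k)) wt τ₁ :=
    hd.congr (by intro x hx; simp only [hτ₁]; rw [run_var]; fin_cases hx <;> rfl)
      (by intro a ha; simp only [hτ₁]; rw [run_arr]; fin_cases ha <;> rfl)
  have hG₁ : ∀ v < n, ∀ x < X, τ₁.arr .G (v * X + x) = 0 := by
    intro v hv x hx
    rw [hτ₁, loop_put fun _ => 0, if_pos]
    · rw [hd.nX_eq]
      nlinarith
    · intros; rfl
  have hP₁ : τ₁.arr .P = τ.arr .P := by rw [hτ₁, run_arr rfl]
  have hh₁ : τ₁.var .h = h := by rw [hτ₁, run_var rfl, hh]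
  obtain ⟨τ₂, hF₂, hI₂, hrun₂⟩ := loop_rule (i := .pos) (y := .X)
    (p := put .G (elem .off (get .h) + get .pos) (elem .P (get .pos))) (σ := τ₁)
    (fun x₀ τ => ∀ v < n, ∀ x < X,
      τ.arr .G (v * X + x) = if v = h ∧ x < x₀ then (δ x).val else 0)
    (by simpa using hG₁) (by
      intro x₀ hx₀ υ hF hI v hv x hx
      rw [hd₁.X_eq] at hx₀
      simp only [run_put, Store.setArr_arr, eval_add, eval_elem, eval_get, Store.setVar_arr,
        Store.setVar_var, reduceCtorEq, if_true, if_false, true_and, hF.arr .off rfl,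
        hF.arr .P rfl, hF.var .h rfl, hh₁, hd₁.off h hhn, row_inj hx hx₀, hP₁, hP x₀ hx₀]
      by_cases hvh : v = h
      · by_cases hxx : x = x₀
        · simp [hvh, hxx, hδ]
        · have : x < x₀ + 1 ↔ x < x₀ := by omega
          simpa [hvh, hxx, this] using hI v hv x hx
      · simpa [hvh] using hI v hv x hx)
  rw [hrun₂]
  set τ₃ := τ₂.setVar .pos (τ₁.var .X) with hτ₃
  have hd₃ : DetData n k X (fun e => al e ∧ χ (e % k)) wt τ₃ :=
    hd₁.congr (by
      intro x hx
      simp only [hτ₃, Store.setVar_var]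
      rw [if_neg (by fin_cases hx <;> simp), hF₂.var x (by fin_cases hx <;> rfl)])
      (by
        intro a ha
        simp only [hτ₃, Store.setVar_arr]
        exact hF₂.arr a (by fin_cases ha <;> rfl))
  have hh₃ : τ₃.var .h = h := by
    simp only [hτ₃, Store.setVar_var, reduceCtorEq, if_false]
    rw [hF₂.var .h rfl, hh₁]
  -- the state after all coefficients below `x₀` and the arcs below `e₀` for the coefficient at `x₀`
  set g : ℕ → ℕ → ℕ → ℕ → ZMod 2 := fun x₀ e₀ v x =>
    if v < h then if x < x₀ then γ v x else
      if x = x₀ then ∑ e ∈ Finset.range e₀, term v x e else 0 else γ v x with hg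
  set p : ℕ → ℕ → ℕ → ZMod 2 := fun x₀ e₀ x =>
    if x < x₀ then δ' x else if x = x₀ then δ x + ∑ e ∈ Finset.range e₀, term h x e else δ x
    with hp
  have hg_succ : ∀ x₀, g x₀ (n * n * k) = g (x₀ + 1) 0 := by
    intro x₀
    funext v x
    simp only [hg]
    by_cases hv : v < h
    · rcases lt_trichotomy x x₀ with hx | rfl | hx
      · simp [hv, hx, Nat.lt_succ_of_lt hx]
      · simp [hv, hγ_rec v hv]
      · have h1 : ¬ x < x₀ := by omega
        have h2 : x ≠ x₀ := by omega
        have h3 : ¬ x < x₀ + 1 := by omega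
        simp [hv, h1, h2, h3]
    · simp [hv]
  have hp_succ : ∀ x₀, p x₀ (n * n * k) = p (x₀ + 1) 0 := by
    intro x₀
    funext x
    simp only [hp]
    rcases lt_trichotomy x x₀ with hx | rfl | hx
    · simp [hx, Nat.lt_succ_of_lt hx]
    · simp [hδ_rec]
    · have h1 : ¬ x < x₀ := by omega
      have h2 : x ≠ x₀ := by omega
      have h3 : ¬ x < x₀ + 1 := by omega
      simp [h1, h2, h3]
  obtain ⟨τ₄, -, hI₄, hrun₄⟩ := loop_rule (i := .pos) (y := .X) (p := loop .e .E extend) (σ := τ₃)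
    (fun x₀ τ => Holds n X (g x₀ 0) (p x₀ 0) τ) (by
      refine ⟨fun v hv x hx => ?_, fun x hx => ?_⟩
      · simp only [hτ₃, Store.setVar_arr]
        rw [hI₂ v hv x hx, hd₁.X_eq]
        simp only [hg, hx, and_true]
        rcases lt_trichotomy v h with hvh | rfl | hvh
        · simp [hvh, hvh.ne]
        · simp [hγh]
        · simp [hvh.not_gt, hvh.ne', hγ0 v hvh]
      · simp only [hτ₃, Store.setVar_arr]
        rw [hF₂.arr .P rfl, hP₁, hP x hx]
        simp [hp, hδ]) (by
      intro x₀ hx₀ υ hF hI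
      rw [hd₃.X_eq] at hx₀
      have hdυ : DetData n k X (fun e => al e ∧ χ (e % k)) wt (υ.setVar .pos x₀) :=
        hd₃.congr (by
          intro x hx
          simp only [Store.setVar_var]
          rw [if_neg (by fin_cases hx <;> simp), hF.var x (by fin_cases hx <;> rfl)])
          (by
            intro a ha
            exact hF.arr a (by fin_cases ha <;> rfl))
      have hhυ : υ.var .h = h := (hF.var .h rfl).trans hh₃
      obtain ⟨τ₅, -, hI₅, hrun₅⟩ := loop_rule (i := .e) (y := .E) (p := extend)
        (σ := υ.setVar .pos x₀) (fun e₀ τ => Holds n X (g x₀ e₀) (p x₀ e₀) τ) hI (by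
          intro e₀ he₀ φ hG hI
          rw [hdυ.E_eq] at he₀
          have hdφ : DetData n k X (fun e => al e ∧ χ (e % k)) wt (φ.setVar .e e₀) :=
            hdυ.congr (by
              intro x hx
              rw [Store.setVar_var, if_neg (by fin_cases hx <;> simp),
                hG.var x (by fin_cases hx <;> rfl)])
              (by
                intro a ha
                exact hG.arr a (by fin_cases ha <;> rfl))
          have hpos : φ.var .pos = x₀ := by rw [hG.var .pos rfl]; simp
          have hhφ : φ.var .h = h := by rw [hG.var .h rfl]; simpa using hhυ
          have key := extend_spec hdφ (g := g x₀ e₀) (p := p x₀ e₀) (e := e₀) (x := x₀) (h := h)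
            hI (by simp) (by simpa using hpos) (by simpa using hhφ) he₀ hx₀ hhn
          have hval : wt e₀ ≤ x₀ →
              g x₀ e₀ (e₀ / k / n) (x₀ - wt e₀) = γ (e₀ / k / n) (x₀ - wt e₀) := by
            intro hle
            have : x₀ - wt e₀ < x₀ := by have := hwt e₀ he₀; omega
            simp [hg, this]
          convert key using 1
          · funext v x
            by_cases hx : x = x₀
            · subst hx
              by_cases hv : v < h
              · simp only [true_and, hv]
                by_cases hc : e₀ / k % n = v ∧ (al e₀ ∧ χ (e₀ % k)) ∧ wt e₀ ≤ x
                · rw [if_pos hc, hval hc.2.2]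
                  simp [hg, hv, Finset.sum_range_succ, hterm, hc]
                · rw [if_neg hc]
                  simp [hg, hv, Finset.sum_range_succ, hterm, hc]
              · simp [hg, hv]
            · simp [hg, hx]
          · funext x
            by_cases hx : x = x₀
            · subst hx
              simp only [true_and]
              by_cases hc : e₀ / k % n = h ∧ (al e₀ ∧ χ (e₀ % k)) ∧ wt e₀ ≤ x
              · rw [if_pos hc, hval hc.2.2]
                simp [hp, Finset.sum_range_succ, hterm, add_assoc, hc]
              · rw [if_neg hc]
                simp [hp, Finset.sum_range_succ, hterm, hc]
            · simp [hp, hx])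
      rw [hrun₅]
      have hE : (υ.setVar .pos x₀).var .E = n * n * k := hdυ.E_eq
      rw [hE, hg_succ, hp_succ] at hI₅
      exact hI₅)
  intro x hx
  rw [hrun₄, Store.setVar_arr, hI₄.2 x hx, hd₃.X_eq]
  simp [hp, hx, hδ']

end Algorithm

/-- The arc opposite to `e`: the same edge in the same color, from its other end. -/
def mirror (n k e : ℕ) : ℕ := arc n k (e / k % n) (e / k / n) (e % k)

/-- The arcs in `al` other than `f` and the arc opposite to `f`. -/
def without (n k : ℕ) (al : ℕ → Prop) (f e : ℕ) : Prop := al e ∧ e ≠ f ∧ mirror n k e ≠ f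

open PowerSeries in
/-- The coefficient of `X ^ x` in the sum of the determinants for all sets of colors. -/
noncomputable def detSum (n k : ℕ) (al : ℕ → Prop) (wt : ℕ → ℕ) (x : ℕ) : ZMod 2 :=
  coeff x (∑ s ∈ Finset.range (2 ^ k), borderDet (arcSeries n k al wt fun c => s / 2 ^ c % 2 = 1) n)

namespace Algorithm

open Stmt Exp

/-- The variables and arrays from which the matrices are computed. -/
structure MatrixData (n k X : ℕ) (al : ℕ → Prop) (wt : ℕ → ℕ) (τ : Store) : Prop where
  E_eq : τ.var .E = n * n * k
  n_eq : τ.var .n = n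
  k_eq : τ.var .k = k
  X_eq : τ.var .X = X
  nX_eq : τ.var .nX = X * n
  S_eq : τ.var .S = 2 ^ k
  tables : Tables n k τ
  off : ∀ v < n, τ.arr .off v = v * X
  pw : ∀ j < k, τ.arr .pw j = 2 ^ j
  al_iff : ∀ e < n * n * k, τ.arr .al e ≠ 0 ↔ al e
  wt_eq : ∀ e < n * n * k, τ.arr .wt e = wt e

/-- The data are preserved by changes of other variables and arrays. -/
theorem MatrixData.congr {n k X : ℕ} {al : ℕ → Prop} {wt : ℕ → ℕ} {τ υ : Store}
    (h : MatrixData n k X al wt τ)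
    (hv : ∀ x ∈ [Var.E, .n, .k, .X, .nX, .S], υ.var x = τ.var x)
    (ha : ∀ a ∈ [Arr.src, .dst, .col, .mir, .off, .pw, .al, .wt], υ.arr a = τ.arr a) :
    MatrixData n k X al wt υ := by
  simp only [List.forall_mem_cons] at hv ha
  obtain ⟨h1, h2, h3, h4, h5, h6, -⟩ := hv
  obtain ⟨a1, a2, a3, a4, a5, a6, a7, a8, -⟩ := ha
  refine ⟨h1 ▸ h.E_eq, h2 ▸ h.n_eq, h3 ▸ h.k_eq, h4 ▸ h.X_eq, h5 ▸ h.nX_eq, h6 ▸ h.S_eq,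
    ⟨?_, ?_, ?_, ?_⟩, ?_, ?_, ?_, ?_⟩
  · rw [a1]; exact h.tables.src
  · rw [a2]; exact h.tables.dst
  · rw [a3]; exact h.tables.col
  · rw [a4]; exact h.tables.mir
  · rw [a5]; exact h.off
  · rw [a6]; exact h.pw
  · rw [a7]; exact h.al_iff
  · rw [a8]; exact h.wt_eq

open PowerSeries in
theorem determinant_spec {n k X : ℕ} {al : ℕ → Prop} {wt : ℕ → ℕ} {τ : Store} {s f : ℕ}
    (hM : MatrixData n k X al wt τ) (hf : τ.var .f = f) (hs : τ.var .s = s) (hsk : s < 2 ^ k)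
    (hwt : ∀ e < n * n * k, 0 < wt e) :
    ∀ x < X, (determinant.run τ).arr .P x = (coeff x (borderDet
      (arcSeries n k (without n k al f) wt fun c => s / 2 ^ c % 2 = 1) n)).val := by
  simp only [determinant, run_block_cons, run_block_nil]
  set τ₁ := digits.run τ with hτ₁
  have hM₁ : MatrixData n k X al wt τ₁ :=
    hM.congr (by intro x hx; rw [hτ₁, run_var]; fin_cases hx <;> rfl)
      (by intro a ha; rw [hτ₁, run_arr]; fin_cases ha <;> rfl)
  have hchi : ∀ c < k, τ₁.arr .chi c = s / 2 ^ c % 2 := by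
    intro c hc
    rw [hτ₁, digits_spec (by rw [hM.k_eq]; exact hM.pw) (by rw [hM.k_eq, hs]; exact hsk) c
      (by rwa [hM.k_eq]), hs]
  have hf₁ : τ₁.var .f = f := by rw [hτ₁, run_var rfl, hf]
  set τ₂ := activate.run τ₁ with hτ₂
  have hM₂ : MatrixData n k X al wt τ₂ :=
    hM₁.congr (by intro x hx; rw [hτ₂, run_var]; fin_cases hx <;> rfl)
      (by intro a ha; rw [hτ₂, run_arr]; fin_cases ha <;> rfl)
  have hon : ∀ e < n * n * k, τ₂.arr .on e ≠ 0 ↔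
      without n k al f e ∧ s / 2 ^ (e % k) % 2 = 1 := by
    intro e he
    have hk : 0 < k := Nat.pos_of_ne_zero (by rintro rfl; simp at he)
    rw [hτ₂, activate_spec _ e (by rwa [hM₁.E_eq]), hM₁.tables.col e he, hM₁.tables.mir e he,
      hchi _ (Nat.mod_lt _ hk), hf₁, hM₁.al_iff e he, Nat.mod_two_ne_zero, without, mirror]
    tauto
  set τ₃ := (loop .pos .X (put .P (get .pos) (not (get .pos)))).run τ₂ with hτ₃
  have hd₃ : DetData n k X (fun e => without n k al f e ∧ s / 2 ^ (e % k) % 2 = 1) wt τ₃ := by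
    have hv : ∀ x ≠ .pos, τ₃.var x = τ₂.var x := fun x hx => by
      rw [hτ₃, run_var]; simpa [writesVar] using hx.symm
    have ha : ∀ a ≠ .P, τ₃.arr a = τ₂.arr a := fun a ha => by
      rw [hτ₃, run_arr]; simpa [writesArr] using ha.symm
    constructor
    · rw [hv _ (by simp)]; exact hM₂.E_eq
    · rw [hv _ (by simp)]; exact hM₂.n_eq
    · rw [hv _ (by simp)]; exact hM₂.X_eq
    · rw [hv _ (by simp)]; exact hM₂.nX_eq
    · rw [ha _ (by simp)]; exact hM₂.tables.src
    · rw [ha _ (by simp)]; exact hM₂.tables.dst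
    · rw [ha _ (by simp)]; exact hM₂.off
    · rw [ha _ (by simp)]; exact hon
    · rw [ha _ (by simp)]; exact hM₂.wt_eq
  have hP₃ : ∀ x < X, τ₃.arr .P x = (coeff x (borderDet
      (arcSeries n k (without n k al f) wt fun c => s / 2 ^ c % 2 = 1) 0)).val := by
    intro x hx
    rw [hτ₃, loop_put fun x => if x = 0 then 1 else 0, if_pos (by rwa [hM₂.X_eq])]
    · have : borderDet (arcSeries n k (without n k al f) wt fun c => s / 2 ^ c % 2 = 1) 0 = 1 := by
        simp [borderDet]
      rw [this, coeff_one]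
      split_ifs <;> rfl
    · intros; simp
  obtain ⟨τ₄, -, hI, hrun⟩ := loop_rule (i := .h) (y := .n) (p := border) (σ := τ₃)
    (fun h υ => ∀ x < X, υ.arr .P x = (coeff x (borderDet
      (arcSeries n k (without n k al f) wt fun c => s / 2 ^ c % 2 = 1) h)).val) hP₃ (by
      intro h hh υ hF hI
      rw [hd₃.n_eq] at hh
      refine border_spec (hd₃.congr (fun x hx => ?_) fun a ha => ?_) (by simp) hh hwt hI
      · rw [Store.setVar_var, if_neg (by fin_cases hx <;> simp),
          hF.var x (by fin_cases hx <;> rfl)]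
      · exact hF.arr a (by fin_cases ha <;> rfl))
  rw [hrun]
  simpa [hd₃.n_eq] using hI

theorem sumDets_spec {n k X : ℕ} {al : ℕ → Prop} {wt : ℕ → ℕ} {τ : Store} {f : ℕ}
    (hM : MatrixData n k X al wt τ) (hf : τ.var .f = f) (hwt : ∀ e < n * n * k, 0 < wt e) :
    ∀ x < X, (sumDets.run τ).arr .acc x = (detSum n k (without n k al f) wt x).val := by
  simp only [sumDets, run_block_cons, run_block_nil]
  set τ₁ := (loop .pos .X (put .acc (get .pos) (lit 0))).run τ with hτ₁
  have hM₁ : MatrixData n k X al wt τ₁ :=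
    hM.congr (by intro x hx; rw [hτ₁, run_var]; fin_cases hx <;> rfl)
      (by intro a ha; rw [hτ₁, run_arr]; fin_cases ha <;> rfl)
  have hf₁ : τ₁.var .f = f := by rw [hτ₁, run_var rfl, hf]
  obtain ⟨τ₂, -, hI, hrun⟩ := loop_rule (i := .s) (y := .S) (p := block [determinant,
    loop .pos .X (put .acc (get .pos) (xor (elem .acc (get .pos)) (elem .P (get .pos))))])
    (σ := τ₁) (fun s υ => ∀ x < X, υ.arr .acc x = (PowerSeries.coeff x (∑ s ∈ Finset.range s,
      borderDet (arcSeries n k (without n k al f) wt fun c => s / 2 ^ c % 2 = 1) n)).val) (by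
      intro x hx
      rw [hτ₁, loop_put fun _ => 0, if_pos (by rwa [hM.X_eq])]
      · simp
      · intros; rfl) (by
      intro s hs υ hF hI x hx
      rw [hM₁.S_eq] at hs
      simp only [run_block_cons, run_block_nil]
      have hMυ : MatrixData n k X al wt (υ.setVar .s s) := by
        refine hM₁.congr (fun x hx => ?_) fun a ha => ?_
        · rw [Store.setVar_var, if_neg (by fin_cases hx <;> simp),
            hF.var x (by fin_cases hx <;> rfl)]
        · exact hF.arr a (by fin_cases ha <;> rfl)
      have hdet := determinant_spec hMυ (f := f) (s := s)
        (by simpa using (hF.var .f rfl).trans hf₁) (by simp) hs hwt x hx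
      set φ := determinant.run (υ.setVar .s s) with hφ
      have hacc : φ.arr .acc = υ.arr .acc := by rw [hφ, run_arr rfl]; rfl
      have hX : φ.var .X = X := by rw [hφ, run_var rfl]; exact hMυ.X_eq
      rw [loop_put fun x => (φ.arr .acc x - φ.arr .P x) + (φ.arr .P x - φ.arr .acc x),
        if_pos (by rwa [hX]), hdet, hacc, hI x hx, Finset.sum_range_succ, map_add, val_add]
      intro j _ ψ _ hb hl
      simp [hb .P (by simp), hl j le_rfl])
  rw [hrun]
  simpa [hM₁.S_eq, detSum] using hI

end Algorithm

/-! ### Selecting arcs and testing the selection -/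

namespace Algorithm

open Stmt Exp

theorem findMin_spec {σ : Store} {W : ℕ} (hW : σ.var .nT ≤ W) (hWX : W < σ.var .X)
    (h0 : σ.arr .acc W ≠ 0) (hlt : ∀ x < W, σ.var .nT ≤ x → σ.arr .acc x = 0) :
    (findMin.run σ).var .W = W := by
  simp only [findMin, run_block_cons, run_set, run_block_nil, eval_lit]
  obtain ⟨τ, -, hI, hrun⟩ := loop_rule (i := .pos) (y := .X)
    (p := when (and (not (get .found)) (and (le (get .nT) (get .pos)) (elem .acc (get .pos))))
      (block [set .W (get .pos), set .found (lit 1)])) (σ := (σ.setVar .W 0).setVar .found 0)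
    (fun x τ => (τ.var .found = if W < x then 1 else 0) ∧ (W < x → τ.var .W = W)) (by simp) (by
      rintro x hx τ hF ⟨h1, h2⟩
      have hacc : τ.arr .acc = σ.arr .acc := hF.arr .acc rfl
      have hnT : τ.var .nT = σ.var .nT := hF.var .nT rfl
      simp only [run_when, eval_and, eval_not, eval_le, eval_elem, eval_get, Store.setVar_var,
        Store.setVar_arr, reduceCtorEq, if_true, if_false, hacc, hnT, h1]
      rcases lt_trichotomy x W with hxW | rfl | hxW
      · have e1 : ¬ W < x := by omega
        have e2 : ¬ W < x + 1 := by omega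
        by_cases hle : σ.var .nT ≤ x
        · simp [e1, e2, hlt x hxW hle, h1]
        · simp [e1, e2, hle, h1]
      · simp [hW, h0]
      · have e2 : W < x + 1 := by omega
        simp [hxW, e2, h1, h2 hxW])
  rw [hrun]
  simpa using hI.2 (by simpa using hWX)

/-- If `W` is the least degree with a nonzero coefficient, then an arc is selected if and only if
the coefficient at `W` vanishes without it. -/
theorem select_spec {n k X : ℕ} {al : ℕ → Prop} {wt : ℕ → ℕ} {τ : Store} {W : ℕ}
    (hM : MatrixData n k X al wt τ) (hwt : ∀ e < n * n * k, 0 < wt e)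
    (hW : τ.var .nT ≤ W) (hWX : W < X)
    (h0 : detSum n k (without n k al (n * n * k)) wt W ≠ 0)
    (hlt : ∀ x < W, τ.var .nT ≤ x → detSum n k (without n k al (n * n * k)) wt x = 0) :
    ∀ f < n * n * k, (select.run τ).arr .sel f ≠ 0 ↔ detSum n k (without n k al f) wt W = 0 := by
  simp only [select, run_block_cons, run_block_nil]
  set τ₁ := (set .f (get .E)).run τ with hτ₁
  have hM₁ : MatrixData n k X al wt τ₁ :=
    hM.congr (by intro x hx; rw [hτ₁, run_var]; fin_cases hx <;> rfl)
      (by intro a ha; rw [hτ₁, run_arr]; fin_cases ha <;> rfl)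
  have hacc := sumDets_spec hM₁ (f := n * n * k) (by simp [hτ₁, hM.E_eq]) hwt
  set τ₂ := sumDets.run τ₁ with hτ₂
  have hM₂ : MatrixData n k X al wt τ₂ :=
    hM₁.congr (by intro x hx; rw [hτ₂, run_var]; fin_cases hx <;> rfl)
      (by intro a ha; rw [hτ₂, run_arr]; fin_cases ha <;> rfl)
  have hnT : τ₂.var .nT = τ.var .nT := by rw [hτ₂, run_var rfl, hτ₁, run_var rfl]
  have hWW : (findMin.run τ₂).var .W = W := by
    refine findMin_spec (by rwa [hnT]) (by rwa [hM₂.X_eq]) ?_ ?_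
    · rw [hacc W hWX]
      simpa [ZMod.val_eq_zero] using h0
    · intro x hx hle
      rw [hacc x (hx.trans hWX), hlt x hx (by rwa [← hnT]), ZMod.val_zero]
  set τ₃ := findMin.run τ₂ with hτ₃
  have hM₃ : MatrixData n k X al wt τ₃ :=
    hM₂.congr (by intro x hx; rw [hτ₃, run_var]; fin_cases hx <;> rfl)
      (by intro a ha; rw [hτ₃, run_arr]; fin_cases ha <;> rfl)
  obtain ⟨τ₄, -, hI, hrun⟩ := loop_rule (i := .f) (y := .E)
    (p := block [sumDets, put .sel (get .f) (not (elem .acc (get .W)))]) (σ := τ₃)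
    (fun f υ => ∀ f' < f, υ.arr .sel f' ≠ 0 ↔ detSum n k (without n k al f') wt W = 0)
    (by simp) (by
      intro f hf υ hF hI
      simp only [run_block_cons, run_block_nil]
      have hMυ : MatrixData n k X al wt (υ.setVar .f f) := by
        refine hM₃.congr (fun x hx => ?_) fun a ha => ?_
        · rw [Store.setVar_var, if_neg (by fin_cases hx <;> simp),
            hF.var x (by fin_cases hx <;> rfl)]
        · exact hF.arr a (by fin_cases ha <;> rfl)
      have hacc := sumDets_spec hMυ (f := f) (by simp) hwt W hWX
      set φ := sumDets.run (υ.setVar .f f) with hφ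
      have h1 : φ.var .f = f := by rw [hφ, run_var rfl]; simp
      have h2 : φ.var .W = W := by
        rw [hφ, run_var rfl, Store.setVar_var, if_neg (by simp), hF.var .W rfl, hWW]
      have h3 : φ.arr .sel = υ.arr .sel := by rw [hφ, run_arr rfl]; rfl
      intro f' hf'
      by_cases hff : f' = f
      · subst hff
        simp only [run_put, eval_get, eval_not, eval_elem, h1, h2, hacc, Store.setArr_arr, true_and,
          if_true, ZMod.val_eq_zero]
        split_ifs <;> simp [*]
      · simpa [h1, hff, h3] using hI f' (by omega))
  intro f hf
  rw [hrun]
  exact hI f (by rwa [hM₃.E_eq])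

/-- The selected arcs are the arcs of a solution: both directions of each edge are selected, one arc
leaves each vertex, every color occurs, and the weight, which counts each edge twice, is at most
`2 * L`. -/
structure Valid (n k L : ℕ) (al : ℕ → Prop) (wa : ℕ → ℕ) (sel : Finset ℕ) : Prop where
  al : ∀ e ∈ sel, al e
  mirror : ∀ e ∈ sel, mirror n k e ∈ sel
  degree : ∀ u < n, (sel.filter fun e => e / k / n = u).card = 1
  surjective : ∀ c < k, ∃ e ∈ sel, e % k = c
  weight : ∑ e ∈ sel, wa e ≤ L + L

/-- The selected arcs. -/
def selected (σ : Store) (E : ℕ) : Finset ℕ := (Finset.range E).filter fun e => σ.arr .sel e ≠ 0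

theorem selected_succ (σ : Store) (e : ℕ) : selected σ (e + 1) =
    if σ.arr .sel e ≠ 0 then insert e (selected σ e) else selected σ e := by
  rw [selected, Finset.range_add_one, Finset.filter_insert, selected]

theorem mem_selected {σ : Store} {E e : ℕ} : e ∈ selected σ E ↔ e < E ∧ σ.arr .sel e ≠ 0 := by
  simp [selected]

open Classical in
/-- The test accepts if and only if the selection is valid, and then writes the partners and the
colors of all vertices. -/
theorem verify_spec {n k : ℕ} {σ : Store} (hE : σ.var .E = n * n * k) (hn : σ.var .n = n)
    (hk : σ.var .k = k) (ht : Tables n k σ) (hdeg : ∀ u < n, σ.arr .deg u = 0)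
    (hmark : ∀ c < k, σ.arr .mark c = 0) :
    ((verify.run σ).var .n = if Valid n k (σ.var .L) (fun e => σ.arr .al e ≠ 0) (σ.arr .wa)
        (selected σ (n * n * k)) then 1 else 0) ∧
      (Valid n k (σ.var .L) (fun e => σ.arr .al e ≠ 0) (σ.arr .wa) (selected σ (n * n * k)) →
        ∀ e ∈ selected σ (n * n * k), (verify.run σ).arr .fst (e / k / n) = e / k % n ∧
          (verify.run σ).arr .snd (e / k / n) = e % k) := by
  simp only [verify, run_block_cons, run_set, run_block_nil, eval_lit]
  set σ₁ := (σ.setVar .ok 1).setVar .sum 0 with hσ₁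
  set S := selected σ with hS
  set uniq : Prop := ∀ e₁ ∈ S (n * n * k), ∀ e₂ ∈ S (n * n * k), e₁ / k / n = e₂ / k / n → e₁ = e₂
    with huniq
  set A : ℕ → Prop := fun e => σ.arr .al e ≠ 0 ∧ σ.arr .sel (mirror n k e) ≠ 0 with hA
  obtain ⟨τ, hF, ⟨i1, i2, i3, i4, i5⟩, hrun⟩ := loop_rule (i := .e) (y := .E) (p := verifyArc)
    (σ := σ₁) (fun e τ => (τ.var .ok = if ∀ e' ∈ S e, A e' then 1 else 0) ∧
      (∀ u < n, τ.arr .deg u = ((S e).filter fun e => e / k / n = u).card) ∧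
      (∀ c < k, τ.arr .mark c ≠ 0 ↔ ∃ e' ∈ S e, e' % k = c) ∧
      (τ.var .sum = ∑ e' ∈ S e, σ.arr .wa e') ∧
      (uniq → ∀ e' ∈ S e, τ.arr .fst (e' / k / n) = e' / k % n ∧
        τ.arr .snd (e' / k / n) = e' % k))
    (by
      have : S 0 = ∅ := rfl
      rw [this]
      exact ⟨by simp [hσ₁], by simpa [hσ₁] using hdeg, by simpa [hσ₁] using hmark, by simp [hσ₁],
        by simp⟩) (by
      rintro e he τ hF ⟨i1, i2, i3, i4, i5⟩
      replace he : e < n * n * k := by simpa [hσ₁, hE] using he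
      have hsel : τ.arr .sel = σ.arr .sel := hF.arr .sel rfl
      have hsrc : τ.arr .src e = e / k / n := by rw [hF.arr .src rfl]; exact ht.src e he
      have hdst : τ.arr .dst e = e / k % n := by rw [hF.arr .dst rfl]; exact ht.dst e he
      have hcol : τ.arr .col e = e % k := by rw [hF.arr .col rfl]; exact ht.col e he
      have hmir : τ.arr .mir e = mirror n k e := by rw [hF.arr .mir rfl]; exact ht.mir e he
      have hal : τ.arr .al = σ.arr .al := hF.arr .al rfl
      have hwa : τ.arr .wa = σ.arr .wa := hF.arr .wa rfl
      have hnot : e ∉ S e := by simp [hS, selected]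
      rw [verifyArc, run_when]
      by_cases hse : σ.arr .sel e = 0
      · have hSe : S (e + 1) = S e := by simp [hS, selected_succ, hse]
        rw [hSe]
        simpa [hse, hsel] using And.intro i1 ⟨i2, i3, i4, i5⟩
      · have hSe : S (e + 1) = insert e (S e) := by simp [hS, selected_succ, hse]
        rw [if_pos (by simpa [hsel] using hse), hSe]
        simp only [run_block_cons, run_put, run_set, run_block_nil, run_when, eval_get, eval_elem,
          eval_add, eval_lit, eval_not, eval_and, Store.setVar_var, Store.setVar_arr,
          Store.setArr_var, Store.setArr_arr, reduceCtorEq, false_and, if_false, if_true, hsrc,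
          hdst, hcol, hmir, hal, hsel, hwa]
        have hok : (if (if σ.arr .al e ≠ 0 ∧ σ.arr .sel (mirror n k e) ≠ 0 then 1 else 0) = 0
            then 1 else 0) ≠ 0 ↔ ¬ A e := by
          simp only [hA]
          split_ifs <;> simp_all
        refine ⟨?_, fun u hu => ?_, fun c hc => ?_, ?_, fun hu e' he' => ?_⟩
        · simp only [hok]
          by_cases hAe : A e
          · simp [hAe, i1]
          · simp [hAe]
        · rw [Finset.filter_insert]
          by_cases heu : e / k / n = u
          · rw [if_pos heu, Finset.card_insert_of_notMem (by simp [hnot]), ← i2 u hu]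
            split_ifs <;> simp [heu]
          · rw [if_neg heu, ← i2 u hu]
            have : u ≠ e / k / n := fun h => heu h.symm
            split_ifs <;> simp [this]
        · have := i3 c hc
          by_cases hec : e % k = c
          · simp only [Finset.mem_insert, exists_eq_or_imp, hec, true_or, iff_true]
            split_ifs <;> simp
          · have h' : c ≠ e % k := fun h => hec h.symm
            simp only [Finset.mem_insert, exists_eq_or_imp, hec, false_or, ← this]
            split_ifs <;> simp [h']
        · rw [Finset.sum_insert hnot, ← i4]
          split_ifs <;> simp [Nat.add_comm]
        · rcases Finset.mem_insert.1 he' with rfl | he''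
          · split_ifs <;> simp
          · have hne : e' / k / n ≠ e / k / n := fun h => by
              have h1 := mem_selected.1 he''
              have := hu e' (mem_selected.2 ⟨h1.1.trans he, h1.2⟩) e
                (mem_selected.2 ⟨he, hse⟩) h
              omega
            have := i5 hu e' he''
            split_ifs <;> simp [hne, this])
  have hE₁ : σ₁.var .E = n * n * k := by simp [hσ₁, hE]
  rw [hE₁] at i1 i2 i3 i4 i5
  rw [hrun, hE₁]
  set τ₁ := τ.setVar .e (n * n * k) with hτ₁
  obtain ⟨τ₂, hF₂, j1, hrun₂⟩ := loop_rule (i := .u) (y := .n)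
    (p := when (not (eq (elem .deg (get .u)) (lit 1))) (set .ok (lit 0))) (σ := τ₁)
    (fun u υ => υ.var .ok = if (∀ e' ∈ S (n * n * k), A e') ∧
      ∀ u' < u, ((S (n * n * k)).filter fun e => e / k / n = u').card = 1 then 1 else 0)
    (by simpa [hτ₁] using i1) (by
      intro u hu υ hG hI
      replace hu : u < n := by
        have : τ₁.var .n = n := (hF.var .n rfl).trans hn
        rwa [this] at hu
      have hd : υ.arr .deg = τ.arr .deg := hG.arr .deg rfl
      simp only [run_when, eval_not, eval_eq, eval_elem, eval_get, eval_lit, Store.setVar_var,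
        Store.setVar_arr, if_true, hd, i2 u hu, Nat.forall_lt_succ_right, ← and_assoc]
      by_cases h1 : ((S (n * n * k)).filter fun e => e / k / n = u).card = 1
      · simp [h1, hI]
      · simp [h1])
  have hn₁ : τ₁.var .n = n := (hF.var .n rfl).trans hn
  rw [hn₁] at j1 hrun₂
  rw [hrun₂]
  set τ₃ := τ₂.setVar .u n with hτ₃
  obtain ⟨τ₄, hF₄, j2, hrun₄⟩ := loop_rule (i := .c) (y := .k)
    (p := when (not (elem .mark (get .c))) (set .ok (lit 0))) (σ := τ₃)
    (fun c υ => υ.var .ok = if ((∀ e' ∈ S (n * n * k), A e') ∧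
      ∀ u' < n, ((S (n * n * k)).filter fun e => e / k / n = u').card = 1) ∧
      ∀ c' < c, ∃ e ∈ S (n * n * k), e % k = c' then 1 else 0)
    (by simpa [hτ₃] using j1) (by
      intro c hc υ hG hI
      have hm : υ.arr .mark = τ.arr .mark := (hG.arr .mark rfl).trans (hF₂.arr .mark rfl)
      replace hc : c < k := by
        have : τ₃.var .k = k := (hF₂.var .k rfl).trans ((hF.var .k rfl).trans hk)
        rwa [this] at hc
      have h3 := i3 c hc
      simp only [run_when, eval_not, eval_elem, eval_get, Store.setVar_var,
        Store.setVar_arr, if_true, hm, Nat.forall_lt_succ_right, ← and_assoc, ← h3]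
      by_cases h1 : τ.arr .mark c = 0
      · simp [h1]
      · simp [h1, hI])
  have hk₃ : τ₃.var .k = k := (hF₂.var .k rfl).trans ((hF.var .k rfl).trans hk)
  rw [hk₃] at j2 hrun₄
  rw [hrun₄]
  have hsum : τ₄.var .sum = ∑ e ∈ S (n * n * k), σ.arr .wa e :=
    (hF₄.var .sum rfl).trans ((hF₂.var .sum rfl).trans i4)
  have hL : τ₄.var .L = σ.var .L :=
    (hF₄.var .L rfl).trans ((hF₂.var .L rfl).trans (hF.var .L rfl))
  have hfst : τ₄.arr .fst = τ.arr .fst := (hF₄.arr .fst rfl).trans (hF₂.arr .fst rfl)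
  have hsnd : τ₄.arr .snd = τ.arr .snd := (hF₄.arr .snd rfl).trans (hF₂.arr .snd rfl)
  have hV : Valid n k (σ.var .L) (fun e => σ.arr .al e ≠ 0) (σ.arr .wa) (S (n * n * k)) ↔
      (((∀ e' ∈ S (n * n * k), A e') ∧
      ∀ u' < n, ((S (n * n * k)).filter fun e => e / k / n = u').card = 1) ∧
      ∀ c' < k, ∃ e ∈ S (n * n * k), e % k = c') ∧
      ∑ e ∈ S (n * n * k), σ.arr .wa e ≤ σ.var .L + σ.var .L := by
    have hmir : ∀ e ∈ S (n * n * k), mirror n k e ∈ S (n * n * k) ↔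
        σ.arr .sel (mirror n k e) ≠ 0 := by
      intro e he
      have h0 : 0 < n * n * k := by have := (mem_selected.1 he).1; omega
      have hk0 : 0 < k := Nat.pos_of_mul_pos_left h0
      have hn0 : 0 < n := Nat.pos_of_mul_pos_left (Nat.pos_of_mul_pos_right h0)
      rw [hS, mem_selected, and_iff_right]
      refine arc_lt (Nat.mod_lt _ hn0) ?_ (Nat.mod_lt _ hk0)
      rw [Nat.div_div_eq_div_mul]
      exact Nat.div_lt_of_lt_mul ((mem_selected.1 he).1.trans_le (by ring_nf; rfl))
    constructor
    · intro h
      exact ⟨⟨⟨fun e he => ⟨h.al e he, (hmir e he).1 (h.mirror e he)⟩, h.degree⟩, h.surjective⟩,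
        h.weight⟩
    · rintro ⟨⟨⟨h1, h2⟩, h3⟩, h4⟩
      exact ⟨fun e he => (h1 e he).1, fun e he => (hmir e he).2 (h1 e he).2, h2, h3, h4⟩
  refine ⟨?_, fun h e he => ?_⟩
  · rw [if_congr hV rfl rfl]
    simp only [run_when, eval_not, eval_le, eval_get, eval_add, Store.setVar_var, reduceCtorEq,
      if_false, hsum, hL]
    by_cases h4 : ∑ e ∈ S (n * n * k), σ.arr .wa e ≤ σ.var .L + σ.var .L
    · simp [h4, j2]
    · simp [h4]
  · have hu : uniq := by
      intro e₁ h₁ e₂ h₂ h12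
      have hlt : e₁ / k / n < n := by
        rw [Nat.div_div_eq_div_mul]
        exact Nat.div_lt_of_lt_mul ((mem_selected.1 h₁).1.trans_le (by ring_nf; rfl))
      exact Finset.card_le_one.1 (h.degree _ hlt).le e₁ (by simp [h₁]) e₂ (by simp [h₂, h12])
    have := i5 hu e he
    simp only [run_when, eval_not, eval_le, eval_get, eval_add, Store.setVar_var, reduceCtorEq,
      if_false]
    split_ifs <;> simpa [hfst, hsnd] using this

end Algorithm

/-! ### Selected arcs, involutions, and perfect matchings -/

theorem arc_eq_arc {n k u v c u' v' c' : ℕ} (hv : v < n) (hc : c < k) (hv' : v' < n) (hc' : c' < k)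
    (h : arc n k u v c = arc n k u' v' c') : u = u' ∧ v = v' ∧ c = c' :=
  ⟨by rw [← arc_src (u := u) hv hc, h, arc_src hv' hc'],
    by rw [← arc_dst (u := u) hv hc, h, arc_dst hv' hc'], by rw [← arc_col hc, h, arc_col hc']⟩

theorem mirror_arc {n k u v c : ℕ} (hv : v < n) (hc : c < k) :
    mirror n k (arc n k u v c) = arc n k v u c := by
  rw [mirror, arc_src hv hc, arc_dst hv hc, arc_col hc]

theorem arc_ends (n k e : ℕ) : arc n k (e / k / n) (e / k % n) (e % k) = e := by
  rw [arc, Nat.div_add_mod', Nat.div_add_mod']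

theorem src_lt {n k e : ℕ} (he : e < n * n * k) : e / k / n < n := by
  rw [Nat.div_div_eq_div_mul]
  exact Nat.div_lt_of_lt_mul (he.trans_le (by ring_nf; rfl))

theorem pos_of_lt_mul {n k e : ℕ} (he : e < n * n * k) : 0 < n ∧ 0 < k := by
  constructor <;> refine Nat.pos_of_ne_zero ?_ <;> rintro rfl <;> simp at he

theorem mirror_lt {n k e : ℕ} (he : e < n * n * k) : mirror n k e < n * n * k :=
  arc_lt (Nat.mod_lt _ (pos_of_lt_mul he).1) (src_lt he) (Nat.mod_lt _ (pos_of_lt_mul he).2)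

/-- The arcs of a solution, one for each vertex. -/
def arcs {n k : ℕ} (p : Equiv.Perm (Fin n) × (Fin n → Fin k)) : Finset ℕ :=
  Finset.univ.image fun u : Fin n => arc n k u (p.1 u) (p.2 u)

theorem mem_arcs {n k : ℕ} {p : Equiv.Perm (Fin n) × (Fin n → Fin k)} {e : ℕ} :
    e ∈ arcs p ↔ ∃ u : Fin n, arc n k u (p.1 u) (p.2 u) = e := by
  simp [arcs]

theorem arc_mem_arcs {n k : ℕ} {p : Equiv.Perm (Fin n) × (Fin n → Fin k)} {u v : Fin n}
    {c : Fin k} : arc n k u v c ∈ arcs p ↔ p.1 u = v ∧ p.2 u = c := by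
  rw [mem_arcs]
  constructor
  · rintro ⟨u', h⟩
    obtain ⟨h1, h2, h3⟩ := arc_eq_arc (p.1 u').2 (p.2 u').2 v.2 c.2 h
    obtain rfl := Fin.ext h1
    exact ⟨Fin.ext h2, Fin.ext h3⟩
  · rintro ⟨rfl, rfl⟩
    exact ⟨u, rfl⟩

theorem arcs_injective {n k : ℕ} :
    Function.Injective (arcs : Equiv.Perm (Fin n) × (Fin n → Fin k) → Finset ℕ) := by
  intro p q h
  have : ∀ u, q.1 u = p.1 u ∧ q.2 u = p.2 u := fun u =>
    arc_mem_arcs.1 (h ▸ arc_mem_arcs.2 ⟨rfl, rfl⟩)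
  exact Prod.ext (Equiv.ext fun u => (this u).1.symm) (funext fun u => (this u).2.symm)

theorem sum_arcs {n k : ℕ} (wt : ℕ → ℕ) (p : Equiv.Perm (Fin n) × (Fin n → Fin k)) :
    ∑ e ∈ arcs p, wt e = arcSum wt p := by
  rw [arcs, Finset.sum_image, arcSum]
  intro u _ u' _ h
  exact Fin.ext (arc_eq_arc (p.1 u).2 (p.2 u).2 (p.1 u').2 (p.2 u').2 h).1

theorem arcs_lt {n k : ℕ} {p : Equiv.Perm (Fin n) × (Fin n → Fin k)} {e : ℕ} (he : e ∈ arcs p) :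
    e < n * n * k := by
  obtain ⟨u, rfl⟩ := mem_arcs.1 he
  exact arc_lt u.2 (p.1 u).2 (p.2 u).2

theorem mirror_mem_arcs {n k : ℕ} {al : ℕ → Prop} {p : Equiv.Perm (Fin n) × (Fin n → Fin k)}
    (hp : p ∈ rainbow n k al) {e : ℕ} (he : e ∈ arcs p) : mirror n k e ∈ arcs p := by
  obtain ⟨h1, h2, -, -⟩ := mem_rainbow.1 hp
  obtain ⟨u, rfl⟩ := mem_arcs.1 he
  rw [mirror_arc (p.1 u).2 (p.2 u).2, arc_mem_arcs]
  exact ⟨h1 u, h2 u⟩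

open Algorithm in
theorem valid_arcs {n k L : ℕ} {al : ℕ → Prop} {wa : ℕ → ℕ}
    {p : Equiv.Perm (Fin n) × (Fin n → Fin k)} (hp : p ∈ rainbow n k al)
    (hL : arcSum wa p ≤ L + L) : Valid n k L al wa (arcs p) := by
  obtain ⟨h1, h2, h3, h4⟩ := mem_rainbow.1 hp
  refine ⟨fun e he => ?_, fun e he => mirror_mem_arcs hp he, fun u hu => ?_, fun c hc => ?_, ?_⟩
  · obtain ⟨u, rfl⟩ := mem_arcs.1 he
    exact h4 u
  · rw [Finset.card_eq_one]
    refine ⟨arc n k u (p.1 ⟨u, hu⟩) (p.2 ⟨u, hu⟩), ?_⟩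
    ext e
    rw [Finset.mem_filter, Finset.mem_singleton, mem_arcs]
    constructor
    · rintro ⟨⟨v, rfl⟩, hv⟩
      rw [arc_src (p.1 v).2 (p.2 v).2] at hv
      subst hv
      rfl
    · rintro rfl
      exact ⟨⟨⟨u, hu⟩, rfl⟩, arc_src (p.1 ⟨u, hu⟩).2 (p.2 ⟨u, hu⟩).2⟩
  · obtain ⟨u, hu⟩ := h3 ⟨c, hc⟩
    exact ⟨_, mem_arcs.2 ⟨u, rfl⟩, by rw [arc_col (p.2 u).2, hu]⟩
  · rwa [sum_arcs]

open Algorithm in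
/-- A valid selection consists of the arcs of an element of `rainbow`, whose involution maps each
vertex to the end of its only selected arc. -/
theorem exists_rainbow_of_valid {n k L : ℕ} {al : ℕ → Prop} {wa : ℕ → ℕ} {S : Finset ℕ}
    (hS : ∀ e ∈ S, e < n * n * k) (h : Valid n k L al wa S) :
    ∃ p ∈ rainbow n k al, arcs p = S := by
  have hex : ∀ u : Fin n, ∃ e, (S.filter fun e => e / k / n = u) = {e} := fun u =>
    Finset.card_eq_one.1 (h.degree u u.2)
  choose a ha using hex
  have hmem : ∀ u, a u ∈ S ∧ a u / k / n = u := fun u => by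
    have : a u ∈ S.filter fun e => e / k / n = u := by rw [ha]; simp
    simpa using this
  have huniq : ∀ u : Fin n, ∀ e ∈ S, e / k / n = u → e = a u := fun u e he hu => by
    have : e ∈ S.filter fun e => e / k / n = u := by simp [he, hu]
    simpa [ha] using this
  have hlt := fun u => hS _ (hmem u).1
  let σ : Fin n → Fin n := fun u => ⟨a u / k % n, Nat.mod_lt _ (pos_of_lt_mul (hlt u)).1⟩
  let ξ : Fin n → Fin k := fun u => ⟨a u % k, Nat.mod_lt _ (pos_of_lt_mul (hlt u)).2⟩
  have hau : ∀ u : Fin n, arc n k u (σ u) (ξ u) = a u := fun u => by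
    conv_rhs => rw [← arc_ends n k (a u), (hmem u).2]
  have hmir : ∀ u : Fin n, arc n k (σ u) u (ξ u) = a (σ u) := fun u => by
    rw [← mirror_arc (σ u).2 (ξ u).2, hau]
    refine huniq _ _ (h.mirror _ (hmem u).1) ?_
    rw [← hau, mirror_arc (σ u).2 (ξ u).2, arc_src u.2 (ξ u).2]
  have hσξ : ∀ u, σ (σ u) = u ∧ ξ (σ u) = ξ u := fun u => by
    have := hmir u
    rw [← hau (σ u)] at this
    obtain ⟨-, h1, h2⟩ := arc_eq_arc u.2 (ξ u).2 (σ (σ u)).2 (ξ (σ u)).2 this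
    exact ⟨Fin.ext h1.symm, Fin.ext h2.symm⟩
  have hinv : Function.Involutive σ := fun u => (hσξ u).1
  refine ⟨(hinv.toPerm, ξ), mem_rainbow.2 ⟨fun u => (hσξ u).1, fun u => (hσξ u).2, fun c => ?_,
    fun u => ?_⟩, ?_⟩
  · obtain ⟨e, he, hec⟩ := h.surjective c c.2
    refine ⟨⟨e / k / n, src_lt (hS e he)⟩, Fin.ext ?_⟩
    show a _ % k = c
    rw [← huniq _ e he rfl, hec]
  · show al (arc n k u (σ u) (ξ u))
    rw [hau]
    exact h.al _ (hmem u).1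
  · ext e
    rw [mem_arcs]
    constructor
    · rintro ⟨u, rfl⟩
      show arc n k u (σ u) (ξ u) ∈ S
      rw [hau]
      exact (hmem u).1
    · intro he
      refine ⟨⟨e / k / n, src_lt (hS e he)⟩, ?_⟩
      show arc n k _ (σ _) (ξ _) = e
      rw [hau]
      exact (huniq _ e he rfl).symm

section Encodes

/-- The pair of an involution and a coloring of the vertices encodes the matching `R`. -/
structure Encodes {I : Instance} (R : PerfectMatching I)
    (p : Equiv.Perm (Fin I.n) × (Fin I.n → Fin I.k)) : Prop where
  adj_iff : ∀ v w, R.M.Adj v w ↔ p.1 v = w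
  color_eq : ∀ v w (h : R.M.Adj v w), (R.color ⟨s(v, w), h⟩ : Fin I.k) = p.2 v

variable {I : Instance}

theorem entry_eq_some {u v : Fin I.n} {c : Fin I.k} (ha : s(u, v) ∈ I.G.edgeSet)
    (hc : c ∈ I.colors ⟨_, ha⟩) : I.entry u v c = some (I.weight ⟨_, ha⟩ ⟨_, hc⟩) := by
  rw [Instance.entry, dif_pos ⟨u.2, v.2, c.2⟩, dif_pos ha, dif_pos hc]

theorem of_entry_ne_none {u v : Fin I.n} {c : Fin I.k} (h : I.entry u v c ≠ none) :
    ∃ ha : s(u, v) ∈ I.G.edgeSet, c ∈ I.colors ⟨_, ha⟩ := by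
  rw [Instance.entry, dif_pos ⟨u.2, v.2, c.2⟩] at h
  split_ifs at h with ha hc
  · exact ⟨ha, hc⟩
  all_goals exact absurd rfl h

namespace Encodes

variable {R : PerfectMatching I} {p : Equiv.Perm (Fin I.n) × (Fin I.n → Fin I.k)}

theorem adj (h : Encodes R p) (u : Fin I.n) : R.M.Adj u (p.1 u) := (h.adj_iff _ _).2 rfl

theorem involutive (h : Encodes R p) (u : Fin I.n) : p.1 (p.1 u) = u :=
  (h.adj_iff _ _).1 (h.adj u).symm

theorem color_apply (h : Encodes R p) (u : Fin I.n) : p.2 (p.1 u) = p.2 u := by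
  rw [← h.color_eq u _ (h.adj u), ← h.color_eq _ u (h.adj u).symm]
  have : ∀ e e' : R.M.edgeSet, e = e' → (R.color e : Fin I.k) = R.color e' := by
    rintro e _ rfl; rfl
  exact this _ _ (Subtype.ext Sym2.eq_swap)

theorem surjective (h : Encodes R p) : Function.Surjective p.2 := by
  intro c
  obtain ⟨⟨e, he⟩, rfl⟩ := R.surjective c
  induction e with
  | _ v w => exact ⟨v, (h.color_eq v w he).symm⟩

theorem ne (h : Encodes R p) (u : Fin I.n) : p.1 u ≠ u := fun hu => by
  have := h.adj u
  rw [hu] at this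
  exact R.M.loopless.irrefl _ this

/-- The edge at the vertex `u`. -/
def edge (h : Encodes R p) (u : Fin I.n) : R.M.edgeSet := ⟨s(u, p.1 u), h.adj u⟩

theorem entry_eq (h : Encodes R p) (u : Fin I.n) : I.entry u (p.1 u) (p.2 u) =
    some (I.weight ⟨(h.edge u).1, R.M.edgeSet_subset (h.edge u).2⟩ (R.color (h.edge u))) := by
  have hc : R.color (h.edge u) = p.2 u := h.color_eq u _ (h.adj u)
  have hmem : p.2 u ∈ I.colors ⟨(h.edge u).1, R.M.edgeSet_subset (h.edge u).2⟩ :=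
    hc ▸ (R.color (h.edge u)).2
  refine (entry_eq_some (R.M.edgeSet_subset (h.edge u).2) hmem).trans ?_
  congr 2
  exact Subtype.ext hc.symm

/-- The weights at the vertices add up to twice the weight of the matching, as each edge has two
ends. -/
theorem sum_entry (h : Encodes R p) :
    ∑ u : Fin I.n, (I.entry u (p.1 u) (p.2 u)).getD 0 = 2 * R.totalWeight := by
  classical
  rw [PerfectMatching.totalWeight, Finset.mul_sum, ← Finset.sum_fiberwise (g := h.edge)]
  refine Finset.sum_congr (by congr!) fun e _ => ?_
  have h1 : ∀ u ∈ Finset.univ.filter fun u => h.edge u = e,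
      (I.entry u (p.1 u) (p.2 u)).getD 0 =
        I.weight ⟨e.1, R.M.edgeSet_subset e.2⟩ (R.color e) := by
    intro u hu
    obtain rfl := (Finset.mem_filter.1 hu).2
    rw [h.entry_eq, Option.getD_some]
  rw [Finset.sum_congr rfl h1, Finset.sum_const, nsmul_eq_mul]
  congr 1
  obtain ⟨e, he⟩ := e
  induction e with
  | _ v w =>
    have hvw : p.1 v = w := (h.adj_iff v w).1 he
    have : (Finset.univ.filter fun u => h.edge u = ⟨s(v, w), he⟩) = {v, w} := by
      ext u
      rw [Finset.mem_filter, and_iff_right (Finset.mem_univ u), Finset.mem_insert,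
        Finset.mem_singleton, Subtype.ext_iff]
      change s(u, p.1 u) = s(v, w) ↔ _
      rw [Sym2.eq_iff]
      constructor
      · rintro (h | h)
        exacts [.inl h.1, .inr h.1]
      · rintro (rfl | rfl)
        · exact .inl ⟨rfl, hvw⟩
        · exact .inr ⟨rfl, by rw [← hvw, h.involutive]⟩
    rw [this, Finset.card_pair (by rw [← hvw]; exact (h.ne v).symm)]
    rfl

end Encodes

theorem exists_encodes (R : PerfectMatching I) : ∃ p, Encodes R p := by
  have hex : ∀ v, ∃! w, R.M.Adj v w := fun v => R.isPerfect.1 (R.isPerfect.2 v)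
  choose σ hσ huniq using hex
  have hinv : Function.Involutive σ := fun v => (huniq _ _ (hσ v).symm).symm
  refine ⟨(hinv.toPerm, fun v => R.color ⟨s(v, σ v), hσ v⟩), fun v w => ⟨fun h => ?_, ?_⟩, ?_⟩
  · exact (huniq v w h).symm
  · rintro rfl
    exact hσ v
  · intro v w h
    obtain rfl := huniq v w h
    rfl

theorem exists_encodes_of_entry (p : Equiv.Perm (Fin I.n) × (Fin I.n → Fin I.k))
    (h1 : ∀ u, p.1 (p.1 u) = u) (h2 : ∀ u, p.2 (p.1 u) = p.2 u) (h3 : Function.Surjective p.2)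
    (h4 : ∀ u : Fin I.n, I.entry u (p.1 u) (p.2 u) ≠ none) : ∃ R, Encodes R p := by
  have hadj : ∀ u, I.G.Adj u (p.1 u) := fun u => (of_entry_ne_none (h4 u)).choose
  let M : I.G.Subgraph :=
    { verts := Set.univ
      Adj := fun v w => p.1 v = w
      adj_sub := by rintro v w rfl; exact hadj v
      edge_vert := fun _ => trivial
      symm := ⟨by rintro v w rfl; exact h1 v⟩ }
  have hM : M.IsPerfectMatching := by
    refine ⟨fun v _ => ⟨p.1 v, rfl, fun w hw => ?_⟩, fun v => trivial⟩
    exact Eq.symm hw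
  have hex : ∀ e : M.edgeSet, ∃ c : I.colors ⟨e, M.edgeSet_subset e.2⟩,
      ∀ v w, e.1 = s(v, w) → (c : Fin I.k) = p.2 v := by
    rintro ⟨e, he⟩
    induction e with
    | _ v w =>
      have hvw : p.1 v = w := he
      obtain ⟨ha, hc⟩ := of_entry_ne_none (h4 v)
      have heq : (⟨s(v, p.1 v), ha⟩ : I.G.edgeSet) = ⟨s(v, w), M.edgeSet_subset he⟩ :=
        Subtype.ext (congrArg (fun x => s(v, x)) hvw)
      refine ⟨⟨p.2 v, heq ▸ hc⟩, fun v' w' h => ?_⟩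
      rcases Sym2.eq_iff.1 h with ⟨rfl, -⟩ | ⟨-, h⟩
      · rfl
      · exact (h2 v).symm.trans (congrArg p.2 (hvw.trans h))
  choose col hcol using hex
  refine ⟨⟨M, hM, col, fun c => ?_⟩, fun v w => Iff.rfl, fun v w h => hcol _ v w rfl⟩
  obtain ⟨u, rfl⟩ := h3 c
  exact ⟨⟨s(u, p.1 u), (rfl : p.1 u = p.1 u)⟩, hcol _ u (p.1 u) rfl⟩

end Encodes

/-! ### Recovering a unique lightest solution from the determinants -/

/-- Allowed arcs and exponents of the matrix: both are symmetric, and the exponents are in the range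
that separates perfect matchings from all others in the sum of the determinants. -/
structure Admissible (n k H : ℕ) (al : ℕ → Prop) (wt : ℕ → ℕ) : Prop where
  pos : 0 < H
  al_mirror : ∀ e < n * n * k, al e → al (mirror n k e)
  wt_mirror : ∀ e < n * n * k, wt (mirror n k e) = wt e
  le_wt : ∀ e < n * n * k, n * H ≤ wt e
  wt_le : ∀ e < n * n * k, al e → wt e ≤ n * H + H

theorem mem_rainbow_without {n k : ℕ} {al : ℕ → Prop} {f : ℕ}
    {p : Equiv.Perm (Fin n) × (Fin n → Fin k)} :
    p ∈ rainbow n k (without n k al f) ↔ p ∈ rainbow n k al ∧ f ∉ arcs p := by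
  constructor
  · intro h
    obtain ⟨h1, h2, h3, h4⟩ := mem_rainbow.1 h
    refine ⟨mem_rainbow.2 ⟨h1, h2, h3, fun u => (h4 u).1⟩, fun hf => ?_⟩
    obtain ⟨u, hu⟩ := mem_arcs.1 hf
    exact (h4 u).2.1 hu
  · rintro ⟨h, hf⟩
    obtain ⟨h1, h2, h3, h4⟩ := mem_rainbow.1 h
    refine mem_rainbow.2 ⟨h1, h2, h3, fun u => ⟨h4 u, fun hu => hf (mem_arcs.2 ⟨u, hu⟩),
      fun hu => hf (hu ▸ mirror_mem_arcs h (mem_arcs.2 ⟨u, rfl⟩))⟩⟩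

/-- The sum of the determinants without the arc `f` counts the solutions that avoid `f`. -/
theorem Admissible.detSum_eq {n k H : ℕ} {al : ℕ → Prop} {wt : ℕ → ℕ}
    (h : Admissible n k H al wt) (f x : ℕ) (hx : n * (n * H) ≤ x) :
    detSum n k (without n k al f) wt x =
      (((rainbow n k al).filter fun p => f ∉ arcs p ∧ arcSum wt p = x).card : ZMod 2) := by
  have hlt : ∀ u v : Fin n, ∀ c : Fin k, arc n k u v c < n * n * k :=
    fun u v c => arc_lt u.2 v.2 c.2
  rw [detSum, coeff_sum_borderDet n k _ wt H x h.pos ?_ ?_ ?_ hx]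
  · congr 2
    ext p
    simp only [Finset.mem_filter, mem_rainbow_without, and_assoc]
  · rintro u v c ⟨h1, h2, h3⟩
    rw [mirror_arc v.2 c.2] at h3
    refine ⟨?_, h3, ?_⟩
    · rw [← mirror_arc v.2 c.2]
      exact h.al_mirror _ (hlt u v c) h1
    · rwa [mirror_arc u.2 c.2]
  · intro u v c
    rw [← mirror_arc u.2 c.2]
    exact h.wt_mirror _ (hlt v u c)
  · rintro u v c ⟨h1, -, -⟩
    exact h.wt_le _ (hlt u v c) h1

theorem Admissible.le_arcSum {n k H : ℕ} {al : ℕ → Prop} {wt : ℕ → ℕ}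
    (h : Admissible n k H al wt) (p : Equiv.Perm (Fin n) × (Fin n → Fin k)) :
    n * (n * H) ≤ arcSum wt p := by
  have := Finset.card_nsmul_le_sum (Finset.univ : Finset (Fin n))
    (fun u => wt (arc n k u (p.1 u) (p.2 u))) (n * H)
    fun u _ => h.le_wt _ (arc_lt u.2 (p.1 u).2 (p.2 u).2)
  simpa [arcSum] using this

/-- The determinants identify a unique lightest solution `p`: its weight is the least exponent, and
the coefficient there vanishes when an arc `f` is left out if and only if `p` uses `f`. -/
theorem Admissible.recover {n k H : ℕ} {al : ℕ → Prop} {wt : ℕ → ℕ}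
    (h : Admissible n k H al wt) {p : Equiv.Perm (Fin n) × (Fin n → Fin k)}
    (hp : p ∈ rainbow n k al) (hmin : ∀ r ∈ rainbow n k al, r ≠ p → arcSum wt p < arcSum wt r) :
    (∀ x < arcSum wt p, n * (n * H) ≤ x → ∀ f, detSum n k (without n k al f) wt x = 0) ∧
      ∀ f, detSum n k (without n k al f) wt (arcSum wt p) = 0 ↔ f ∈ arcs p := by
  constructor
  · intro x hx hle f
    rw [h.detSum_eq f x hle, Finset.filter_eq_empty_iff.2, Finset.card_empty, Nat.cast_zero]
    rintro r hr ⟨-, rfl⟩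
    by_cases hrp : r = p
    · subst hrp; omega
    · exact absurd (hmin r hr hrp) (by omega)
  · intro f
    rw [h.detSum_eq f _ (h.le_arcSum p)]
    by_cases hf : f ∈ arcs p
    · rw [Finset.filter_eq_empty_iff.2, Finset.card_empty, Nat.cast_zero]
      · simp [hf]
      · rintro r hr ⟨h1, h2⟩
        by_cases hrp : r = p
        · subst hrp; exact h1 hf
        · exact absurd (hmin r hr hrp) (by omega)
    · have : ((rainbow n k al).filter fun r => f ∉ arcs r ∧ arcSum wt r = arcSum wt p) = {p} := by
        ext r
        rw [Finset.mem_filter, Finset.mem_singleton]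
        constructor
        · rintro ⟨hr, -, h2⟩
          by_contra hrp
          exact absurd (hmin r hr hrp) (by omega)
        · rintro rfl
          exact ⟨hp, hf, rfl⟩
      rw [this]
      simp [hf]

theorem arcSum_mirror {n k : ℕ} {al : ℕ → Prop} {p : Equiv.Perm (Fin n) × (Fin n → Fin k)}
    (hp : p ∈ rainbow n k al) (R : ℕ → ℕ) :
    arcSum (fun e => R (mirror n k e)) p = arcSum R p := by
  obtain ⟨h1, h2, -, -⟩ := mem_rainbow.1 hp
  simp only [arcSum]
  rw [← Equiv.sum_comp p.1 fun u => R (arc n k u (p.1 u) (p.2 u))]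
  refine Finset.sum_congr rfl fun u _ => ?_
  rw [mirror_arc (p.1 u).2 (p.2 u).2, h1, h2]

/-- The total exponent of a solution. -/
theorem arcSum_exponents {n k : ℕ} {al : ℕ → Prop} {p : Equiv.Perm (Fin n) × (Fin n → Fin k)}
    (hp : p ∈ rainbow n k al) (T K : ℕ) (wa R : ℕ → ℕ) :
    arcSum (fun e => T + wa e * K + R e + R (mirror n k e)) p =
      n * T + K * arcSum wa p + 2 * arcSum R p := by
  have h := arcSum_mirror hp R
  simp only [arcSum] at h ⊢
  simp only [Finset.sum_add_distrib, h, ← Finset.sum_mul, Finset.sum_const, Finset.card_univ,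
    Fintype.card_fin, smul_eq_mul]
  ring

/-! ### Scaling the weights -/

namespace Instance

variable (I : Instance)

/-- The weight of an arc; `none` stands for arcs that are not allowed. -/
noncomputable def arcWeight (e : ℕ) : Option ℚ≥0 :=
  I.entry (e / I.k / I.n) (e / I.k % I.n) (e % I.k)

/-- The denominators after the replacement by `1` if the bound is zero. -/
noncomputable def arcDen (e : ℕ) : ℕ :=
  (I.arcWeight e).elim 0 fun w => if I.bound = 0 then 1 else w.den

/-- The numerators. -/
noncomputable def arcNum (e : ℕ) : ℕ := (I.arcWeight e).elim 0 NNRat.num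

/-- The common denominator by which the weights are scaled. -/
noncomputable def commonDenom : ℕ := if I.bound = 0 then 1 else I.denom

/-- The scaled weights. -/
noncomputable def intWeight (e : ℕ) : ℕ := I.arcNum e * (I.commonDenom / I.arcDen e)

/-- The arcs that can occur in a solution. The condition on the weight bounds the exponents of the
matrix. -/
def Allowed (e : ℕ) : Prop := I.arcDen e ≠ 0 ∧ I.intWeight e ≤ I.scaledBound

theorem bound_mul_commonDenom : I.bound * I.commonDenom = I.scaledBound := by
  rw [commonDenom, scaledBound]
  split_ifs with h
  · simp [h]
  · exact Nat.mul_comm _ _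

theorem commonDenom_pos : 0 < I.commonDenom := by
  rw [commonDenom]
  split_ifs
  · exact one_pos
  · rw [denom, Nat.pos_iff_ne_zero, Ne, Finset.lcm_eq_zero_iff]
    rintro ⟨p, -, hp⟩
    exact (I.weight p.1 p.2).den_ne_zero hp

theorem commonDenom_le : I.commonDenom ≤ I.scaledBound + 1 := by
  rw [← bound_mul_commonDenom]
  by_cases h : I.bound = 0
  · simp [commonDenom, h]
  · have : 1 ≤ I.bound := Nat.one_le_iff_ne_zero.2 h
    nlinarith

theorem arcWeight_arc (u v : Fin I.n) (c : Fin I.k) :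
    I.arcWeight (arc I.n I.k u v c) = I.entry u v c := by
  rw [arcWeight, arc_src v.2 c.2, arc_dst v.2 c.2, arc_col c.2]

/-- The search for the common denominator, which only looks at the table, finds the right one. -/
theorem dvd_iff (D : ℕ) : (∀ e < I.n * I.n * I.k, I.arcDen e ≠ 0 → I.arcDen e ∣ D) ↔
    I.commonDenom ∣ D := by
  by_cases hb : I.bound = 0
  · simp only [commonDenom, hb, if_true, one_dvd, iff_true]
    intro e _ he
    rw [arcDen] at he ⊢
    cases h : I.arcWeight e with
    | none => simp [h] at he
    | some w => simp [hb]
  · simp only [commonDenom, hb, if_false, denom, Finset.lcm_dvd_iff]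
    constructor
    · rintro h ⟨⟨e, he⟩, c, hc⟩ -
      induction e with
      | _ u v =>
        have := h (arc I.n I.k u v c) (arc_lt u.2 v.2 c.2)
        rw [arcDen, arcWeight_arc, entry_eq_some he hc] at this
        simpa [hb] using this
    · intro h e he hne
      have he' : e = arc I.n I.k (⟨_, src_lt he⟩ : Fin I.n)
          (⟨_, Nat.mod_lt _ (pos_of_lt_mul he).1⟩ : Fin I.n)
          (⟨_, Nat.mod_lt _ (pos_of_lt_mul he).2⟩ : Fin I.k) := (arc_ends _ _ _).symm
      rw [he', arcDen, arcWeight_arc] at hne ⊢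
      have hne' : I.entry (⟨_, src_lt he⟩ : Fin I.n)
          (⟨_, Nat.mod_lt _ (pos_of_lt_mul he).1⟩ : Fin I.n)
          (⟨_, Nat.mod_lt _ (pos_of_lt_mul he).2⟩ : Fin I.k) ≠ none := fun h0 => by
        rw [h0] at hne; simp at hne
      obtain ⟨ha, hc⟩ := of_entry_ne_none hne'
      rw [entry_eq_some ha hc]
      classical
      simpa [hb] using h ⟨⟨_, ha⟩, ⟨_, hc⟩⟩ (Finset.mem_univ _)

theorem entry_comm (u v : Fin I.n) (c : Fin I.k) : I.entry u v c = I.entry v u c := by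
  have key : ∀ u v : Fin I.n, I.entry u v c ≠ none → I.entry u v c = I.entry v u c := by
    intro u v h
    obtain ⟨ha, hc⟩ := of_entry_ne_none h
    have : ∀ x : I.G.edgeSet, (⟨s(u, v), ha⟩ : I.G.edgeSet) = x →
        ∃ hc' : c ∈ I.colors x, I.weight ⟨s(u, v), ha⟩ ⟨c, hc⟩ = I.weight x ⟨c, hc'⟩ := by
      rintro _ rfl
      exact ⟨hc, rfl⟩
    obtain ⟨hc', h'⟩ := this ⟨s(v, u), Sym2.eq_swap ▸ ha⟩ (Subtype.ext Sym2.eq_swap)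
    rw [entry_eq_some ha hc, entry_eq_some _ hc', h']
  by_cases h : I.entry u v c = none
  · by_contra h'
    exact h' (key v u fun h0 => h' (h.trans h0.symm)).symm
  · exact key u v h

theorem arcWeight_mirror {e : ℕ} (he : e < I.n * I.n * I.k) :
    I.arcWeight (mirror I.n I.k e) = I.arcWeight e := by
  have hv := Nat.mod_lt (e / I.k) (pos_of_lt_mul he).1
  have hc := Nat.mod_lt e (pos_of_lt_mul he).2
  have := I.entry_comm ⟨_, src_lt he⟩ ⟨_, hv⟩ ⟨_, hc⟩
  rw [arcWeight, mirror, arc_src (src_lt he) hc, arc_dst (src_lt he) hc, arc_col hc]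
  exact this.symm

theorem arcDen_mirror {e : ℕ} (he : e < I.n * I.n * I.k) :
    I.arcDen (mirror I.n I.k e) = I.arcDen e := by
  rw [arcDen, I.arcWeight_mirror he, arcDen]

theorem intWeight_mirror {e : ℕ} (he : e < I.n * I.n * I.k) :
    I.intWeight (mirror I.n I.k e) = I.intWeight e := by
  rw [intWeight, arcNum, I.arcWeight_mirror he, I.arcDen_mirror he, intWeight, arcNum]

theorem allowed_mirror {e : ℕ} (he : e < I.n * I.n * I.k) (h : I.Allowed e) :
    I.Allowed (mirror I.n I.k e) := by
  rwa [Allowed, I.arcDen_mirror he, I.intWeight_mirror he]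

variable {I}

theorem cast_intWeight (hb : I.bound ≠ 0) {e : ℕ} (he : e < I.n * I.n * I.k) {w : ℚ≥0}
    (hw : I.arcWeight e = some w) : (I.intWeight e : ℚ≥0) = w * I.commonDenom := by
  have hden : I.arcDen e = w.den := by simp [arcDen, hw, hb]
  have hdvd : w.den ∣ I.commonDenom :=
    hden ▸ (I.dvd_iff _).2 dvd_rfl e he (hden ▸ w.den_ne_zero)
  obtain ⟨d, hd⟩ := hdvd
  rw [intWeight, arcNum, hw, hden, hd, Nat.mul_div_cancel_left _ (Nat.pos_of_ne_zero w.den_ne_zero)]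
  push_cast
  rw [← mul_assoc]
  congr 1
  conv_rhs => rw [← NNRat.num_div_den w]
  field_simp
  simp

theorem intWeight_eq_zero (hb : I.bound = 0) {e : ℕ} {w : ℚ≥0} (hw : I.arcWeight e = some w) :
    I.intWeight e = 0 ↔ w = 0 := by
  have : w.num = 0 ↔ w = 0 := not_iff_not.1 NNRat.num_ne_zero
  simp [intWeight, arcNum, arcDen, commonDenom, hw, hb, this]

end Instance

section Encodes

variable {I : Instance} {R : PerfectMatching I} {p : Equiv.Perm (Fin I.n) × (Fin I.n → Fin I.k)}

/-- The bound on the weight, scaled to integers; each edge is counted twice. -/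
theorem Encodes.isSolution_iff (h : Encodes R p) :
    R.IsSolution ↔ arcSum I.intWeight p ≤ I.scaledBound + I.scaledBound := by
  have hw : ∀ u : Fin I.n, I.arcWeight (arc I.n I.k u (p.1 u) (p.2 u)) =
      some ((I.entry u (p.1 u) (p.2 u)).getD 0) := fun u => by
    rw [Instance.arcWeight_arc, h.entry_eq, Option.getD_some]
  have hsum := h.sum_entry
  rw [PerfectMatching.IsSolution]
  by_cases hb : I.bound = 0
  · have h1 : R.totalWeight = 0 ↔ ∑ u : Fin I.n, (I.entry u (p.1 u) (p.2 u)).getD 0 = 0 := by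
      rw [hsum]; simp
    rw [← I.bound_mul_commonDenom, hb, zero_mul, add_zero, Nat.cast_zero, nonpos_iff_eq_zero,
      nonpos_iff_eq_zero, h1, arcSum, Finset.sum_eq_zero_iff, Finset.sum_eq_zero_iff]
    exact forall₂_congr fun u _ => (Instance.intWeight_eq_zero hb (hw u)).symm
  · have hD : (0 : ℚ≥0) < I.commonDenom := by exact_mod_cast I.commonDenom_pos
    have h1 : (arcSum I.intWeight p : ℚ≥0) = 2 * R.totalWeight * I.commonDenom := by
      rw [← hsum, arcSum, Nat.cast_sum, Finset.sum_mul]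
      exact Finset.sum_congr rfl fun u _ =>
        Instance.cast_intWeight hb (arc_lt u.2 (p.1 u).2 (p.2 u).2) (hw u)
    rw [← Nat.cast_le (α := ℚ≥0), h1, ← I.bound_mul_commonDenom]
    push_cast
    rw [show (I.bound : ℚ≥0) * I.commonDenom + I.bound * I.commonDenom =
      2 * I.bound * I.commonDenom by ring, mul_le_mul_iff_left₀ hD,
      mul_le_mul_iff_right₀ (by norm_num)]

/-- Solutions only use arcs of scaled weight at most `L`. -/
theorem Encodes.mem_rainbow (h : Encodes R p) (hR : R.IsSolution) :
    p ∈ rainbow I.n I.k I.Allowed := by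
  refine RainbowMatching.mem_rainbow.2 ⟨h.involutive, h.color_apply, h.surjective,
    fun u => ⟨?_, ?_⟩⟩
  · rw [Instance.arcDen, Instance.arcWeight_arc, h.entry_eq]
    simp only [Option.elim_some]
    split_ifs
    · simp
    · exact NNRat.den_ne_zero _
  · -- the arc and its opposite, which has the same weight, both contribute to the sum
    have hlt := arc_lt (k := I.k) u.2 (p.1 u).2 (p.2 u).2
    have h2 := h.isSolution_iff.1 hR
    have h3 : I.intWeight (arc I.n I.k (p.1 u) (p.1 (p.1 u)) (p.2 (p.1 u))) =
        I.intWeight (arc I.n I.k u (p.1 u) (p.2 u)) := by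
      rw [h.involutive, h.color_apply, ← mirror_arc (p.1 u).2 (p.2 u).2, I.intWeight_mirror hlt]
    have h4 : ∑ v ∈ {u, p.1 u}, I.intWeight (arc I.n I.k v (p.1 v) (p.2 v)) ≤
        arcSum I.intWeight p :=
      Finset.sum_le_sum_of_subset (Finset.subset_univ _)
    rw [Finset.sum_pair (h.ne u).symm, h3] at h4
    omega

theorem exists_encodes_of_mem (hp : p ∈ rainbow I.n I.k I.Allowed) : ∃ R, Encodes R p := by
  obtain ⟨h1, h2, h3, h4⟩ := RainbowMatching.mem_rainbow.1 hp
  refine exists_encodes_of_entry p h1 h2 h3 fun u hu => (h4 u).1 ?_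
  rw [Instance.arcDen, Instance.arcWeight_arc, hu]
  rfl

end Encodes

/-! ### The exponents of the matrix -/

theorem mirror_mirror {n k e : ℕ} (he : e < n * n * k) : mirror n k (mirror n k e) = e := by
  have hc := Nat.mod_lt e (pos_of_lt_mul he).2
  have hv := Nat.mod_lt (e / k) (pos_of_lt_mul he).1
  rw [mirror.eq_1 n k e, mirror_arc (src_lt he) hc, arc_ends]

namespace Instance

variable (I : Instance) (c : ℕ)

/-- The number of random bits for each arc. It makes the number of random values at least
`(n + L + 1) ^ (c + 3)`, where three factors compensate the number of arcs. -/
noncomputable def arcBits : ℕ := (c + 3) * Nat.clog 2 (I.n + I.scaledBound + 1)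

/-- The factor that makes the weights prevail over the random numbers. -/
noncomputable def factor : ℕ := (2 ^ I.arcBits c + 2 ^ I.arcBits c) * I.n + 1

/-- An upper bound for the part of an exponent that depends on the arc. -/
noncomputable def span : ℕ := I.factor c * (I.scaledBound + 1)

/-- The number of coefficients that are computed; the exponents of all solutions are below it. -/
noncomputable def precision : ℕ := I.span c * I.n * I.n + I.span c + I.span c

/-- The random number for the arc `e`. -/
noncomputable def randomNumber (ω : ℕ → Bool) (e : ℕ) : ℕ :=
  bitsVal (fun j => ω (j + e * I.arcBits c)) (I.arcBits c)

/-- The exponents of the entries of the matrix. -/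
noncomputable def exponent (ω : ℕ → Bool) (e : ℕ) : ℕ :=
  I.span c * I.n + I.intWeight e * I.factor c + I.randomNumber c ω e +
    I.randomNumber c ω (mirror I.n I.k e)

theorem randomNumber_lt (ω : ℕ → Bool) (e : ℕ) : I.randomNumber c ω e < 2 ^ I.arcBits c :=
  bitsVal_lt _ _

theorem span_pos : 0 < I.span c := by
  unfold span factor; positivity

theorem admissible (ω : ℕ → Bool) :
    Admissible I.n I.k (I.span c) I.Allowed (I.exponent c ω) where
  pos := I.span_pos c
  al_mirror _ he h := I.allowed_mirror he h
  wt_mirror e he := by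
    rw [exponent, I.intWeight_mirror he, mirror_mirror he, exponent]
    omega
  le_wt e he := by
    rw [exponent, Nat.mul_comm I.n]
    omega
  wt_le e he h := by
    have h1 := I.randomNumber_lt c ω e
    have h2 := I.randomNumber_lt c ω (mirror I.n I.k e)
    have hn := (pos_of_lt_mul he).1
    have h3 : I.intWeight e * I.factor c ≤ I.scaledBound * I.factor c :=
      Nat.mul_le_mul_right _ h.2
    have h4 : 2 ^ I.arcBits c + 2 ^ I.arcBits c ≤ I.factor c := by
      rw [factor]; nlinarith
    have h5 : I.span c = I.scaledBound * I.factor c + I.factor c := by rw [span]; ring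
    rw [exponent, Nat.mul_comm I.n]
    omega

theorem exponent_pos (ω : ℕ → Bool) (e : ℕ) (he : e < I.n * I.n * I.k) :
    0 < I.exponent c ω e := by
  have h1 := (I.admissible c ω).le_wt e he
  have h2 := Nat.mul_pos (pos_of_lt_mul he).1 (I.span_pos c)
  omega

theorem arcSum_exponent (ω : ℕ → Bool) {p : Equiv.Perm (Fin I.n) × (Fin I.n → Fin I.k)}
    (hp : p ∈ rainbow I.n I.k I.Allowed) :
    arcSum (I.exponent c ω) p = I.n * (I.span c * I.n) + I.factor c * arcSum I.intWeight p +
      2 * arcSum (I.randomNumber c ω) p :=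
  arcSum_exponents hp _ _ _ _

theorem two_mul_arcSum_randomNumber_lt (ω : ℕ → Bool)
    (p : Equiv.Perm (Fin I.n) × (Fin I.n → Fin I.k)) :
    2 * arcSum (I.randomNumber c ω) p < I.factor c := by
  have : arcSum (I.randomNumber c ω) p ≤ I.n * 2 ^ I.arcBits c := by
    have := Finset.sum_le_card_nsmul (Finset.univ : Finset (Fin I.n))
      (fun u => I.randomNumber c ω (arc I.n I.k u (p.1 u) (p.2 u))) (2 ^ I.arcBits c)
      fun u _ => (I.randomNumber_lt c ω _).le
    simpa [arcSum] using this
  rw [factor]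
  nlinarith

theorem arcSum_exponent_lt (ω : ℕ → Bool) {p : Equiv.Perm (Fin I.n) × (Fin I.n → Fin I.k)}
    (hp : p ∈ rainbow I.n I.k I.Allowed)
    (hL : arcSum I.intWeight p ≤ I.scaledBound + I.scaledBound) :
    arcSum (I.exponent c ω) p < I.precision c := by
  have h1 := I.two_mul_arcSum_randomNumber_lt c ω p
  have h2 := Nat.mul_le_mul_left (I.factor c) hL
  have h3 : I.span c = I.factor c * I.scaledBound + I.factor c := by rw [span]; ring
  have h4 : I.n * (I.span c * I.n) = I.span c * I.n * I.n := by ring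
  rw [I.arcSum_exponent c ω hp, precision, h4]
  rw [Nat.mul_add] at h2
  omega

end Instance

/-! ### Correctness of the algorithm -/

namespace Algorithm

open Stmt Exp

/-- The state after the first `d` steps of the search for the common denominator. -/
structure Prepared (I : Instance) (ω : ℕ → Bool) (d : ℕ) (σ : Store) : Prop where
  n_eq : σ.var .n = I.n
  k_eq : σ.var .k = I.k
  bound_eq : σ.var .bound = I.bound
  E_eq : σ.var .E = I.n * I.n * I.k
  D_eq : σ.var .D = d
  tables : Tables I.n I.k σ
  fst_eq : ∀ e < I.n * I.n * I.k, σ.arr .fst e = I.arcNum e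
  snd_eq : ∀ e < I.n * I.n * I.k, σ.arr .snd e = I.arcDen e
  deg_eq : ∀ u, σ.arr .deg u = 0
  mark_eq : ∀ c, σ.arr .mark c = 0
  coins_eq : σ.coins = ω

/-- The state before the selection of the arcs. -/
structure Ready (I : Instance) (c : ℕ) (ω : ℕ → Bool) (σ : Store) : Prop where
  matrix : MatrixData I.n I.k (I.precision c) I.Allowed (I.exponent c ω) σ
  D_eq : σ.var .D = I.commonDenom
  B_eq : σ.var .B = I.n + I.scaledBound + 1
  Q_eq : σ.var .Q = c + 3
  m0_eq : σ.var .m0 = Nat.clog 2 (I.n + I.scaledBound + 1)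
  m_eq : σ.var .m = I.arcBits c
  L1_eq : σ.var .L1 = I.scaledBound + 1
  K_eq : σ.var .K = I.factor c
  nT_eq : σ.var .nT = I.span c * I.n * I.n
  L_eq : σ.var .L = I.scaledBound
  wa_eq : ∀ e < I.n * I.n * I.k, σ.arr .wa e = I.intWeight e
  deg_eq : ∀ u, σ.arr .deg u = 0
  mark_eq : ∀ c, σ.arr .mark c = 0

theorem ready_phases {I : Instance} {c : ℕ} {ω : ℕ → Bool} {σ : Store}
    (h : Prepared I ω I.commonDenom σ) : Ready I c ω ((phases c).foldl (fun σ p => p.run σ) σ) := by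
  simp only [phases, List.foldl_cons, List.foldl_nil]
  obtain ⟨s1, s2, s3, s4, s5⟩ := scale_spec σ
  rw [h.bound_eq, h.D_eq, I.bound_mul_commonDenom] at s1 s2 s5
  rw [h.n_eq] at s2
  rw [h.E_eq] at s5
  set σ₁ := scale.run σ with hσ₁
  obtain ⟨l1, l2, l3, l4⟩ := findLog_spec c s3 s4
  rw [s2] at l1
  set σ₂ := (findLog c).run σ₁ with hσ₂
  obtain ⟨r1, r2, r3, r4⟩ := randomRange_spec l3 l4
  have e2n : σ₂.var .n = I.n := by
    rw [hσ₂, run_var rfl, hσ₁, run_var rfl, h.n_eq]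
  have e2L : σ₂.var .L = I.scaledBound := by rw [hσ₂, run_var rfl, s1]
  have hm : σ₂.var .Q * σ₂.var .m0 = I.arcBits c := by rw [l1, l2]; rfl
  rw [hm] at r1 r2 r4
  rw [e2n] at r4
  rw [e2L] at r3
  set σ₃ := randomRange.run σ₂ with hσ₃
  obtain ⟨p1, p2, p3, p4, p5, p6, p7, p8⟩ := parameters_spec σ₃
  have e3n : σ₃.var .n = I.n := by rw [hσ₃, run_var rfl, e2n]
  have e3k : σ₃.var .k = I.k := by
    rw [hσ₃, run_var rfl, hσ₂, run_var rfl, hσ₁, run_var rfl, h.k_eq]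
  have hH : σ₃.var .K * σ₃.var .L1 = I.span c := by rw [r4, r3]; rfl
  rw [hH, e3n] at p2 p3 p4 p5 p8
  rw [e3k] at p6 p7
  set σ₄ := parameters.run σ₃ with hσ₄
  have e4E : σ₄.var .E = I.n * I.n * I.k := by
    rw [hσ₄, run_var rfl, hσ₃, run_var rfl, hσ₂, run_var rfl, hσ₁, run_var rfl, h.E_eq]
  have e4m : σ₄.var .m = I.arcBits c := by rw [hσ₄, run_var rfl, r1]
  have e4c : σ₄.coins = ω := by
    rw [hσ₄, run_coins rfl, hσ₃, run_coins rfl, hσ₂, run_coins rfl, hσ₁, run_coins rfl, h.coins_eq]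
  have hR := randomize_spec σ₄
  rw [e4E, e4m, e4c] at hR
  set σ₅ := randomize.run σ₄ with hσ₅
  have hX := exponents_spec σ₅
  have e5 : ∀ {x}, Stmt.writesVar randomize x = false → σ₅.var x = σ₄.var x := fun hx => by
    rw [hσ₅, run_var hx]
  rw [e5 rfl, e4E, e5 rfl, p2, e5 (x := .K) rfl] at hX
  have e4K : σ₄.var .K = I.factor c := by rw [hσ₄, run_var rfl, r4]; rfl
  rw [e4K] at hX
  set σ₆ := exponents.run σ₅ with hσ₆
  have e6 : ∀ {x}, Stmt.writesVar randomize x = false → Stmt.writesVar exponents x = false →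
      σ₆.var x = σ₄.var x := fun hx hx' => by
    rw [hσ₆, run_var hx', e5 hx]
  have a5 : ∀ {a}, Stmt.writesArr (findLog c) a = false → Stmt.writesArr randomRange a = false →
      Stmt.writesArr parameters a = false → Stmt.writesArr randomize a = false →
      σ₅.arr a = σ₁.arr a := fun h1 h2 h3 h4 => by
    rw [hσ₅, run_arr h4, hσ₄, run_arr h3, hσ₃, run_arr h2, hσ₂, run_arr h1]
  have a6 : ∀ {a}, Stmt.writesArr (findLog c) a = false → Stmt.writesArr randomRange a = false →
      Stmt.writesArr parameters a = false → Stmt.writesArr randomize a = false →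
      Stmt.writesArr exponents a = false →
      σ₆.arr a = σ₁.arr a := fun h1 h2 h3 h4 h5 => by
    rw [hσ₆, run_arr h5, a5 h1 h2 h3 h4]
  have a1 : ∀ {a}, Stmt.writesArr scale a = false → σ₁.arr a = σ.arr a := fun h => by
    rw [hσ₁, run_arr h]
  have hsrc : σ₆.arr .src = σ.arr .src := (a6 rfl rfl rfl rfl rfl).trans (a1 rfl)
  have hdst : σ₆.arr .dst = σ.arr .dst := (a6 rfl rfl rfl rfl rfl).trans (a1 rfl)
  have hcol : σ₆.arr .col = σ.arr .col := (a6 rfl rfl rfl rfl rfl).trans (a1 rfl)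
  have hmir : σ₆.arr .mir = σ.arr .mir := (a6 rfl rfl rfl rfl rfl).trans (a1 rfl)
  have hwa : ∀ e < I.n * I.n * I.k, σ₁.arr .wa e = I.intWeight e := fun e he => by
    rw [(s5 e he).1, h.fst_eq e he, h.snd_eq e he]; rfl
  refine ⟨⟨?_, ?_, ?_, ?_, ?_, ?_, ⟨?_, ?_, ?_, ?_⟩, ?_, ?_, ?_, ?_⟩, ?_, ?_, ?_, ?_,
    ?_, ?_, ?_, ?_, ?_, ?_, ?_, ?_⟩
  · rw [e6 rfl rfl, e4E]
  · rw [e6 rfl rfl, hσ₄, run_var rfl, e3n]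
  · rw [e6 rfl rfl, hσ₄, run_var rfl, e3k]
  · rw [e6 rfl rfl, p4]; rfl
  · rw [e6 rfl rfl, p5]; rfl
  · rw [e6 rfl rfl, p6]
  · rw [hsrc]; exact h.tables.src
  · rw [hdst]; exact h.tables.dst
  · rw [hcol]; exact h.tables.col
  · rw [hmir]; exact h.tables.mir
  · rw [hσ₆, run_arr rfl, hσ₅, run_arr rfl]
    exact p8
  · rw [hσ₆, run_arr rfl, hσ₅, run_arr rfl]
    exact p7
  · intro e he
    rw [a6 rfl rfl rfl rfl rfl, (s5 e he).2, h.fst_eq e he, h.snd_eq e he]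
    rfl
  · intro e he
    have hm : σ₅.arr .mir e = mirror I.n I.k e := by
      rw [a5 rfl rfl rfl rfl, a1 rfl]; exact h.tables.mir e he
    rw [hX e he, hm, hR e he, hR _ (mirror_lt he), a5 rfl rfl rfl rfl, hwa e he]
    rfl
  · rw [e6 rfl rfl, hσ₄, run_var rfl, hσ₃, run_var rfl, hσ₂, run_var rfl, hσ₁, run_var rfl, h.D_eq]
  · rw [e6 rfl rfl, hσ₄, run_var rfl, hσ₃, run_var rfl, hσ₂, run_var rfl, s2]
  · rw [e6 rfl rfl, hσ₄, run_var rfl, hσ₃, run_var rfl, l2]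
  · rw [e6 rfl rfl, hσ₄, run_var rfl, hσ₃, run_var rfl, l1]
  · rw [e6 rfl rfl, e4m]
  · rw [e6 rfl rfl, hσ₄, run_var rfl, r3]
  · rw [e6 rfl rfl, e4K]
  · rw [e6 rfl rfl, p3]
  · rw [e6 rfl rfl, hσ₄, run_var rfl, hσ₃, run_var rfl, e2L]
  · rw [a6 rfl rfl rfl rfl rfl]; exact hwa
  · rw [a6 rfl rfl rfl rfl rfl, a1 rfl]; exact h.deg_eq
  · rw [a6 rfl rfl rfl rfl rfl, a1 rfl]; exact h.mark_eq

open Classical in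
/-- The final answer and output in terms of the selected arcs. -/
theorem finish_spec {I : Instance} {c : ℕ} {ω : ℕ → Bool} {σ : Store} (h : Ready I c ω σ) :
    let S := selected (select.run σ) (I.n * I.n * I.k)
    let V := Valid I.n I.k I.scaledBound I.Allowed I.intWeight S
    ((verify.run (select.run σ)).var .n = if V then 1 else 0) ∧
      (V → ∀ e ∈ S, (verify.run (select.run σ)).arr .fst (e / I.k / I.n) = e / I.k % I.n ∧
        (verify.run (select.run σ)).arr .snd (e / I.k / I.n) = e % I.k) := by
  set τ := select.run σ with hτ
  have hM : MatrixData I.n I.k (I.precision c) I.Allowed (I.exponent c ω) τ :=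
    h.matrix.congr (by intro x hx; rw [hτ, run_var]; fin_cases hx <;> rfl)
      (by intro a ha; rw [hτ, run_arr]; fin_cases ha <;> rfl)
  have hL : τ.var .L = I.scaledBound := by rw [hτ, run_var rfl, h.L_eq]
  have hwa : τ.arr .wa = σ.arr .wa := by rw [hτ, run_arr rfl]
  have key := verify_spec hM.E_eq hM.n_eq hM.k_eq hM.tables
    (fun u _ => by rw [hτ, run_arr rfl, h.deg_eq]) fun c _ => by rw [hτ, run_arr rfl, h.mark_eq]
  have hV : Valid I.n I.k (τ.var .L) (fun e => τ.arr .al e ≠ 0) (τ.arr .wa)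
      (selected τ (I.n * I.n * I.k)) ↔ Valid I.n I.k I.scaledBound I.Allowed I.intWeight
      (selected τ (I.n * I.n * I.k)) := by
    have hlt : ∀ e ∈ selected τ (I.n * I.n * I.k), e < I.n * I.n * I.k :=
      fun e he => (mem_selected.1 he).1
    have hsum : ∑ e ∈ selected τ (I.n * I.n * I.k), τ.arr .wa e =
        ∑ e ∈ selected τ (I.n * I.n * I.k), I.intWeight e :=
      Finset.sum_congr rfl fun e he => by rw [hwa, h.wa_eq e (hlt e he)]
    constructor
    · rintro ⟨h1, h2, h3, h4, h5⟩
      exact ⟨fun e he => (hM.al_iff e (hlt e he)).1 (h1 e he), h2, h3, h4, by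
        rwa [← hsum, ← hL]⟩
    · rintro ⟨h1, h2, h3, h4, h5⟩
      exact ⟨fun e he => (hM.al_iff e (hlt e he)).2 (h1 e he), h2, h3, h4, by
        rwa [hsum, hL]⟩
  simp only [hV] at key
  exact key

/-- Only correct answers are given. -/
theorem finish_sound {I : Instance} {c : ℕ} {ω : ℕ → Bool} {σ : Store} (h : Ready I c ω σ) :
    (verify.run (select.run σ)).var .n = 0 ∨ (verify.run (select.run σ)).var .n = 1 ∧
      ∃ p ∈ rainbow I.n I.k I.Allowed, arcSum I.intWeight p ≤ I.scaledBound + I.scaledBound ∧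
        ∀ u : Fin I.n, (verify.run (select.run σ)).arr .fst u = p.1 u ∧
          (verify.run (select.run σ)).arr .snd u = p.2 u := by
  classical
  obtain ⟨h1, h2⟩ := finish_spec h
  by_cases hV : Valid I.n I.k I.scaledBound I.Allowed I.intWeight
    (selected (select.run σ) (I.n * I.n * I.k))
  · refine .inr ⟨by rw [h1, if_pos hV], ?_⟩
    obtain ⟨p, hp, hS⟩ := exists_rainbow_of_valid (fun e he => (mem_selected.1 he).1) hV
    refine ⟨p, hp, ?_, fun u => ?_⟩
    · rw [← sum_arcs, hS]
      exact hV.weight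
    · have := h2 hV (arc I.n I.k u (p.1 u) (p.2 u)) (hS ▸ arc_mem_arcs.2 ⟨rfl, rfl⟩)
      rwa [arc_src (p.1 u).2 (p.2 u).2, arc_dst (p.1 u).2 (p.2 u).2, arc_col (p.2 u).2] at this
  · exact .inl (by rw [h1, if_neg hV])

/-- If a unique lightest solution exists, it is found. -/
theorem finish_complete {I : Instance} {c : ℕ} {ω : ℕ → Bool} {σ : Store} (h : Ready I c ω σ)
    {p : Equiv.Perm (Fin I.n) × (Fin I.n → Fin I.k)} (hp : p ∈ rainbow I.n I.k I.Allowed)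
    (hL : arcSum I.intWeight p ≤ I.scaledBound + I.scaledBound)
    (hmin : ∀ r ∈ rainbow I.n I.k I.Allowed, r ≠ p →
      arcSum (I.exponent c ω) p < arcSum (I.exponent c ω) r) :
    (verify.run (select.run σ)).var .n = 1 := by
  classical
  obtain ⟨h1, -⟩ := finish_spec h
  obtain ⟨g1, g2⟩ := (I.admissible c ω).recover hp hmin
  have hnT : σ.var .nT = I.n * (I.n * I.span c) := by rw [h.nT_eq]; ring
  have hsel := select_spec h.matrix (fun e he => I.exponent_pos c ω e he)
    (W := arcSum (I.exponent c ω) p) (by rw [hnT]; exact (I.admissible c ω).le_arcSum p)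
    (I.arcSum_exponent_lt c ω hp hL) (fun h0 => (arcs_lt ((g2 _).1 h0)).false)
    fun x hx hle => g1 x hx (by rwa [← hnT]) _
  have hS : selected (select.run σ) (I.n * I.n * I.k) = arcs p := by
    ext e
    rw [mem_selected]
    constructor
    · rintro ⟨he, hne⟩
      exact (g2 e).1 ((hsel e he).1 hne)
    · intro he
      exact ⟨arcs_lt he, (hsel e (arcs_lt he)).2 ((g2 e).2 he)⟩
  rw [h1, if_pos]
  rw [hS]
  exact valid_arcs hp hL

end Algorithm

/-! ### Execution and running time -/

/-- The running time of a list of statements, in terms of values `v` of the loop bounds that hold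
whenever they are used. -/
theorem chain_exec {l : List Stmt} (hwf : ∀ p ∈ l, p.wf = true) {σ : Store} {s : State}
    (h : Rep σ s) {v : Var → ℕ}
    (hv : ∀ l₁ p l₂, l = l₁ ++ p :: l₂ →
      ∀ x ∈ p.bounds, (l₁.foldl (fun σ p => p.run σ) σ).var x = v x) :
    ∃ s' t, Exec (chain l) s s' t ∧ t ≤ 1 + (l.map fun p => p.time v).sum ∧
      Rep (l.foldl (fun σ p => p.run σ) σ) s' := by
  induction l generalizing σ s with
  | nil =>
    obtain ⟨s', t, h1, h2, h3⟩ := Stmt.skip.code_exec rfl h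
    exact ⟨s', t, h1, by simpa [Stmt.time] using h2, h3⟩
  | cons p l ih =>
    obtain ⟨s₁, t₁, h1, h2, h3⟩ := p.code_exec (hwf p (by simp)) h
    obtain ⟨s₂, t₂, g1, g2, g3⟩ := ih (fun q hq => hwf q (by simp [hq])) h3
      fun l₁ q l₂ hl => hv (p :: l₁) q l₂ (by rw [hl]; rfl)
    refine ⟨s₂, _, .seq h1 g1, ?_, g3⟩
    replace h2 := h2.trans_eq (Stmt.time_congr p (v' := v) (hv [] p l rfl))
    simp only [List.map_cons, List.sum_cons]
    omega

/-- No statement of the list changes the loop bounds of itself or of an earlier one. -/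
def stable : List Stmt → Bool
  | [] => true
  | p :: l => (p.bounds.all fun x => (p :: l).all fun q => !q.writesVar x) && stable l

theorem foldl_run_var {l : List Stmt} {x : Var} (h : ∀ p ∈ l, p.writesVar x = false) (σ : Store) :
    (l.foldl (fun σ p => p.run σ) σ).var x = σ.var x := by
  induction l generalizing σ with
  | nil => rfl
  | cons p l ih =>
    rw [List.foldl_cons, ih fun q hq => h q (by simp [hq]), Stmt.run_var (h p (by simp))]

theorem stable_bounds {l : List Stmt} (hl : stable l = true) (σ : Store) :
    ∀ l₁ p l₂, l = l₁ ++ p :: l₂ → ∀ x ∈ p.bounds,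
      (l₁.foldl (fun σ p => p.run σ) σ).var x = (l.foldl (fun σ p => p.run σ) σ).var x := by
  induction l generalizing σ with
  | nil => intro l₁ p l₂ h; simp at h
  | cons q l ih =>
    simp only [stable, Bool.and_eq_true, List.all_eq_true, Bool.not_eq_true'] at hl
    rintro (_ | ⟨q', l₁⟩) p l₂ h x hx
    · obtain ⟨rfl, rfl⟩ := List.cons.inj h
      exact (foldl_run_var (hl.1 x hx) σ).symm
    · obtain ⟨rfl, h'⟩ := List.cons.inj h
      exact ih hl.2 _ l₁ p l₂ h' x hx

/-- The part of a machine state that the named variables and arrays see. -/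
def Store.ofState (s : State) : Store where
  var x := s.var x.idx
  arr a := s.arr a.idx
  coins := s.coins

theorem rep_ofState (s : State) : Rep (Store.ofState s) s := ⟨fun _ => rfl, fun _ => rfl, rfl⟩

namespace Instance

/-- A bound for the number of rounds of the loops, apart from those over all sets of colors. -/
noncomputable def rounds (I : Instance) (c : ℕ) : ℕ :=
  9 * (c + 4) * (2 * ((I.n + 1) * (I.scaledBound + 1))) ^ (c + 3) *
    ((I.n + 1) * (I.scaledBound + 1)) ^ 5

/-- A bound for the factor by which the number of steps exceeds the size of a program. -/
noncomputable def cost (I : Instance) (c : ℕ) : ℕ := I.rounds c ^ 4 * 2 ^ I.k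

end Instance

namespace Algorithm

open Stmt Exp

/-- The variables that bound the number of rounds of a loop. -/
def loopVars : List Var := [.n, .k, .E, .D, .B, .Q, .m0, .m, .L1, .K, .X, .nX]

theorem Ready.var_le {I : Instance} {c : ℕ} {ω : ℕ → Bool} {σ : Store} (h : Ready I c ω σ)
    (hk : I.k ≤ I.n) : ∀ x ∈ loopVars, σ.var x ≤ I.rounds c := by
  set Y := (I.n + 1) * (I.scaledBound + 1) with hY
  set M := (2 * Y) ^ (c + 3) with hM
  have hY1 : 1 ≤ Y := Nat.one_le_iff_ne_zero.2 (by positivity)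
  have hM1 : 1 ≤ M := Nat.one_le_pow _ _ (by omega)
  have hnY : I.n + 1 ≤ Y := Nat.le_mul_of_pos_right _ (by omega)
  have hLY : I.scaledBound + 1 ≤ Y := Nat.le_mul_of_pos_left _ (by omega)
  have hBY : I.n + I.scaledBound + 1 ≤ Y := by rw [hY]; nlinarith
  have hlog := clog_two_le (I.n + I.scaledBound + 1)
  have hN : 2 ^ I.arcBits c ≤ M := by
    rw [Instance.arcBits, Nat.mul_comm, pow_mul, hM]
    refine Nat.pow_le_pow_left ?_ _
    -- the least power of two above `B` is at most `2 * B`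
    by_cases h0 : Nat.clog 2 (I.n + I.scaledBound + 1) = 0
    · rw [h0, pow_zero]; omega
    · obtain ⟨m, hm⟩ := Nat.exists_eq_succ_of_ne_zero h0
      have := Nat.pow_lt_of_lt_clog (b := 2) (x := I.n + I.scaledBound + 1) (y := m) (by omega)
      rw [hm, pow_succ]
      omega
  have hr : I.rounds c = 9 * (c + 4) * M * Y ^ 5 := rfl
  have hpow : ∀ i j, i ≤ j → Y ^ i ≤ Y ^ j := fun i j h => Nat.pow_le_pow_right hY1 h
  -- all bounds are products of a small constant, `c + 3`, a power of `Y`, and `M`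
  have base : ∀ a d i x, a ≤ 9 → d ≤ c + 4 → i ≤ 5 → x ≤ a * d * M * Y ^ i → x ≤ I.rounds c := by
    intro a d i x ha hd hi hx
    refine hx.trans ?_
    rw [hr]
    exact Nat.mul_le_mul (Nat.mul_le_mul_right _ (Nat.mul_le_mul ha hd)) (hpow _ _ hi)
  have hYM : ∀ i, Y ^ i ≤ M * Y ^ i := fun i => Nat.le_mul_of_pos_left _ hM1
  have hfac : I.factor c ≤ 3 * M * Y := by
    have h1 : 2 ^ I.arcBits c * I.n ≤ M * Y := Nat.mul_le_mul hN (by omega)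
    have h2 : 1 ≤ M * Y := Nat.mul_pos hM1 hY1
    rw [Instance.factor, Nat.add_mul]
    nlinarith
  have hspan : I.span c ≤ 3 * M * Y ^ 2 := by
    calc I.span c ≤ 3 * M * Y * Y := Nat.mul_le_mul hfac hLY
      _ = _ := by ring
  have hprec : I.precision c ≤ 9 * M * Y ^ 4 := by
    have h1 : I.span c * I.n * I.n ≤ 3 * M * Y ^ 2 * Y * Y :=
      Nat.mul_le_mul (Nat.mul_le_mul hspan (by omega)) (by omega)
    have h2 : 3 * M * Y ^ 2 ≤ 3 * M * Y ^ 4 := Nat.mul_le_mul_left _ (hpow 2 4 (by omega))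
    have h3 : 3 * M * Y ^ 2 * Y * Y = 3 * M * Y ^ 4 := by ring
    have h4 : 9 * M * Y ^ 4 = 3 * M * Y ^ 4 + 3 * M * Y ^ 4 + 3 * M * Y ^ 4 := by ring
    rw [Instance.precision]
    omega
  have hYle : ∀ x, x ≤ Y → x ≤ I.rounds c := fun x hx =>
    base 1 1 1 x (by omega) (by omega) (by omega) (by simpa using hx.trans (by simpa using hYM 1))
  simp only [loopVars, List.forall_mem_cons]
  refine ⟨?_, ?_, ?_, ?_, ?_, ?_, ?_, ?_, ?_, ?_, ?_, ?_, by simp⟩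
  · rw [h.matrix.n_eq]; exact hYle _ (by omega)
  · rw [h.matrix.k_eq]; exact hYle _ (by omega)
  · rw [h.matrix.E_eq]
    refine base 1 1 3 _ (by omega) (by omega) (by omega) ?_
    calc I.n * I.n * I.k ≤ Y * Y * Y :=
          Nat.mul_le_mul (Nat.mul_le_mul (by omega) (by omega)) (by omega)
      _ = Y ^ 3 := by ring
      _ ≤ _ := by simpa using hYM 3
  · rw [h.D_eq]; exact hYle _ (I.commonDenom_le.trans hLY)
  · rw [h.B_eq]; exact hYle _ hBY
  · rw [h.Q_eq]
    refine base 1 (c + 3) 0 _ (by omega) (by omega) (by omega) ?_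
    calc c + 3 ≤ (c + 3) * M := Nat.le_mul_of_pos_right _ hM1
      _ = _ := by ring
  · rw [h.m0_eq]; exact hYle _ (hlog.trans hBY)
  · rw [h.m_eq, Instance.arcBits]
    refine base 1 (c + 3) 1 _ (by omega) (by omega) (by omega) ?_
    rw [one_mul, pow_one, mul_assoc]
    exact Nat.mul_le_mul_left _ ((hlog.trans hBY).trans (by simpa using hYM 1))
  · rw [h.L1_eq]; exact hYle _ hLY
  · rw [h.K_eq]
    exact base 3 1 1 _ (by omega) (by omega) (by omega) (by simpa using hfac)
  · rw [h.matrix.X_eq]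
    exact base 9 1 4 _ (by omega) (by omega) (by omega) (by simpa using hprec)
  · rw [h.matrix.nX_eq]
    refine base 9 1 5 _ (by omega) (by omega) (by omega) ?_
    calc I.precision c * I.n ≤ 9 * M * Y ^ 4 * Y := Nat.mul_le_mul hprec (by omega)
      _ = _ := by ring

theorem one_le_rounds (I : Instance) (c : ℕ) : 1 ≤ I.rounds c :=
  Nat.one_le_iff_ne_zero.2 (by unfold Instance.rounds; positivity)

theorem time_le_cost (p : Stmt) {I : Instance} {c : ℕ} {v : Var → ℕ} (hd : p.deg ≤ 4)
    (hs : p.setDeg ≤ 1) (hv : ∀ x ∈ p.bounds, x ≠ .S → v x ≤ I.rounds c)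
    (hS : v .S ≤ 2 ^ I.k ∨ .S ∉ p.bounds) : p.time v ≤ p.coef * I.cost c := by
  refine (p.time_le (one_le_rounds I c) Nat.one_le_two_pow hv hS).trans ?_
  refine Nat.mul_le_mul_left _ (Nat.mul_le_mul (Nat.pow_le_pow_right (one_le_rounds I c) hd) ?_)
  simpa using Nat.pow_le_pow_right (n := 2 ^ I.k) Nat.one_le_two_pow hs

/-- The statements whose loops are bounded by the variables in `loopVars`. -/
theorem bounds_subset (c : ℕ) : ∀ p ∈ select :: verify :: phases c,
    p.deg ≤ 4 ∧ p.setDeg ≤ 1 ∧ ∀ x ∈ p.bounds, x ≠ .S → x ∈ loopVars := by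
  simp only [phases, List.forall_mem_cons]
  refine ⟨?_, ?_, ?_, ?_, ?_, ?_, ?_, ?_, by simp⟩ <;>
    refine ⟨Nat.le_of_ble_eq_true rfl, Nat.le_of_ble_eq_true rfl, ?_⟩
  all_goals first | decide | (change ∀ x ∈ (findLog 0).bounds, _; decide)

theorem Ready.time_le {I : Instance} {c : ℕ} {ω : ℕ → Bool} {σ : Store} (h : Ready I c ω σ)
    (hk : I.k ≤ I.n) : ∀ p ∈ select :: verify :: phases c, p.time σ.var ≤ p.coef * I.cost c := by
  intro p hp
  obtain ⟨h1, h2, h3⟩ := bounds_subset c p hp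
  exact time_le_cost p h1 h2 (fun x hx hxS => h.var_le hk x (h3 x hx hxS))
    (.inl h.matrix.S_eq.le)

theorem phases_wf (c : ℕ) : ∀ p ∈ phases c, p.wf = true := by
  simp only [phases, List.forall_mem_cons]
  refine ⟨?_, ?_, ?_, ?_, ?_, ?_, by simp⟩ <;> rfl

theorem phases_stable (c : ℕ) : stable (phases c) = true := rfl

theorem prepared_tabulate (I : Instance) (ω : ℕ → Bool) :
    Prepared I ω 0 (tabulate.run (countArcs.run (Store.ofState (I.start ω)))) ∧
      (tabulate.run (countArcs.run (Store.ofState (I.start ω)))).var .go = 1 := by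
  set σ := countArcs.run (Store.ofState (I.start ω)) with hσ
  have hn : σ.var .n = I.n := by rw [hσ, run_var rfl]; rfl
  have hk : σ.var .k = I.k := by rw [hσ, run_var rfl]; rfl
  have hb : σ.var .bound = I.bound := by rw [hσ, run_var rfl]; rfl
  have hE : σ.var .E = I.n * I.n * I.k := countArcs_spec _
  obtain ⟨h1, h2, h3, h4⟩ := tabulate_spec (σ := σ) (by rw [hE, hn, hk])
  rw [hn, hk] at h1
  refine ⟨⟨?_, ?_, ?_, ?_, h2, h1, ?_, ?_, ?_, ?_, ?_⟩, h3⟩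
  · rw [run_var rfl, hn]
  · rw [run_var rfl, hk]
  · rw [run_var rfl, hb]
  · rw [run_var rfl, hE]
  · intro e _
    rw [run_arr rfl, hσ, run_arr rfl]
    rfl
  · intro e he
    rw [h4 e (by rwa [hE]), hb, hσ, run_arr rfl, Instance.arcDen]
    have : (Store.ofState (I.start ω)).arr .snd e = (I.arcWeight e).elim 0 NNRat.den := rfl
    rw [this]
    cases I.arcWeight e with
    | none => simp
    | some w =>
      have := w.den_pos
      simp only [Option.elim_some]
      split_ifs <;> omega
  · intro u
    rw [run_arr rfl, hσ, run_arr rfl]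
    rfl
  · intro u
    rw [run_arr rfl, hσ, run_arr rfl]
    rfl
  · rw [run_coins rfl, hσ, run_coins rfl]
    rfl

/-- The search for the common denominator ends after the remaining `r` candidates. -/
theorem search_exec {I : Instance} {ω : ℕ → Bool} {T : ℕ}
    (hT : ∀ v : Var → ℕ, v .E = I.n * I.n * I.k → v .D ≤ I.commonDenom →
      nextDenom.time v + testDenom.time v ≤ T) (r d : ℕ) (hdr : d + r = I.commonDenom) {σ : Store}
    {s : State} (h : Prepared I ω d σ) (hgo : σ.var .go = if r = 0 then 0 else 1) (hs : Rep σ s) :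
    ∃ s' t σ', Exec (.loop Var.go.idx (.seq nextDenom.code testDenom.code)) s s' t ∧
      t ≤ 1 + r * (T + 1) ∧ Prepared I ω I.commonDenom σ' ∧ Rep σ' s' := by
  induction r generalizing d σ s with
  | zero =>
    obtain rfl : d = I.commonDenom := hdr
    exact ⟨s, 1, σ, .loopDone (by rw [hs.var, hgo]; rfl), by omega, h, hs⟩
  | succ r ih =>
    obtain ⟨s₁, t₁, e1, e2, e3⟩ := nextDenom.code_exec rfl hs
    obtain ⟨s₂, t₂, g1, g2, g3⟩ := testDenom.code_exec rfl e3
    set σ₁ := nextDenom.run σ with hσ₁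
    set σ₂ := testDenom.run σ₁ with hσ₂
    have v1 : ∀ {x}, nextDenom.writesVar x = false → testDenom.writesVar x = false →
        σ₂.var x = σ.var x := fun h1 h2 => by
      rw [hσ₂, run_var h2, hσ₁, run_var h1]
    have a1 : ∀ {a}, nextDenom.writesArr a = false → testDenom.writesArr a = false →
        σ₂.arr a = σ.arr a := fun h1 h2 => by
      rw [hσ₂, run_arr h2, hσ₁, run_arr h1]
    have hD : σ₁.var .D = d + 1 := by simp [hσ₁, nextDenom, h.D_eq]
    have hE : σ₁.var .E = I.n * I.n * I.k := by rw [hσ₁, run_var rfl, h.E_eq]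
    have hp : Prepared I ω (d + 1) σ₂ := by
      refine ⟨?_, ?_, ?_, ?_, ?_, ⟨?_, ?_, ?_, ?_⟩, ?_, ?_, ?_, ?_, ?_⟩
      · rw [v1 rfl rfl, h.n_eq]
      · rw [v1 rfl rfl, h.k_eq]
      · rw [v1 rfl rfl, h.bound_eq]
      · rw [v1 rfl rfl, h.E_eq]
      · rw [hσ₂, run_var rfl, hD]
      · rw [a1 rfl rfl]; exact h.tables.src
      · rw [a1 rfl rfl]; exact h.tables.dst
      · rw [a1 rfl rfl]; exact h.tables.col
      · rw [a1 rfl rfl]; exact h.tables.mir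
      · rw [a1 rfl rfl]; exact h.fst_eq
      · rw [a1 rfl rfl]; exact h.snd_eq
      · rw [a1 rfl rfl]; exact h.deg_eq
      · rw [a1 rfl rfl]; exact h.mark_eq
      · rw [hσ₂, run_coins rfl, hσ₁, run_coins rfl, h.coins_eq]
    have hiff : (∀ e < σ₁.var .E, σ₁.arr .snd e ≠ 0 → σ₁.arr .snd e ∣ σ₁.var .D) ↔ r = 0 := by
      have : σ₁.arr .snd = σ.arr .snd := by rw [hσ₁, run_arr rfl]
      rw [this, hE, hD]
      have h1 : (∀ e < I.n * I.n * I.k, σ.arr .snd e ≠ 0 → σ.arr .snd e ∣ d + 1) ↔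
          ∀ e < I.n * I.n * I.k, I.arcDen e ≠ 0 → I.arcDen e ∣ d + 1 :=
        forall₂_congr fun e he => by rw [h.snd_eq e he]
      rw [h1, I.dvd_iff]
      constructor
      · intro hdvd
        have := Nat.le_of_dvd (by omega) hdvd
        omega
      · rintro rfl
        exact dvd_of_eq (by omega)
    have hgo₂ : σ₂.var .go = if r = 0 then 0 else 1 := by
      rw [hσ₂, testDenom_spec, if_congr hiff rfl rfl]
    obtain ⟨s₃, t₃, σ₃, k1, k2, k3, k4⟩ := ih (d + 1) (by omega) hp hgo₂ g3
    refine ⟨s₃, _, σ₃, .loopStep ?_ (.seq e1 g1) k1, ?_, k3, k4⟩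
    · rw [hs.var, hgo]; simp
    · have h1 := hT σ₁.var hE (by omega)
      have h2 : nextDenom.time σ.var = nextDenom.time σ₁.var := rfl
      have h3 : (r + 1) * (T + 1) = r * (T + 1) + (T + 1) := by ring
      omega

/-- The constant factor in the running time of the algorithm. -/
def size (c : ℕ) : ℕ :=
  100 + countArcs.coef + tabulate.coef + (nextDenom.coef + testDenom.coef) +
    ((phases c).map coef).sum + select.coef + verify.coef

/-- The algorithm halts in time. Its final state is that of the abstract programs, from which
correctness follows. -/
theorem algorithm_exec (I : Instance) (c : ℕ) (ω : ℕ → Bool) (hk : I.k ≤ I.n) :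
    ∃ s t σ, Exec (algorithm c) (I.start ω) s t ∧ t ≤ size c * (I.rounds c ^ 5 * 2 ^ I.k) ∧
      Ready I c ω σ ∧ Rep (verify.run (select.run σ)) s := by
  set σ₀ := Store.ofState (I.start ω) with hσ₀
  obtain ⟨s₁, c1, c2, c3, -⟩ := (Exp.le (.get .k) (.get .n)).code_exec 0 (rep_ofState (I.start ω))
  obtain ⟨s₂, t₂, d1, d2, d3⟩ := countArcs.code_exec rfl c2
  obtain ⟨s₃, t₃, e1, e2, e3⟩ := tabulate.code_exec rfl d3
  obtain ⟨hp, hgo⟩ := prepared_tabulate I ω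
  rw [← hσ₀] at *
  have hDpos := I.commonDenom_pos
  -- bounds for the numbers of rounds, which the store after all phases provides
  have hle : ∀ x ∈ loopVars, ∀ y, (∀ σ, Ready I c ω σ → σ.var x = y) → y ≤ I.rounds c := by
    intro x hx y hy
    have hR : Ready I c ω ((phases c).foldl (fun σ p => p.run σ)
        ((tabulate.run (countArcs.run σ₀)).setVar .D I.commonDenom)) := by
      refine ready_phases ⟨?_, ?_, ?_, ?_, ?_, ⟨hp.tables.src,
        hp.tables.dst, hp.tables.col, hp.tables.mir⟩, hp.fst_eq, hp.snd_eq, hp.deg_eq,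
        hp.mark_eq, hp.coins_eq⟩ <;> simp [hp.n_eq, hp.k_eq, hp.bound_eq, hp.E_eq]
    rw [← hy _ hR]
    exact hR.var_le hk x hx
  have hn := hle .n (by simp [loopVars]) I.n fun σ h => h.matrix.n_eq
  have hkr := hle .k (by simp [loopVars]) I.k fun σ h => h.matrix.k_eq
  have hE := hle .E (by simp [loopVars]) _ fun σ h => h.matrix.E_eq
  have hD := hle .D (by simp [loopVars]) _ fun σ h => h.D_eq
  have hT : ∀ v : Var → ℕ, v .E = I.n * I.n * I.k → v .D ≤ I.commonDenom →
      nextDenom.time v + testDenom.time v ≤ (nextDenom.coef + testDenom.coef) * I.cost c := by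
    intro v hvE hvD
    rw [Nat.add_mul]
    refine Nat.add_le_add (time_le_cost _ (by decide) (by decide) ?_ (.inr (by decide)))
      (time_le_cost _ (by decide) (by decide) ?_ (.inr (by decide)))
    · intro x hx; simp [nextDenom, bounds] at hx
    · intro x hx _
      have : x = .E ∨ x = .D := by revert x; decide
      rcases this with rfl | rfl
      · exact hvE.trans_le hE
      · exact hvD.trans hD
  obtain ⟨s₄, t₄, σ₄, f1, f2, f3, f4⟩ := search_exec hT I.commonDenom 0 (by omega) hp
    (by rw [hgo, if_neg hDpos.ne']) e3
  have hR := ready_phases (c := c) f3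
  obtain ⟨s₅, t₅, g1, g2, g3⟩ := chain_exec (phases_wf c) f4 (stable_bounds (phases_stable c) σ₄)
  set σ₅ := (phases c).foldl (fun σ p => p.run σ) σ₄ with hσ₅
  obtain ⟨s₆, t₆, k1, k2, k3⟩ := select.code_exec rfl g3
  obtain ⟨s₇, t₇, l1, l2, l3⟩ := verify.code_exec rfl k3
  have hx : s₁.var (temp 0) ≠ 0 := by
    rw [c3, eval_le, eval_get, eval_get, if_pos (show σ₀.var .k ≤ σ₀.var .n from hk)]
    exact one_ne_zero
  refine ⟨s₇, _, σ₅, .seq c1 (.condTrue hx (.seq d1 (.seq e1 (.seq f1 (.seq g1 (.seq k1 l1)))))),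
    ?_, hR, l3⟩
  have b2 : countArcs.time σ₀.var ≤ countArcs.coef * I.cost c := by
    refine time_le_cost _ (by decide) (by decide) (fun x hx _ => ?_) (.inr (by decide))
    have : x = .n ∨ x = .k := by revert x; decide
    rcases this with rfl | rfl
    exacts [hn, hkr]
  have b3 : tabulate.time (countArcs.run σ₀).var ≤ tabulate.coef * I.cost c := by
    refine time_le_cost _ (by decide) (by decide) (fun x hx _ => ?_) (.inr (by decide))
    have : x = .n ∨ x = .k ∨ x = .E := by revert x; decide
    rcases this with rfl | rfl | rfl
    · rw [run_var rfl]; exact hn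
    · rw [run_var rfl]; exact hkr
    · rw [countArcs_spec]; exact hE
  have b5 : ((phases c).map fun p => p.time σ₅.var).sum ≤ ((phases c).map coef).sum * I.cost c := by
    rw [← List.sum_map_mul_right]
    exact List.sum_le_sum fun p hp => hR.time_le hk p (by simp [hp])
  have b6 := hR.time_le hk select (by simp)
  have b7 : verify.time (select.run σ₅).var ≤ verify.coef * I.cost c := by
    rw [verify.time_congr (v' := σ₅.var)]
    · exact hR.time_le hk verify (by simp)
    · intro x hx
      refine run_var ?_ _
      revert x; decide
  have hr := one_le_rounds I c
  have hcost : I.rounds c ^ 5 * 2 ^ I.k = I.rounds c * I.cost c := by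
    rw [Instance.cost]; ring
  have hC1 : 1 ≤ I.cost c := Nat.mul_pos (Nat.pow_pos hr) (Nat.two_pow_pos _)
  rw [hcost]
  set C := I.rounds c * I.cost c with hC
  have hCC : I.cost c ≤ C := Nat.le_mul_of_pos_left _ hr
  have hrC : I.rounds c ≤ C := Nat.le_mul_of_pos_right _ hC1
  have f2' : t₄ ≤ 1 + ((nextDenom.coef + testDenom.coef) * C + C) := by
    refine f2.trans ?_
    have : I.commonDenom * ((nextDenom.coef + testDenom.coef) * I.cost c + 1) ≤
        I.rounds c * ((nextDenom.coef + testDenom.coef) * I.cost c + 1) :=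
      Nat.mul_le_mul_right _ hD
    have h2 : I.rounds c * ((nextDenom.coef + testDenom.coef) * I.cost c + 1) =
      (nextDenom.coef + testDenom.coef) * C + I.rounds c := by rw [hC]; ring
    omega
  have m2 := Nat.mul_le_mul_left countArcs.coef hCC
  have m3 := Nat.mul_le_mul_left tabulate.coef hCC
  have m5 := Nat.mul_le_mul_left ((phases c).map coef).sum hCC
  have m6 := Nat.mul_le_mul_left select.coef hCC
  have m7 := Nat.mul_le_mul_left verify.coef hCC
  have hsize : (Exp.le (.get .k) (.get .n)).size = 7 := rfl
  have h1C : 1 ≤ C := hC1.trans hCC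
  have hexp : size c * C = 100 * C + countArcs.coef * C + tabulate.coef * C +
      (nextDenom.coef + testDenom.coef) * C + ((phases c).map coef).sum * C + select.coef * C +
      verify.coef * C := by rw [size]; ring
  omega

theorem algorithm_exec_of_lt (I : Instance) (c : ℕ) (ω : ℕ → Bool) (hk : I.n < I.k) :
    ∃ s t, Exec (algorithm c) (I.start ω) s t ∧ t ≤ 100 ∧ AnswersNo s := by
  obtain ⟨s₁, c1, c2, c3, -⟩ := (Exp.le (.get .k) (.get .n)).code_exec 0 (rep_ofState (I.start ω))
  obtain ⟨s₂, t₂, d1, d2, d3⟩ := (Stmt.set .n (.lit 0)).code_exec rfl c2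
  have hx : s₁.var (temp 0) = 0 := by
    rw [c3, eval_le, eval_get, eval_get, if_neg]
    exact not_le.2 hk
  refine ⟨s₂, _, .seq c1 (.condFalse hx d1), ?_, ?_⟩
  · have : (Exp.le (.get .k) (.get .n)).size = 7 := rfl
    have : (Stmt.set .n (.lit 0)).time (Store.ofState (I.start ω)).var = 3 := rfl
    omega
  · exact (d3.var .n).trans rfl

end Algorithm

/-! ### The probability of a wrong answer -/

/-- The first `E` blocks of `m` random bits each. -/
def blocks (E m : ℕ) (ω : ℕ → Bool) : Fin E → Fin m → Bool := fun e j => ω (j + e * m)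

open MeasureTheory in
/-- The event prescribes `E * m` of the bits. -/
theorem fairCoins_blocks_eq_le (E m : ℕ) (r : Fin E → Fin m → Bool) :
    fairCoins {ω | blocks E m ω = r} ≤ ((2 ^ m : ℝ≥0∞)⁻¹) ^ E := by
  -- the prescribed value of the bit `i`
  let g : ℕ → Bool := fun i =>
    if h : i / m < E ∧ i % m < m then r ⟨i / m, h.1⟩ ⟨i % m, h.2⟩ else false
  have hsub : {ω | blocks E m ω = r} ⊆ Set.pi (Finset.range (E * m)) fun i => {g i} := by
    rintro ω rfl i hi
    have hi : i < E * m := by simpa using hi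
    have hm : 0 < m := Nat.pos_of_ne_zero (by rintro rfl; simp at hi)
    have h : i / m < E ∧ i % m < m :=
      ⟨Nat.div_lt_of_lt_mul (by rwa [Nat.mul_comm]), Nat.mod_lt _ hm⟩
    simp only [g, dif_pos h, blocks, Set.mem_singleton_iff]
    rw [Nat.mod_add_div']
  refine (measure_mono hsub).trans_eq ?_
  rw [fairCoins, Measure.infinitePi_pi _ fun _ _ => measurableSet_singleton _]
  simp only [PMF.toMeasure_apply_singleton _ _ (measurableSet_singleton _),
    PMF.uniformOfFintype_apply, Fintype.card_bool, Finset.prod_const, Finset.card_range]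
  rw [Nat.mul_comm, pow_mul, ENNReal.inv_pow]
  rfl

open MeasureTheory in
theorem fairCoins_blocks_mem_le (E m : ℕ) (S : Finset (Fin E → Fin m → Bool)) :
    fairCoins {ω | blocks E m ω ∈ S} ≤ S.card * ((2 ^ m : ℝ≥0∞)⁻¹) ^ E := by
  have : {ω | blocks E m ω ∈ S} = ⋃ r ∈ S, {ω | blocks E m ω = r} := by
    ext ω; simp
  rw [this]
  refine (measure_biUnion_finset_le _ _).trans ?_
  refine (Finset.sum_le_sum fun r _ => fairCoins_blocks_eq_le E m r).trans_eq ?_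
  rw [Finset.sum_const, nsmul_eq_mul]

/-- The number with the given binary digits. -/
def blockVal (m : ℕ) (b : Fin m → Bool) : ℕ :=
  bitsVal (fun j => if h : j < m then b ⟨j, h⟩ else false) m

theorem blockVal_injective (m : ℕ) : Function.Injective (blockVal m) := by
  intro b b' h
  funext j
  have := bitsVal_inj h j j.2
  simpa using this

theorem blockVal_blocks (I : Instance) (c : ℕ) (ω : ℕ → Bool) {E : ℕ} (e : Fin E) :
    blockVal (I.arcBits c) (blocks E (I.arcBits c) ω e) = I.randomNumber c ω e :=
  bitsVal_congr fun j hj => by simp [hj, blocks]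

/-- The arcs of a solution as elements of a finite type. -/
def arcSet (I : Instance) (p : Equiv.Perm (Fin I.n) × (Fin I.n → Fin I.k)) :
    Finset (Fin (I.n * I.n * I.k)) :=
  Finset.univ.filter fun e => (e : ℕ) ∈ arcs p

theorem arcSet_injective (I : Instance) : Function.Injective (arcSet I) := by
  intro p q h
  refine arcs_injective (Finset.ext fun e => ?_)
  constructor
  · intro he
    have : (⟨e, arcs_lt he⟩ : Fin (I.n * I.n * I.k)) ∈ arcSet I q := by
      rw [← h]; simpa [arcSet] using he
    simpa [arcSet] using this
  · intro he
    have : (⟨e, arcs_lt he⟩ : Fin (I.n * I.n * I.k)) ∈ arcSet I p := by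
      rw [h]; simpa [arcSet] using he
    simpa [arcSet] using this

theorem sum_arcSet (I : Instance) (p : Equiv.Perm (Fin I.n) × (Fin I.n → Fin I.k)) (R : ℕ → ℕ) :
    ∑ e ∈ arcSet I p, R e = arcSum R p := by
  rw [← sum_arcs]
  refine Finset.sum_nbij (fun e => (e : ℕ)) ?_ ?_ ?_ ?_
  · intro e he; simpa [arcSet] using he
  · intro e _ e' _ h; exact Fin.ext h
  · intro e he; exact ⟨⟨e, arcs_lt he⟩, by simpa [arcSet] using he, rfl⟩
  · intro e _; rfl

open Classical in
/-- The random bits for which the lightest solution is not unique. -/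
noncomputable def badBlocks (I : Instance) (c : ℕ) :
    Finset (Fin (I.n * I.n * I.k) → Fin (I.arcBits c) → Bool) :=
  Finset.univ.filter fun R => ∃ p ∈ rainbow I.n I.k I.Allowed, ∃ p' ∈ rainbow I.n I.k I.Allowed,
    p ≠ p' ∧
    (∀ r ∈ rainbow I.n I.k I.Allowed, I.factor c * arcSum I.intWeight p +
      2 * ∑ i ∈ arcSet I p, blockVal (I.arcBits c) (R i) ≤ I.factor c * arcSum I.intWeight r +
      2 * ∑ i ∈ arcSet I r, blockVal (I.arcBits c) (R i)) ∧
    (∀ r ∈ rainbow I.n I.k I.Allowed, I.factor c * arcSum I.intWeight p' +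
      2 * ∑ i ∈ arcSet I p', blockVal (I.arcBits c) (R i) ≤ I.factor c * arcSum I.intWeight r +
      2 * ∑ i ∈ arcSet I r, blockVal (I.arcBits c) (R i))

/-- The isolation lemma for the random numbers of the arcs. -/
theorem card_badBlocks_mul_le (I : Instance) (c : ℕ) :
    (badBlocks I c).card * 2 ^ I.arcBits c ≤
      (I.n * I.n * I.k) * (2 ^ I.arcBits c) ^ (I.n * I.n * I.k) := by
  have := isolation (ι := Fin (I.n * I.n * I.k)) (blockVal (I.arcBits c))
    (blockVal_injective _) (rainbow I.n I.k I.Allowed : Set _) (arcSet I)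
    (arcSet_injective I).injOn (fun p => I.factor c * arcSum I.intWeight p) 2 two_pos
  simp only [Fintype.card_fun, Fintype.card_bool, Fintype.card_fin] at this
  convert this using 3
  ext R
  simp only [badBlocks, Finset.mem_filter, Finset.mem_univ, true_and, SetLike.mem_coe]

theorem arcSum_exponent_blocks (I : Instance) (c : ℕ) (ω : ℕ → Bool)
    {p : Equiv.Perm (Fin I.n) × (Fin I.n → Fin I.k)} (hp : p ∈ rainbow I.n I.k I.Allowed) :
    arcSum (I.exponent c ω) p = I.n * (I.span c * I.n) + (I.factor c * arcSum I.intWeight p +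
      2 * ∑ i ∈ arcSet I p, blockVal (I.arcBits c) (blocks _ (I.arcBits c) ω i)) := by
  simp only [blockVal_blocks]
  rw [I.arcSum_exponent c ω hp, sum_arcSet I p (I.randomNumber c ω), Nat.add_assoc]

/-- If the bits are not bad and there is a solution, then there is a unique lightest element of
`rainbow`, and it is a solution. -/
theorem exists_unique_lightest (I : Instance) (c : ℕ) (ω : ℕ → Bool)
    (hω : blocks (I.n * I.n * I.k) (I.arcBits c) ω ∉ badBlocks I c)
    {q : Equiv.Perm (Fin I.n) × (Fin I.n → Fin I.k)} (hq : q ∈ rainbow I.n I.k I.Allowed)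
    (hL : arcSum I.intWeight q ≤ I.scaledBound + I.scaledBound) :
    ∃ p ∈ rainbow I.n I.k I.Allowed, arcSum I.intWeight p ≤ I.scaledBound + I.scaledBound ∧
      ∀ r ∈ rainbow I.n I.k I.Allowed, r ≠ p →
        arcSum (I.exponent c ω) p < arcSum (I.exponent c ω) r := by
  classical
  obtain ⟨p, hp, hmin⟩ := (rainbow I.n I.k I.Allowed).exists_min_image
    (arcSum (I.exponent c ω)) ⟨q, hq⟩
  refine ⟨p, hp, ?_, fun r hr hrp => ?_⟩
  · -- the factor exceeds the random part of the exponents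
    by_contra hlt
    have h1 := hmin q hq
    rw [I.arcSum_exponent c ω hp, I.arcSum_exponent c ω hq] at h1
    have h2 := I.two_mul_arcSum_randomNumber_lt c ω q
    have h3 : I.factor c * (arcSum I.intWeight q + 1) ≤ I.factor c * arcSum I.intWeight p :=
      Nat.mul_le_mul_left _ (by omega)
    rw [Nat.mul_add, Nat.mul_one] at h3
    omega
  · by_contra hle
    refine hω (Finset.mem_filter.2 ⟨Finset.mem_univ _, p, hp, r, hr, hrp.symm,
      fun x hx => ?_, fun x hx => ?_⟩)
    · have := hmin x hx
      rw [arcSum_exponent_blocks I c ω hp, arcSum_exponent_blocks I c ω hx] at this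
      omega
    · have h1 := hmin x hx
      rw [arcSum_exponent_blocks I c ω hx] at h1
      rw [arcSum_exponent_blocks I c ω hr] at hle
      omega

/-- The choice of `arcBits` makes the probability of bad bits small enough. -/
theorem fairCoins_badBlocks_le (I : Instance) (c : ℕ) (hk : I.k ≤ I.n) :
    fairCoins {ω | blocks (I.n * I.n * I.k) (I.arcBits c) ω ∈ badBlocks I c} ≤
      1 / ((I.n + I.scaledBound : ℕ) : ℝ≥0∞) ^ c := by
  refine (fairCoins_blocks_mem_le _ _ _).trans ?_
  have hcard := card_badBlocks_mul_le I c
  have hE : (I.n * I.n * I.k) * (I.n + I.scaledBound) ^ c ≤ 2 ^ I.arcBits c := by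
    have hB : I.n + I.scaledBound + 1 ≤ 2 ^ Nat.clog 2 (I.n + I.scaledBound + 1) :=
      Nat.le_pow_clog one_lt_two _
    calc (I.n * I.n * I.k) * (I.n + I.scaledBound) ^ c
        ≤ (I.n + I.scaledBound + 1) ^ 3 * (I.n + I.scaledBound + 1) ^ c := by
          refine Nat.mul_le_mul ?_ (Nat.pow_le_pow_left (by omega) _)
          calc I.n * I.n * I.k ≤ (I.n + I.scaledBound + 1) * (I.n + I.scaledBound + 1) *
                (I.n + I.scaledBound + 1) :=
                Nat.mul_le_mul (Nat.mul_le_mul (by omega) (by omega)) (by omega)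
            _ = _ := by ring
      _ = (I.n + I.scaledBound + 1) ^ (c + 3) := by ring
      _ ≤ (2 ^ Nat.clog 2 (I.n + I.scaledBound + 1)) ^ (c + 3) := Nat.pow_le_pow_left hB _
      _ = 2 ^ I.arcBits c := by rw [← pow_mul, Instance.arcBits, Nat.mul_comm]
  generalize (badBlocks I c).card = a at *
  generalize I.n * I.n * I.k = E at *
  generalize I.arcBits c = m at *
  have hN0 : (2 ^ m : ℝ≥0∞) ≠ 0 := by positivity
  have hNt : (2 ^ m : ℝ≥0∞) ≠ ⊤ := by finiteness
  have h1 : (a : ℝ≥0∞) * 2 ^ m ≤ E * (2 ^ m) ^ E := by exact_mod_cast hcard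
  have h2 : (E : ℝ≥0∞) * ((I.n + I.scaledBound : ℕ) : ℝ≥0∞) ^ c ≤ 2 ^ m := by exact_mod_cast hE
  have h3 : (a : ℝ≥0∞) * ((2 ^ m : ℝ≥0∞)⁻¹) ^ E ≤ E / 2 ^ m := by
    rw [ENNReal.le_div_iff_mul_le (.inl hN0) (.inl hNt)]
    calc (a : ℝ≥0∞) * ((2 ^ m : ℝ≥0∞)⁻¹) ^ E * 2 ^ m = a * 2 ^ m * ((2 ^ m : ℝ≥0∞)⁻¹) ^ E := by ring
      _ ≤ E * (2 ^ m) ^ E * ((2 ^ m : ℝ≥0∞)⁻¹) ^ E := by gcongr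
      _ = E * ((2 ^ m) * (2 ^ m : ℝ≥0∞)⁻¹) ^ E := by rw [mul_assoc, ← mul_pow]
      _ = E := by rw [ENNReal.mul_inv_cancel hN0 hNt, one_pow, mul_one]
  refine h3.trans ?_
  rw [ENNReal.le_div_iff_mul_le (.inr one_ne_zero) (.inr ENNReal.one_ne_top)]
  rw [ENNReal.div_eq_inv_mul, mul_assoc]
  calc (2 ^ m : ℝ≥0∞)⁻¹ * (E * ((I.n + I.scaledBound : ℕ) : ℝ≥0∞) ^ c)
      ≤ (2 ^ m : ℝ≥0∞)⁻¹ * 2 ^ m := by gcongr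
    _ = 1 := ENNReal.inv_mul_cancel hN0 hNt

/-! ### The main result -/

/-- The algorithm only presents solutions. -/
theorem sound {I : Instance} {c : ℕ} {ω : ℕ → Bool} {σ : Store} {s : State}
    (h : Algorithm.Ready I c ω σ) (hs : Rep (Algorithm.verify.run (Algorithm.select.run σ)) s) :
    AnswersNo s ∨ ∃ R : PerfectMatching I, R.IsSolution ∧ Presents s R := by
  have hvar : s.var 0 = (Algorithm.verify.run (Algorithm.select.run σ)).var .n := hs.var .n
  rcases Algorithm.finish_sound h with h0 | ⟨h1, p, hp, hL, hout⟩
  · exact .inl (hvar.trans h0)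
  · obtain ⟨R, hR⟩ := exists_encodes_of_mem hp
    refine .inr ⟨R, hR.isSolution_iff.2 hL, hvar.trans h1, fun v w hvw => ?_⟩
    have h2 : s.arr 0 v = _ := congrFun (hs.arr .fst) v
    have h3 : s.arr 1 v = _ := congrFun (hs.arr .snd) v
    rw [h2, h3, (hout v).1, (hout v).2, hR.color_eq v w hvw, (hR.adj_iff v w).1 hvw]
    exact ⟨rfl, rfl⟩

/-- A solution is missed only if the random bits are bad. -/
theorem answersNo_subset {I : Instance} (c : ℕ) (hk : I.k ≤ I.n)
    (hsol : ∃ R : PerfectMatching I, R.IsSolution) :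
    {ω | ∃ (s : State) (t : ℕ), Exec (algorithm c) (I.start ω) s t ∧ AnswersNo s} ⊆
      {ω | blocks (I.n * I.n * I.k) (I.arcBits c) ω ∈ badBlocks I c} := by
  rintro ω ⟨s, t, hexec, hno⟩
  by_contra hω
  obtain ⟨R, hR⟩ := hsol
  obtain ⟨q, hq⟩ := exists_encodes R
  obtain ⟨p, hp, hL, hmin⟩ := exists_unique_lightest I c ω hω (hq.mem_rainbow hR)
    (hq.isSolution_iff.1 hR)
  obtain ⟨s', t', σ, hexec', -, hready, hrep⟩ := Algorithm.algorithm_exec I c ω hk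
  obtain ⟨rfl, -⟩ := hexec.deterministic hexec'
  have h1 : s.var 0 = _ := hrep.var .n
  rw [Algorithm.finish_complete hready hp hL hmin] at h1
  rw [AnswersNo, h1] at hno
  exact one_ne_zero hno

theorem colors_le_of_matching {I : Instance} (R : PerfectMatching I) : I.k ≤ I.n := by
  obtain ⟨p, hp⟩ := exists_encodes R
  simpa using Fintype.card_le_of_surjective p.2 hp.surjective

end RainbowMatching

open RainbowMatching in
/-- For each `c` there is a randomized program that, on each instance and for each outcome of its
random bits, halts within `2 ^ k * n ^ O(1) * L ^ O(1)` steps, where `n` is the number of vertices,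
`k` the number of colors, and `L` the bound on the weight after the weights have been scaled to
integers; it then either answers "no" or presents a perfect over-the-rainbow matching of weight at
most the bound; and if such a matching exists, it answers "no" with probability at most
`1 / (n + L) ^ c`. -/
theorem theorem2 :
    ∀ c : ℕ, ∃ (P : Prog) (A b : ℕ), ∀ I : Instance,
      (∀ ω : ℕ → Bool, ∃ (s : State) (t : ℕ), Exec P (I.start ω) s t ∧
        t ≤ A * 2 ^ I.k * (I.n + 1) ^ b * (I.scaledBound + 1) ^ b ∧
        (AnswersNo s ∨ ∃ R : PerfectMatching I, R.IsSolution ∧ Presents s R)) ∧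
      ((∃ R : PerfectMatching I, R.IsSolution) →
        fairCoins {ω | ∃ (s : State) (t : ℕ), Exec P (I.start ω) s t ∧ AnswersNo s} ≤
          1 / ((I.n + I.scaledBound : ℕ) : ℝ≥0∞) ^ c) := by
  intro c
  refine ⟨algorithm c, 100 + Algorithm.size c * (9 * (c + 4) * 2 ^ (c + 3)) ^ 5,
    5 * (c + 8), fun I => ⟨fun ω => ?_, fun hsol => ?_⟩⟩
  · have hpos : 1 ≤ 2 ^ I.k * (I.n + 1) ^ (5 * (c + 8)) * (I.scaledBound + 1) ^ (5 * (c + 8)) :=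
      Nat.one_le_iff_ne_zero.2 (by positivity)
    rw [Nat.mul_assoc, Nat.mul_assoc, Nat.add_mul, ← Nat.mul_assoc (2 ^ I.k)]
    rcases Nat.lt_or_ge I.n I.k with hk | hk
    · obtain ⟨s, t, h1, h2, h3⟩ := Algorithm.algorithm_exec_of_lt I c ω hk
      refine ⟨s, t, h1, h2.trans ?_, .inl h3⟩
      exact (Nat.le_mul_of_pos_right _ hpos).trans (Nat.le_add_right _ _)
    · obtain ⟨s, t, σ, h1, h2, h3, h4⟩ := Algorithm.algorithm_exec I c ω hk
      refine ⟨s, t, h1, h2.trans ?_, sound h3 h4⟩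
      refine le_trans (le_of_eq ?_) (Nat.le_add_left _ _)
      rw [Instance.rounds, mul_pow 2]
      generalize I.scaledBound + 1 = l
      generalize I.n + 1 = n
      generalize Algorithm.size c = C
      rw [mul_pow, mul_pow, mul_pow, mul_pow, mul_pow n l, mul_pow n l]
      ring
  · obtain ⟨R, hR⟩ := hsol
    have hk := colors_le_of_matching R
    exact (MeasureTheory.measure_mono (answersNo_subset c hk ⟨R, hR⟩)).trans
      (fairCoins_badBlocks_le I c hk)
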